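/- **Conventions.** All groupoids $G$ are second countable, locally compact, Hausdorff topological groupoids with unit space $G^{(0)}$ and range and source maps $r,s\colon G\to G^{(0)}$; $\gamma\eta$ is defined when $s(\gamma)=r(\eta)$. A *family of measures* along a map $p\colon X\to B$ is a family $(m_b)_{b\in B}$ of Radon measures on $X$ with $\operatorname{supp} m_b=p^{-1}(b)$ such that $b\mapsto\int f\,dm_b$ is continuous for every $f\in C_c(X)$. A *Haar system* $\alpha=(\alpha^u)_{u\in G^{(0)}}$ on $G$ is a left invariant family of measures along $r$. A *topological correspondence* $(X,\lambda)\colon(G,\alpha)\to(H,\beta)$ consists of a second countable locally compact Hausdorff space $X$ with commuting continuous actions of $G$ from the left (momentum map $r_X\colon X\to G^{(0)}$) and of $H$ from the right (momentum map $s_X\colon X\to H^{(0)}$), the action of $H$ being proper, an $H$-invariant family of measures $\lambda$ along $s_X$, and a continuous function $\Delta\colon G\ltimes X\to(0,\infty)$ (the adjoining function) such that for all $u\in H^{(0)}$ and $F\in C_c(G\ltimes X)$ $$\int_X\!\int_{G} F(\gamma^{-1},x)\,d\alpha^{r_X(x)}(\gamma)\,d\lambda_u(x)=\int_X\!\int_{G}F(\gamma,\gamma^{-1}x)\,\Delta(\gamma,\gamma^{-1}x)\,d\alpha^{r_X(x)}(\gamma)\,d\lambda_u(x).$$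 The *identity correspondence* of $(G,\alpha)$ is $X=G$ with left and right multiplication, $\lambda=\alpha^{-1}$ (the image of $\alpha$ under inversion) and $\Delta=1$. An *isomorphism* $(X,\lambda)\to(X',\lambda')$ of correspondences from $(G,\alpha)$ to $(H,\beta)$ is a $G$-$H$-equivariant homeomorphism $\phi\colon X\to X'$ for which there is a continuous function $h\colon X'\to(0,\infty)$ with $\phi_*\lambda_u=h\,\lambda'_u$ for all $u\in H^{(0)}$. Let $(X,\lambda)\colon(G_1,\chi_1)\to(G_2,\chi_2)$ and $(Y,\beta)\colon(G_2,\chi_2)\to(G_3,\chi_3)$ be correspondences with adjoining functions $\Delta_1,\Delta_2$, and let $Z=X\times_{G_2^{(0)}}Y=\{(x,y):s_X(x)=r_Y(y)\}$ with the diagonal action $(x,y)\gamma=(x\gamma,\gamma^{-1}y)$ of $G_2$. A *composite* of them is a correspondence $(\Omega,\mu)\colon(G_1,\chi_1)\to(G_3,\chi_3)$ on the quotient space $\Omega=Z/G_2$, with the momentum maps and actions induced by those of $G_1$ on $X$ and of $G_3$ on $Y$, for which there is a continuous $b\colon Z\to(0,\infty)$ with $b(x,y\eta)=b(x,y)$ for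 $\eta\in G_3$ and $b(x\gamma,\gamma^{-1}y)/b(x,y)=\Delta_2(\gamma^{-1},y)$ for $\gamma\in G_2$, such that for all $u\in G_3^{(0)}$ and $f\in C_c(Z)$ $$\int_\Omega\int_{G_2} f(x\gamma,\gamma^{-1}y)\,d\chi_2^{r_Y(y)}(\gamma)\,d\mu_u([x,y])=\int_Y\int_X b(x,y)f(x,y)\,d\lambda_{r_Y(y)}(x)\,d\beta_u(y).$$ **Theorem.** The identity correspondence of every $(G,\alpha)$ is a topological correspondence, and any two composable correspondences have a composite. Moreover, for every choice of one composite $P\circ Q\colon G\to K$ for each pair of composable correspondences $P\colon G\to H$, $Q\colon H\to K$ (written in this order), the following data form a bicategory $\mathfrak T$: - objects: second countable locally compact Hausdorff groupoids with Haar systems; - 1-arrows: topological correspondences, composed by the chosen composites, with the identity correspondences as identity 1-arrows; - 2-arrows: isomorphisms of correspondences, with composition of maps as vertical composition and identity maps as identities; - horizontal composition (a functor in both variables): $\phi\cdot_h\psi\colon[x,y]\mapsto[\phi(x),\psi(y)]$; - associativity isomorphisms: $(P\circ Q)\circ R\to P\circ(Q\circ R)$, $[[x,y],z]\mapsto[x,[y,z]]$;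 - left and right identity isomorphisms: $[\gamma,x]\mapsto\gamma x$ and $[x,\gamma]\mapsto x\gamma$. In particular, all these maps are well defined 2-arrows, the associativity and identity isomorphisms are natural, and the pentagon and triangle coherence conditions hold. -/

import Mathlib

open MeasureTheory CategoryTheory Topology
open scoped CompactlySupported Classical

universe w v u

noncomputable section

/-! ### Families of measures -/

/-- A continuous family of Radon measures with full support along `p : X → B`:
the measure `m b` is finite on compact sets (on the second countable, locally compact Hausdorff
spaces used below, such Borel measures are exactly the Radon measures), its support is the fibre
`p ⁻¹' {b}`, and `b ↦ ∫ f d(m b)` is continuous for every compactly supported continuous `f`. -/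
structure IsMeasureFamily {X B : Type*} [TopologicalSpace X] [TopologicalSpace B]
    [MeasurableSpace X] (p : X → B) (m : B → Measure X) : Prop where
  finiteOnCompacts : ∀ b, IsFiniteMeasureOnCompacts (m b)
  support_eq : ∀ b, (m b).support = p ⁻¹' {b}
  continuous_integral : ∀ f : C_c(X, ℝ), Continuous fun b => ∫ x, f x ∂(m b)

/-- Two families of measures `m`, `n` are continuously equivalent: for all `b` the measures `m b`
and `n b` are equivalent, and their Radon-Nikodym derivatives `d(m b)/d(n b)` are given by one
continuous, strictly positive function on the total space. (Mutual absolute continuity follows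
from the positivity of the density.) -/
def ContEquivalent {X B : Type*} [TopologicalSpace X] [MeasurableSpace X]
    (m n : B → Measure X) : Prop :=
  ∃ h : X → ℝ, Continuous h ∧ (∀ x, 0 < h x) ∧
    ∀ b, m b = (n b).withDensity fun x => ENNReal.ofReal (h x)

/-! ### Groupoids with Haar systems -/

/-- A second countable, locally compact, Hausdorff topological groupoid, with space of units `Obj`,
space of arrows `Arr`, range map `rng`, source map `src`; the product `g h` is defined when
`src g = rng h`. The unit map identifies `Obj` with a closed subspace of `Arr`. -/
structure LCGroupoid : Type (u + 1) where
  Obj : Type u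
  Arr : Type u
  [topObj : TopologicalSpace Obj]
  [topArr : TopologicalSpace Arr]
  [t2 : T2Space Arr]
  [locallyCompact : LocallyCompactSpace Arr]
  [secondCountable : SecondCountableTopology Arr]
  rng : Arr → Obj
  src : Arr → Obj
  one : Obj → Arr
  inv : Arr → Arr
  mul : src.Pullback rng → Arr
  continuous_rng : Continuous rng
  continuous_src : Continuous src
  continuous_one : Continuous one
  continuous_inv : Continuous inv
  continuous_mul : Continuous mul
  rng_one : ∀ a, rng (one a) = a
  src_one : ∀ a, src (one a) = a
  rng_inv : ∀ g, rng (inv g) = src g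
  src_inv : ∀ g, src (inv g) = rng g
  rng_mul : ∀ p, rng (mul p) = rng p.1.1
  src_mul : ∀ p, src (mul p) = src p.1.2
  one_mul : ∀ g (h : src (one (rng g)) = rng g), mul ⟨(one (rng g), g), h⟩ = g
  mul_one : ∀ g (h : src g = rng (one (src g))), mul ⟨(g, one (src g)), h⟩ = g
  mul_inv : ∀ g (h : src g = rng (inv g)), mul ⟨(g, inv g), h⟩ = one (rng g)
  inv_mul : ∀ g (h : src (inv g) = rng g), mul ⟨(inv g, g), h⟩ = one (src g)
  mul_assoc : ∀ g k l (h₁ : src g = rng k) (h₂ : src k = rng l)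
    (h₃ : src (mul ⟨(g, k), h₁⟩) = rng l) (h₄ : src g = rng (mul ⟨(k, l), h₂⟩)),
    mul ⟨(mul ⟨(g, k), h₁⟩, l), h₃⟩ = mul ⟨(g, mul ⟨(k, l), h₂⟩), h₄⟩

attribute [instance] LCGroupoid.topObj LCGroupoid.topArr LCGroupoid.t2
  LCGroupoid.locallyCompact LCGroupoid.secondCountable

/-- A second countable, locally compact, Hausdorff groupoid with a (left invariant, continuous)
Haar system `haar`, a family of measures along the range map. -/
structure HaarGroupoid : Type (u + 1) extends LCGroupoid.{u} where
  [measArr : MeasurableSpace Arr]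
  [borelArr : BorelSpace Arr]
  haar : Obj → Measure Arr
  haar_family : IsMeasureFamily rng haar
  haar_invariant : ∀ (g : Arr) (f : C_c(Arr, ℝ)),
    ∫ k, (if h : src g = rng k then f (mul ⟨(g, k), h⟩) else 0) ∂(haar (src g)) =
      ∫ k, f k ∂(haar (rng g))

attribute [instance] HaarGroupoid.measArr HaarGroupoid.borelArr

/-! ### Topological correspondences -/

/-- The structure of a topological correspondence from `G` to `H` on the space `X`: commuting
actions of `G` from the left along `lmom` and of `H` from the right along `rmom`, the latter one
proper, an `H`-invariant continuous family of measures `meas` along `rmom`, and the adjoining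
function `adj` on the transformation groupoid `G ⋉ X`. -/
structure CorrOn (G H : HaarGroupoid.{u}) (X : Type u) [TopologicalSpace X]
    [MeasurableSpace X] : Type u where
  borel : BorelSpace X
  t2 : T2Space X
  locallyCompact : LocallyCompactSpace X
  secondCountable : SecondCountableTopology X
  lmom : X → G.Obj
  rmom : X → H.Obj
  lact : G.src.Pullback lmom → X
  ract : rmom.Pullback H.rng → X
  continuous_lmom : Continuous lmom
  continuous_rmom : Continuous rmom
  continuous_lact : Continuous lact
  continuous_ract : Continuous ract
  lmom_lact : ∀ p, lmom (lact p) = G.rng p.1.1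
  rmom_lact : ∀ p, rmom (lact p) = rmom p.1.2
  rmom_ract : ∀ p, rmom (ract p) = H.src p.1.2
  lmom_ract : ∀ p, lmom (ract p) = lmom p.1.1
  lact_one : ∀ x (h : G.src (G.one (lmom x)) = lmom x), lact ⟨(G.one (lmom x), x), h⟩ = x
  ract_one : ∀ x (h : rmom x = H.rng (H.one (rmom x))), ract ⟨(x, H.one (rmom x)), h⟩ = x
  lact_mul : ∀ g k x (h₁ : G.src g = G.rng k) (h₂ : G.src k = lmom x)
    (h₃ : G.src (G.mul ⟨(g, k), h₁⟩) = lmom x) (h₄ : G.src g = lmom (lact ⟨(k, x), h₂⟩)),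
    lact ⟨(G.mul ⟨(g, k), h₁⟩, x), h₃⟩ = lact ⟨(g, lact ⟨(k, x), h₂⟩), h₄⟩
  ract_mul : ∀ x g k (h₁ : rmom x = H.rng g) (h₂ : H.src g = H.rng k)
    (h₃ : rmom x = H.rng (H.mul ⟨(g, k), h₂⟩)) (h₄ : rmom (ract ⟨(x, g), h₁⟩) = H.rng k),
    ract ⟨(x, H.mul ⟨(g, k), h₂⟩), h₃⟩ = ract ⟨(ract ⟨(x, g), h₁⟩, k), h₄⟩
  lact_ract : ∀ g x k (h₁ : G.src g = lmom x) (h₂ : rmom x = H.rng k)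
    (h₃ : rmom (lact ⟨(g, x), h₁⟩) = H.rng k) (h₄ : G.src g = lmom (ract ⟨(x, k), h₂⟩)),
    ract ⟨(lact ⟨(g, x), h₁⟩, k), h₃⟩ = lact ⟨(g, ract ⟨(x, k), h₂⟩), h₄⟩
  /-- the action of `H` is proper -/
  proper : IsProperMap fun p : rmom.Pullback H.rng => (ract p, p.1.1)
  meas : H.Obj → Measure X
  meas_family : IsMeasureFamily rmom meas
  meas_invariant : ∀ (k : H.Arr) (f : C_c(X, ℝ)),
    ∫ x, (if h : rmom x = H.rng k then f (ract ⟨(x, k), h⟩) else 0) ∂(meas (H.rng k)) =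
      ∫ x, f x ∂(meas (H.src k))
  adj : G.src.Pullback lmom → ℝ
  continuous_adj : Continuous adj
  adj_pos : ∀ p, 0 < adj p
  /-- `∫∫ F(γ⁻¹, x) dα(γ) dλ_u(x) = ∫∫ F(γ, γ⁻¹ x) Δ(γ, γ⁻¹ x) dα(γ) dλ_u(x)`, where the inner
  integrals are over all arrows `γ` with range the left momentum of `x` -/
  adj_eq : ∀ (a : H.Obj) (F : C_c(G.src.Pullback lmom, ℝ)),
    ∫ x, ∫ γ, (if h : G.rng γ = lmom x then
        F ⟨(G.inv γ, x), (G.src_inv γ).trans h⟩ else 0) ∂(G.haar (lmom x)) ∂(meas a) =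
    ∫ x, ∫ γ, (if h : G.rng γ = lmom x then
        F ⟨(γ, lact ⟨(G.inv γ, x), (G.src_inv γ).trans h⟩),
            ((lmom_lact _).trans (G.rng_inv γ)).symm⟩ *
          adj ⟨(γ, lact ⟨(G.inv γ, x), (G.src_inv γ).trans h⟩),
            ((lmom_lact _).trans (G.rng_inv γ)).symm⟩
      else 0) ∂(G.haar (lmom x)) ∂(meas a)

/-- A topological correspondence from `G` to `H`. -/
structure Corr (G H : HaarGroupoid.{u}) : Type (u + 1) where
  carrier : Type u
  [top : TopologicalSpace carrier]
  [measurableSpace : MeasurableSpace carrier]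
  str : CorrOn G H carrier

attribute [instance] Corr.top Corr.measurableSpace

/-- The identity correspondence `(G, α⁻¹)`: the space of arrows with left and right
multiplication, the image `α⁻¹` of the Haar system under inversion, a family along the source map,
and the constant adjoining function `1`. All data are prescribed; the content of an
element is that they form a correspondence. -/
structure IdCorr (G : HaarGroupoid.{u}) : Type u extends CorrOn G G G.Arr where
  lmom_eq : ∀ x, lmom x = G.rng x
  rmom_eq : ∀ x, rmom x = G.src x
  lact_eq : ∀ g x (h : G.src g = lmom x) (h' : G.src g = G.rng x),
    lact ⟨(g, x), h⟩ = G.mul ⟨(g, x), h'⟩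
  ract_eq : ∀ x g (h : rmom x = G.rng g) (h' : G.src x = G.rng g),
    ract ⟨(x, g), h⟩ = G.mul ⟨(x, g), h'⟩
  meas_eq : ∀ a, meas a = (G.haar a).map G.inv
  adj_eq_one : ∀ p, adj p = 1

/-- The identity correspondence, bundled. -/
abbrev IdCorr.toCorr {G : HaarGroupoid.{u}} (I : IdCorr G) : Corr G G where
  carrier := G.Arr
  str := I.toCorrOn

/-! ### 2-arrows -/

/-- An isomorphism of correspondences: a `G`-`H`-equivariant homeomorphism `φ` such that
the family of push-forward measures is continuously equivalent to the target family. -/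
structure CorrIso {G H : HaarGroupoid.{u}} (P Q : Corr G H) : Type u where
  φ : P.carrier ≃ₜ Q.carrier
  lmom_map : ∀ x, Q.str.lmom (φ x) = P.str.lmom x
  rmom_map : ∀ x, Q.str.rmom (φ x) = P.str.rmom x
  lact_map : ∀ g x (h : G.src g = P.str.lmom x) (h' : G.src g = Q.str.lmom (φ x)),
    φ (P.str.lact ⟨(g, x), h⟩) = Q.str.lact ⟨(g, φ x), h'⟩
  ract_map : ∀ x k (h : P.str.rmom x = H.rng k) (h' : Q.str.rmom (φ x) = H.rng k),
    φ (P.str.ract ⟨(x, k), h⟩) = Q.str.ract ⟨(φ x, k), h'⟩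
  equivalent : ContEquivalent (fun a => (P.str.meas a).map φ) Q.str.meas

theorem CorrIso.ext {G H : HaarGroupoid.{u}} {P Q : Corr G H} {η θ : CorrIso P Q}
    (h : ∀ x, η.φ x = θ.φ x) : η = θ := by
  obtain ⟨a, _, _, _, _, _⟩ := η
  obtain ⟨b, _, _, _, _, _⟩ := θ
  obtain rfl : a = b := Homeomorph.ext h
  rfl

/-- The identity 2-arrow. -/
def CorrIso.refl {G H : HaarGroupoid.{u}} (P : Corr G H) : CorrIso P P where
  φ := Homeomorph.refl _
  lmom_map _ := rfl
  rmom_map _ := rfl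
  lact_map _ _ _ _ := rfl
  ract_map _ _ _ _ := rfl
  equivalent := ⟨fun _ => 1, continuous_const, fun _ => one_pos, fun b => by
    simp only [Homeomorph.refl_apply, ENNReal.ofReal_one]
    rw [show (fun _ : P.carrier => (1 : ENNReal)) = 1 from rfl, withDensity_one]
    exact Measure.map_id⟩

/-- Vertical composition of 2-arrows: composition of maps. -/
def CorrIso.trans {G H : HaarGroupoid.{u}} {P Q R : Corr G H}
    (η : CorrIso P Q) (θ : CorrIso Q R) : CorrIso P R where
  φ := η.φ.trans θ.φ
  lmom_map x := (θ.lmom_map _).trans (η.lmom_map x)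
  rmom_map x := (θ.rmom_map _).trans (η.rmom_map x)
  lact_map g x h h' :=
    (congrArg θ.φ (η.lact_map g x h (h.trans (η.lmom_map x).symm))).trans
      (θ.lact_map g (η.φ x) _ h')
  ract_map x k h h' :=
    (congrArg θ.φ (η.ract_map x k h ((η.rmom_map x).trans h))).trans
      (θ.ract_map (η.φ x) k _ h')
  equivalent := by
    have := P.str.borel
    have := Q.str.borel
    have := R.str.borel
    obtain ⟨h₁, hc₁, hp₁, he₁⟩ := η.equivalent
    obtain ⟨h₂, hc₂, hp₂, he₂⟩ := θ.equivalent
    refine ⟨fun x => h₂ x * h₁ (θ.φ.symm x), hc₂.mul (hc₁.comp θ.φ.symm.continuous),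
      fun x => mul_pos (hp₂ x) (hp₁ _), fun b => ?_⟩
    have e₁ : (P.str.meas b).map η.φ = _ := he₁ b
    have e₂ : (Q.str.meas b).map θ.φ = _ := he₂ b
    have hm₁ : Measurable fun x => ENNReal.ofReal (h₁ x) := hc₁.measurable.ennreal_ofReal
    have hm₂ : Measurable fun x => ENNReal.ofReal (h₂ x) := hc₂.measurable.ennreal_ofReal
    have hm₃ : Measurable fun x => ENNReal.ofReal (h₁ (θ.φ.symm x)) :=
      hm₁.comp θ.φ.symm.continuous.measurable
    have e₃ : (P.str.meas b).map (η.φ.trans θ.φ) = ((P.str.meas b).map η.φ).map θ.φ :=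
      (Measure.map_map θ.φ.continuous.measurable η.φ.continuous.measurable).symm
    have e₄ : (fun x => ENNReal.ofReal (h₂ x * h₁ (θ.φ.symm x))) =
        (fun x => ENNReal.ofReal (h₂ x)) * fun x => ENNReal.ofReal (h₁ (θ.φ.symm x)) := by
      funext x
      exact ENNReal.ofReal_mul (hp₂ x).le
    show (P.str.meas b).map (η.φ.trans θ.φ) = _
    rw [e₃, e₁, e₄, withDensity_mul _ hm₂ hm₃, ← e₂]
    ext s hs
    rw [Measure.map_apply θ.φ.continuous.measurable hs,
      withDensity_apply _ (θ.φ.continuous.measurable hs), withDensity_apply _ hs,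
      setLIntegral_map hs hm₃ θ.φ.continuous.measurable]
    simp

/-- The category of correspondences from `G` to `H` and their isomorphisms. -/
instance corrCategory (G H : HaarGroupoid.{u}) : Category.{u} (Corr G H) where
  Hom P Q := CorrIso P Q
  id P := CorrIso.refl P
  comp η θ := CorrIso.trans η θ

/-- The map of spaces underlying a 2-arrow. -/
abbrev mapOf {G H : HaarGroupoid.{u}} {P Q : Corr G H} (η : P ⟶ Q) : P.carrier → Q.carrier :=
  (CorrIso.φ η : P.carrier ≃ₜ Q.carrier)

/-! ### Composites -/

section Composite

variable {G H K : HaarGroupoid.{u}}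

/-- The fibre product of the spaces of `P` and `Q` over the units of `H`. -/
abbrev FibProd (P : Corr G H) (Q : Corr H K) : Type u := P.str.rmom.Pullback Q.str.lmom

/-- The diagonal action `(x, y) γ = (x γ, γ⁻¹ y)` of `H` on the fibre product. -/
def diagAct {P : Corr G H} {Q : Corr H K} (z : FibProd P Q) (γ : H.Arr)
    (h : P.str.rmom z.1.1 = H.rng γ) : FibProd P Q :=
  ⟨(P.str.ract ⟨(z.1.1, γ), h⟩,
    Q.str.lact ⟨(H.inv γ, z.1.2), (H.src_inv γ).trans (h.symm.trans z.2)⟩),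
    by rw [P.str.rmom_ract, Q.str.lmom_lact, H.rng_inv]⟩

theorem CorrOn.lact_congr {X : Type u} [TopologicalSpace X] [MeasurableSpace X]
    (S : CorrOn G H X) {g g' : G.Arr} {x x' : X} (hg : g = g') (hx : x = x')
    (h : G.src g = S.lmom x) (h' : G.src g' = S.lmom x') :
    S.lact ⟨(g, x), h⟩ = S.lact ⟨(g', x'), h'⟩ := by
  subst hg hx
  rfl

theorem CorrOn.ract_congr {X : Type u} [TopologicalSpace X] [MeasurableSpace X]
    (S : CorrOn G H X) {k k' : H.Arr} {x x' : X} (hk : k = k') (hx : x = x')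
    (h : S.rmom x = H.rng k) (h' : S.rmom x' = H.rng k') :
    S.ract ⟨(x, k), h⟩ = S.ract ⟨(x', k'), h'⟩ := by
  subst hk hx
  rfl

/-- `g⁻¹ x = x'` if and only if `x = g x'`. -/
theorem CorrOn.lact_inv_eq_iff {X : Type u} [TopologicalSpace X] [MeasurableSpace X]
    (S : CorrOn G H X) (g : G.Arr) (x x' : X) (h : G.src (G.inv g) = S.lmom x)
    (h' : G.src g = S.lmom x') :
    S.lact ⟨(G.inv g, x), h⟩ = x' ↔ x = S.lact ⟨(g, x'), h'⟩ := by
  have hr : G.rng g = S.lmom x := (G.src_inv g).symm.trans h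
  constructor
  · rintro rfl
    have e₁ : G.src g = G.rng (G.inv g) := (G.rng_inv g).symm
    rw [← S.lact_mul g (G.inv g) x e₁ h (by rw [G.src_mul]; exact h) h']
    rw [S.lact_congr ((G.mul_inv g e₁).trans (congrArg G.one hr)) rfl _ (G.src_one _)]
    exact (S.lact_one x _).symm
  · rintro rfl
    have e₁ : G.src (G.inv g) = G.rng g := G.src_inv g
    rw [← S.lact_mul (G.inv g) g x' e₁ h' (by rw [G.src_mul]; exact h') h]
    rw [S.lact_congr ((G.inv_mul g e₁).trans (congrArg G.one h')) rfl _ (G.src_one _)]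
    exact S.lact_one x' _

theorem eq_diagAct_iff {P : Corr G H} {Q : Corr H K} (z z' : FibProd P Q) (γ : H.Arr)
    (h : P.str.rmom z.1.1 = H.rng γ) (h' : H.src γ = Q.str.lmom z'.1.2) :
    z' = diagAct z γ h ↔
      z'.1.1 = P.str.ract ⟨(z.1.1, γ), h⟩ ∧ z.1.2 = Q.str.lact ⟨(γ, z'.1.2), h'⟩ := by
  rw [← Q.str.lact_inv_eq_iff γ z.1.2 z'.1.2 ((H.src_inv γ).trans (h.symm.trans z.2)) h',
    Subtype.ext_iff, Prod.ext_iff]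
  exact and_congr Iff.rfl eq_comm

theorem src_eq_of_eq_diagAct {P : Corr G H} {Q : Corr H K} {z z' : FibProd P Q} {γ : H.Arr}
    {h : P.str.rmom z.1.1 = H.rng γ} (e : z' = diagAct z γ h) :
    H.src γ = Q.str.lmom z'.1.2 := by
  subst e
  rw [diagAct, Q.str.lmom_lact, H.rng_inv]

/-- Being in the same orbit of the diagonal action. -/
def orbitSetoid (P : Corr G H) (Q : Corr H K) : Setoid (FibProd P Q) where
  r z z' := ∃ (γ : H.Arr) (h : P.str.rmom z.1.1 = H.rng γ), z' = diagAct z γ h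
  iseqv := by
    refine ⟨fun z => ?_, ?_, ?_⟩
    · refine ⟨H.one (P.str.rmom z.1.1), (H.rng_one _).symm, ?_⟩
      rw [eq_diagAct_iff _ _ _ _ ((H.src_one _).trans z.2)]
      refine ⟨(P.str.ract_one _ _).symm, ?_⟩
      rw [Q.str.lact_congr (congrArg H.one z.2) rfl _ (H.src_one _)]
      exact (Q.str.lact_one _ _).symm
    · rintro z z' ⟨γ, h, e⟩
      have hs := src_eq_of_eq_diagAct e
      have e₁ : H.rng γ = H.src (H.inv γ) := (H.src_inv γ).symm
      obtain ⟨ex, ey⟩ := (eq_diagAct_iff z z' γ h hs).1 e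
      refine ⟨H.inv γ, (z'.2.trans hs.symm).trans (H.rng_inv γ).symm, ?_⟩
      rw [eq_diagAct_iff _ _ _ _ (e₁.symm.trans (h.symm.trans z.2))]
      refine ⟨?_, ((Q.str.lact_inv_eq_iff γ z.1.2 z'.1.2 _ hs).2 ey).symm⟩
      have e₂ : H.src γ = H.rng (H.inv γ) := (H.rng_inv γ).symm
      rw [P.str.ract_congr rfl ex _ ((P.str.rmom_ract _).trans e₂),
        ← P.str.ract_mul z.1.1 γ (H.inv γ) h e₂ (by rw [H.rng_mul]; exact h),
        P.str.ract_congr ((H.mul_inv γ e₂).trans (congrArg H.one h.symm)) rfl _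
          (H.rng_one _).symm]
      exact (P.str.ract_one _ _).symm
    · rintro z z' z'' ⟨γ, h, e⟩ ⟨δ, k, e'⟩
      have hs := src_eq_of_eq_diagAct e
      have ks := src_eq_of_eq_diagAct e'
      obtain ⟨ex, ey⟩ := (eq_diagAct_iff z z' γ h hs).1 e
      obtain ⟨ex', ey'⟩ := (eq_diagAct_iff z' z'' δ k ks).1 e'
      have hγ : H.src γ = H.rng δ := hs.trans (z'.2.symm.trans k)
      refine ⟨H.mul ⟨(γ, δ), hγ⟩, by rw [H.rng_mul]; exact h, ?_⟩
      rw [eq_diagAct_iff _ _ _ _ (by rw [H.src_mul]; exact ks)]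
      constructor
      · rw [ex', P.str.ract_mul z.1.1 γ δ h hγ _ ((P.str.rmom_ract _).trans hγ)]
        exact P.str.ract_congr rfl ex _ _
      · rw [ey, Q.str.lact_mul γ δ z''.1.2 hγ ks _
          (by rw [Q.str.lmom_lact]; exact hγ)]
        exact Q.str.lact_congr rfl ey' _ _

/-- The space `(X ×_{H⁰} Y) / H` of a composite, with the quotient topology. -/
def CompSpace (P : Corr G H) (Q : Corr H K) : Type u := Quotient (orbitSetoid P Q)

instance (P : Corr G H) (Q : Corr H K) : TopologicalSpace (CompSpace P Q) :=
  inferInstanceAs (TopologicalSpace (Quotient (orbitSetoid P Q)))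

instance (P : Corr G H) (Q : Corr H K) : MeasurableSpace (CompSpace P Q) :=
  borel (CompSpace P Q)

/-- The class `[x, y]`. -/
def CompSpace.mk (P : Corr G H) (Q : Corr H K) (x : P.carrier) (y : Q.carrier)
    (h : P.str.rmom x = Q.str.lmom y) : CompSpace P Q :=
  Quotient.mk (orbitSetoid P Q) ⟨(x, y), h⟩

/-- The integral `∫ f(x γ, γ⁻¹ y) dα(γ)` of a function on the fibre product over the orbit
`ω = [x, y]`, where `α` is the Haar measure of `H` at the unit `lmom y`; it does not depend on the
representative. -/
def orbitIntegral (P : Corr G H) (Q : Corr H K) (f : FibProd P Q → ℝ) (ω : CompSpace P Q) : ℝ :=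
  ∫ γ, (if h : P.str.rmom (Quotient.out ω).1.1 = H.rng γ then f (diagAct (Quotient.out ω) γ h)
    else 0) ∂(H.haar (Q.str.lmom (Quotient.out ω).1.2))

/-- The integral `∫_Y ∫_X f(x, y) dα(x) dβ_a(y)` of a function on the fibre product, where the
inner integral is with respect to the measure of `P` at the unit `lmom y`. -/
def prodIntegral (P : Corr G H) (Q : Corr H K) (a : K.Obj) (f : FibProd P Q → ℝ) : ℝ :=
  ∫ y, ∫ x, (if h : P.str.rmom x = Q.str.lmom y then f ⟨(x, y), h⟩ else 0)
    ∂(P.str.meas (Q.str.lmom y)) ∂(Q.str.meas a)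

/-- A composite of `P` and `Q`: a correspondence on the space `CompSpace P Q` with the
momentum maps and actions induced by those of `P` and `Q`, and with a family of measures that
lifts to `b (α × β)` for some continuous positive `K`-invariant cochain `b` on the fibre product
whose coboundary is `((x, y), γ) ↦ Δ₂(γ⁻¹, y)`. -/
structure Composite (P : Corr G H) (Q : Corr H K) : Type u
    extends CorrOn G K (CompSpace P Q) where
  lmom_mk : ∀ x y h, lmom (CompSpace.mk P Q x y h) = P.str.lmom x
  rmom_mk : ∀ x y h, rmom (CompSpace.mk P Q x y h) = Q.str.rmom y
  lact_mk : ∀ g x y h h₁ (h₂ : G.src g = P.str.lmom x)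
    (h₃ : P.str.rmom (P.str.lact ⟨(g, x), h₂⟩) = Q.str.lmom y),
    lact ⟨(g, CompSpace.mk P Q x y h), h₁⟩ = CompSpace.mk P Q (P.str.lact ⟨(g, x), h₂⟩) y h₃
  ract_mk : ∀ x y k h h₁ (h₂ : Q.str.rmom y = K.rng k)
    (h₃ : P.str.rmom x = Q.str.lmom (Q.str.ract ⟨(y, k), h₂⟩)),
    ract ⟨(CompSpace.mk P Q x y h, k), h₁⟩ = CompSpace.mk P Q x (Q.str.ract ⟨(y, k), h₂⟩) h₃
  exists_cochain : ∃ b : FibProd P Q → ℝ, Continuous b ∧ (∀ z, 0 < b z) ∧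
    (∀ x y k (h : P.str.rmom x = Q.str.lmom y) (h₁ : Q.str.rmom y = K.rng k)
      (h₂ : P.str.rmom x = Q.str.lmom (Q.str.ract ⟨(y, k), h₁⟩)),
      b ⟨(x, Q.str.ract ⟨(y, k), h₁⟩), h₂⟩ = b ⟨(x, y), h⟩) ∧
    (∀ z γ (h : P.str.rmom z.1.1 = H.rng γ),
      b (diagAct z γ h) / b z =
        Q.str.adj ⟨(H.inv γ, z.1.2), (H.src_inv γ).trans (h.symm.trans z.2)⟩) ∧
    ∀ (a : K.Obj) (f : C_c(FibProd P Q, ℝ)),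
      ∫ ω, orbitIntegral P Q f ω ∂(meas a) = prodIntegral P Q a fun z => b z * f z

/-- A composite, bundled as a correspondence. -/
abbrev Composite.toCorr {P : Corr G H} {Q : Corr H K} (R : Composite P Q) : Corr G K where
  carrier := CompSpace P Q
  str := R.toCorrOn

end Composite

/-! ### Bicategories -/

set_option linter.checkUnivs false in
/-- The data of a bicategory, without the laws. -/
structure BicategoryData (B : Type u) extends CategoryStruct.{v} B where
  homCategory : ∀ a b : B, Category.{w} (a ⟶ b)
  whiskerLeft {a b c : B} (f : a ⟶ b) {g h : b ⟶ c} (η : g ⟶ h) : (f ≫ g) ⟶ (f ≫ h)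
  whiskerRight {a b c : B} {f g : a ⟶ b} (η : f ⟶ g) (h : b ⟶ c) : (f ≫ h) ⟶ (g ≫ h)
  associator {a b c d : B} (f : a ⟶ b) (g : b ⟶ c) (h : c ⟶ d) : (f ≫ g) ≫ h ≅ f ≫ (g ≫ h)
  leftUnitor {a b : B} (f : a ⟶ b) : 𝟙 a ≫ f ≅ f
  rightUnitor {a b : B} (f : a ⟶ b) : f ≫ 𝟙 b ≅ f

/-- The data underlying a bicategory. -/
def bicategoryData {B : Type u} (S : Bicategory.{w, v} B) : BicategoryData.{w, v} B where
  toCategoryStruct := S.toCategoryStruct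
  homCategory := S.homCategory
  whiskerLeft := S.whiskerLeft
  whiskerRight := S.whiskerRight
  associator := S.associator
  leftUnitor := S.leftUnitor
  rightUnitor := S.rightUnitor

/-- The data form a bicategory, that is, they satisfy the bicategory laws. -/
def BicategoryData.IsBicategory {B : Type u} (D : BicategoryData.{w, v} B) : Prop :=
  ∃ S : Bicategory.{w, v} B, bicategoryData S = D

end

/-! Let `H` act on the fibre product `Z` of two composable correspondences `P` and `Q`. The action
is proper because the right action on `P` is. The measure theory rests on a dictionary between
measures `μ` on an orbit space and measures `M` upstairs: `M` lifts `μ` when integrating orbit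
averages against `μ` is integrating against `M`. A lift is invariant under inversion of the
transformation groupoid (`RAct.IsLift.qinv`). Conversely, with a cutoff function `e` whose orbit
averages are `1`, every inversion-invariant `M` lifts the push-forward of `e M`
(`RAct.QInv.isLift`), and `μ` is determined by its lift (`RAct.IsLift.unique`). If `M` and `D M`
lift two measures, with `D` continuous and positive, then `D` is constant on the orbits that meet
the support of `M`. Hence, for families whose supports cover `Z`, it descends to a continuous
density between the two families (`RAct.IsLift.exists_density`).

Existence of composites. The product measures on `Z` are not inversion-invariant: the defect is the
adjoining function of `Q`. This function is a cocycle (`Corr.dens_cocycle`), which comes from the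
uniqueness of continuous densities on the support of a measure. A cocycle over a proper action is a
coboundary: averaging it against a positive function with proper support produces the cochain `b`
(`FibProd.exists_isCochain`). Multiplication by `b` restores invariance (`FibProd.IsCochain.qinv`),
so the measures descend. The resulting family on the orbit space inherits continuity, full support
and `K`-invariance, and its adjoining function is the descent of `b(z)⁻¹ b(g⁻¹ z) Δ₁(g, g⁻¹ x)`. For
the identity correspondence, left invariance of the Haar system and Fubini's theorem suffice.

Two-arrows. Every structural map is a homeomorphism because it compares two open quotient maps with
the same fibres. By uniqueness of lifts it is a 2-arrow once the target family has a lift to the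
fibre product with a continuous positive density (`Composite.contEquivalent`). For horizontal
composition this lift is transported along the product map; for the unitors it is computed on
representatives with a unit coordinate. For the associator both bracketings are quotients of the
triple product by commuting actions of `H` and `K`, and lifting in two steps can be done in either
order (`RAct.IsLift.exchange`). The ratio of the cochains involved is `K`-invariant because the
coboundaries cancel.

Coherence. The laws are equalities of maps and are checked on representatives; only the triangle
uses the orbit relation.

Throughout, actions are extended by junk values to pairs that cannot be multiplied, so they are
Borel everywhere and continuous on a closed domain that carries the relevant measures. A left action
is encoded as the right action `x · g = g⁻¹ x`, so that one theory covers both sides. Identities for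
compactly supported continuous functions are turned into equalities of measures, the calculations
are made with lower integrals of nonnegative Borel functions, and Bochner integrals return only at
the end. -/

set_option linter.unusedSectionVars false
set_option linter.style.haveILetI false

/-! ### Measure-theoretic preliminaries -/

section Families

open ProbabilityTheory
open scoped ENNReal

variable {X B Z : Type*} [TopologicalSpace X] [T2Space X] [LocallyCompactSpace X]
  [TopologicalSpace B]

theorem exists_compactlySupported_one {K U : Set X} (hK : IsCompact K) (hU : IsOpen U)
    (hKU : K ⊆ U) : ∃ f : C_c(X, ℝ), (∀ x ∈ K, f x = 1) ∧ (∀ x, 0 ≤ f x) ∧ (∀ x, f x ≤ 1) ∧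
      ∀ x ∉ U, f x = 0 := by
  obtain ⟨f, h1, h0, hc, h⟩ := exists_continuous_one_zero_of_isCompact hK hU.isClosed_compl
    (Set.disjoint_compl_right_iff_subset.2 hKU)
  exact ⟨⟨f, hc⟩, fun x hx => h1 hx, fun x => (h x).1, fun x => (h x).2, fun x hx => h0 hx⟩

/-- Measurability descends along measurable surjections out of a second countable, locally compact
Hausdorff space. -/
theorem measurable_of_comp_surjective [SecondCountableTopology X] [MeasurableSpace X]
    [BorelSpace X] [MeasurableSpace Z] [MeasurableSpace.CountablySeparated Z]
    {f : X → Z} (hf : Measurable f) (hs : Function.Surjective f) {g : Z → ℝ≥0∞}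
    (hg : Measurable fun x => g (f x)) : Measurable g := by
  -- Descent of measurability along a surjection is applied to a Polish source: the disjoint union
  -- of the members of a compact exhaustion, which maps continuously onto `X`.
  let K := CompactExhaustion.choice X
  letI : MeasurableSpace (Σ n, K n) := borel _
  haveI : BorelSpace (Σ n, K n) := ⟨rfl⟩
  have : ∀ n, CompactSpace (K n) := fun n => isCompact_iff_compactSpace.1 (K.isCompact n)
  have : ∀ n, PolishSpace (K n) := fun n => by
    letI := TopologicalSpace.metrizableSpaceMetric (K n)
    infer_instance
  have hc : Continuous fun y : Σ n, K n => (y.2 : X) :=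
    continuous_sigma fun n => continuous_subtype_val
  have hs' : Function.Surjective fun y : Σ n, K n => f y.2 := fun z => by
    obtain ⟨x, rfl⟩ := hs z
    obtain ⟨n, hn⟩ := K.exists_mem x
    exact ⟨⟨n, x, hn⟩, rfl⟩
  exact ((hf.comp hc.measurable).measurable_comp_iff_of_surjective hs').1 (hg.comp hc.measurable)

variable [MeasurableSpace X] [BorelSpace X] {p : X → B} {m : B → Measure X}

/-- Measures that are finite on compact sets are determined by compactly supported continuous
functions; `hK` replaces properness of `T` and makes the push-forward such a measure. Only
measurability of `T` is assumed because the maps used below carry junk values off a closed domain.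
-/
theorem map_eq_of_integral_eq [SecondCountableTopology X] [MeasurableSpace Z] [TopologicalSpace Z]
    [T2Space Z] [BorelSpace Z] {μ : Measure Z} {ν : Measure X} [IsFiniteMeasureOnCompacts μ]
    [IsFiniteMeasureOnCompacts ν] {T : Z → X} (hT : Measurable T)
    (hK : ∀ K, IsCompact K → ∃ L, IsCompact L ∧ ∀ᵐ z ∂μ, T z ∈ K → z ∈ L)
    (h : ∀ f : C_c(X, ℝ), ∫ z, f (T z) ∂μ = ∫ x, f x ∂ν) : μ.map T = ν := by
  have : IsFiniteMeasureOnCompacts (μ.map T) := ⟨fun K hKc => by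
    obtain ⟨L, hL, hKL⟩ := hK K hKc
    rw [Measure.map_apply hT hKc.measurableSet]
    exact (measure_mono_ae hKL).trans_lt hL.measure_lt_top⟩
  refine Measure.ext_of_integral_eq_on_compactlySupported fun f => ?_
  rw [← h f, integral_map hT.aemeasurable (map_continuous f).aestronglyMeasurable]

/-! ### Families of measures as s-finite kernels -/

namespace IsMeasureFamily

theorem ae_eq [SecondCountableTopology X] (hm : IsMeasureFamily p m) (b : B) :
    ∀ᵐ x ∂m b, p x = b := by
  have := Measure.support_mem_ae (μ := m b)
  rw [hm.support_eq b] at this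
  exact this

theorem measure_pos (hm : IsMeasureFamily p m) {U : Set X} {x : X} (hU : U ∈ 𝓝 x) :
    0 < m (p x) U := by
  have : x ∈ (m (p x)).support := by rw [hm.support_eq]; rfl
  exact (Measure.mem_support_iff_forall x).1 this U hU

theorem lintegral_ofReal (hm : IsMeasureFamily p m) (f : C_c(X, ℝ)) (hf : ∀ x, 0 ≤ f x) (b : B) :
    ∫⁻ x, ENNReal.ofReal (f x) ∂m b = ENNReal.ofReal (∫ x, f x ∂m b) := by
  have := hm.finiteOnCompacts b
  rw [ofReal_integral_eq_lintegral_ofReal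
    ((map_continuous f).integrable_of_hasCompactSupport f.hasCompactSupport) (.of_forall hf)]

theorem measure_le_lintegral {K : Set X} (hK : MeasurableSet K) {f : C_c(X, ℝ)}
    (hf : ∀ x ∈ K, f x = 1) (μ : Measure X) : μ K ≤ ∫⁻ x, ENNReal.ofReal (f x) ∂μ := by
  rw [← lintegral_indicator_one hK]
  refine lintegral_mono fun x => ?_
  by_cases hx : x ∈ K <;> simp [hx, hf]

theorem lintegral_le_measure {U : Set X} (hU : MeasurableSet U) {f : C_c(X, ℝ)}
    (h1 : ∀ x, f x ≤ 1) (h0 : ∀ x ∉ U, f x = 0) (μ : Measure X) :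
    ∫⁻ x, ENNReal.ofReal (f x) ∂μ ≤ μ U := by
  rw [← lintegral_indicator_one hU]
  refine lintegral_mono fun x => ?_
  by_cases hx : x ∈ U <;> simp [hx, h0, h1]

/-- A bump function at `x` supported in `U` has positive integral over the fibre of `x`, by full
support. Positivity persists at nearby base points by continuity, and then the fibre there must meet
`U`. -/
theorem isOpenMap [SecondCountableTopology X] (hm : IsMeasureFamily p m) : IsOpenMap p := by
  intro U hU
  rw [isOpen_iff_mem_nhds]
  rintro _ ⟨x, hx, rfl⟩
  obtain ⟨f, h1, h0, hle, hs⟩ := exists_compactlySupported_one (isCompact_singleton (x := x)) hU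
    (Set.singleton_subset_iff.2 hx)
  have hpos : 0 < ∫ x', f x' ∂m (p x) := by
    rw [← ENNReal.ofReal_pos, ← hm.lintegral_ofReal f h0, pos_iff_ne_zero, Ne,
      lintegral_eq_zero_iff (map_continuous f).measurable.ennreal_ofReal]
    intro hae
    have hV : {x' | 0 < f x'} ∈ 𝓝 x :=
      (isOpen_lt continuous_const (map_continuous f)).mem_nhds (by simp [h1 x rfl])
    refine (hm.measure_pos hV).ne' (measure_mono_null (fun x' hx' => ?_) (ae_iff.1 hae))
    simpa using hx'
  filter_upwards [(hm.continuous_integral f).continuousAt.eventually_mem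
    (isOpen_Ioi.mem_nhds hpos)] with b hb
  by_contra hbU
  have hae : f =ᵐ[m b] 0 := by
    filter_upwards [Measure.support_mem_ae (μ := m b)] with y hy
    rw [hm.support_eq] at hy
    by_contra hne
    exact hbU ⟨y, by_contra fun h => hne (hs y h), hy⟩
  exact (show (0 : ℝ) < ∫ x', f x' ∂m b from hb).ne' (integral_eq_zero_of_ae hae)

/-- An open set is exhausted by compact sets; Urysohn functions squeezed between these and `U`
exhibit `m b U` as a supremum of continuous functions of `b`. -/
theorem measurable_measure_of_isOpen [SecondCountableTopology X] [MeasurableSpace B]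
    [BorelSpace B] (hm : IsMeasureFamily p m) {U : Set X} (hU : IsOpen U) :
    Measurable fun b => m b U := by
  have : LocallyCompactSpace U := hU.locallyCompactSpace
  let K : ℕ → Set X := fun n => Subtype.val '' compactCovering U n
  have hK : ∀ n, IsCompact (K n) := fun n =>
    (isCompact_compactCovering U n).image continuous_subtype_val
  have hKU : ∀ n, K n ⊆ U := fun n => by rintro _ ⟨x, _, rfl⟩; exact x.2
  have hmono : Monotone K := fun i j hij => Set.image_mono (compactCovering_subset U hij)
  have hUn : ⋃ n, K n = U := by
    rw [← Set.image_iUnion, iUnion_compactCovering, Set.image_univ, Subtype.range_coe]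
  choose f h1 h0 hle hs using fun n => exists_compactlySupported_one (hK n) hU (hKU n)
  have key : ∀ b, m b U = ⨆ n, ∫⁻ x, ENNReal.ofReal (f n x) ∂m b := fun b => by
    refine le_antisymm ?_ (iSup_le fun n => lintegral_le_measure hU.measurableSet (hle n) (hs n) _)
    conv_lhs => rw [← hUn, hmono.measure_iUnion]
    exact iSup_mono fun n => measure_le_lintegral (hK n).measurableSet (h1 n) _
  simp_rw [key]
  refine Measurable.iSup fun n => ?_
  simp_rw [hm.lintegral_ofReal (f n) (h0 n)]
  exact (hm.continuous_integral (f n)).measurable.ennreal_ofReal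

/-- The π-system argument starting from open sets needs finite measures, so it is run on the
interiors of a compact exhaustion, followed by a supremum. -/
theorem measurable [SecondCountableTopology X] [MeasurableSpace B] [BorelSpace B]
    (hm : IsMeasureFamily p m) : Measurable m := by
  let K := CompactExhaustion.choice X
  have hfin : ∀ n b, IsFiniteMeasure ((m b).restrict (interior (K n))) := fun n b => by
    have := hm.finiteOnCompacts b
    refine ⟨?_⟩
    rw [Measure.restrict_apply_univ]
    exact (measure_mono interior_subset).trans_lt (K.isCompact n).measure_lt_top
  have h1 : ∀ n, Measurable fun b => (m b).restrict (interior (K n)) := fun n => by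
    refine Measurable.measure_of_isPiSystem (BorelSpace.measurable_eq (α := X))
      isPiSystem_isOpen (fun U hU => ?_) ?_
    · simp_rw [Measure.restrict_apply (IsOpen.measurableSet hU)]
      exact hm.measurable_measure_of_isOpen (IsOpen.inter hU isOpen_interior)
    · simp_rw [Measure.restrict_apply_univ]
      exact hm.measurable_measure_of_isOpen isOpen_interior
  have hmono : Monotone fun n => interior (K n) := fun i j hij => interior_mono (K.subset hij)
  have hun : ⋃ n, interior (K n) = Set.univ := by
    refine Set.eq_univ_of_forall fun x => ?_
    obtain ⟨n, hn⟩ := K.exists_mem x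
    exact Set.mem_iUnion.2 ⟨n + 1, K.subset_interior_succ n hn⟩
  refine Measure.measurable_of_measurable_coe _ fun s hs => ?_
  have key : ∀ b, m b s = ⨆ n, (m b).restrict (interior (K n)) s := fun b => by
    simp_rw [Measure.restrict_apply hs]
    rw [← Monotone.measure_iUnion fun i j hij => Set.inter_subset_inter_right s (hmono hij),
      ← Set.inter_iUnion, hun, Set.inter_univ]
  simp_rw [key]
  exact Measurable.iSup fun n => (Measure.measurable_coe hs).comp (h1 n)

theorem exists_measure_le (hm : IsMeasureFamily p m) {K : Set X} {L : Set B}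
    (hK : IsCompact K) (hL : IsCompact L) : ∃ C : NNReal, ∀ b ∈ L, m b K ≤ C := by
  obtain ⟨f, h1, h0, hle, hs⟩ := exists_compactlySupported_one hK isOpen_univ (Set.subset_univ _)
  obtain ⟨C, hC⟩ := (hL.image (hm.continuous_integral f)).bddAbove
  refine ⟨C.toNNReal, fun b hb => (measure_le_lintegral hK.measurableSet h1 _).trans ?_⟩
  rw [hm.lintegral_ofReal f h0]
  exact ENNReal.ofReal_le_ofReal (hC ⟨b, hb, rfl⟩)

/-- A family of measures as a kernel. -/
def kernel [SecondCountableTopology X] [MeasurableSpace B] [BorelSpace B]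
    (hm : IsMeasureFamily p m) (_ : Continuous p) : Kernel B X := ⟨m, hm.measurable⟩

/-- Restricting to the pieces of a compact covering, made disjoint, gives finite kernels: the mass
of `K n` is uniformly bounded over the compact set `p '' K n` and vanishes over all other base
points. -/
instance [SecondCountableTopology X] [MeasurableSpace B] [BorelSpace B]
    (hm : IsMeasureFamily p m) (hp : Continuous p) : IsSFiniteKernel (hm.kernel hp) := by
  let K : ℕ → Set X := compactCovering X
  have hK : ∀ n, IsCompact (K n) := isCompact_compactCovering X
  have hmeas : ∀ n, MeasurableSet (disjointed K n) :=
    fun n => MeasurableSet.disjointed (fun n => (hK n).measurableSet) n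
  refine ⟨⟨fun n => (hm.kernel hp).restrict (hmeas n), fun n => ?_, ?_⟩⟩
  · obtain ⟨C, hC⟩ := hm.exists_measure_le (hK n) ((hK n).image hp)
    refine ⟨⟨C, ENNReal.coe_lt_top, fun b => ?_⟩⟩
    rw [Kernel.restrict_apply, Measure.restrict_apply_univ]
    refine (measure_mono (disjointed_subset K n)).trans ?_
    by_cases hb : b ∈ p '' K n
    · exact hC b hb
    · have : m b (K n) = 0 := measure_mono_null (fun x hx hxb => hb ⟨x, hx, hxb⟩)
        (ae_iff.1 (hm.ae_eq b))
      exact this.le.trans zero_le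
  · ext1 b
    rw [Kernel.sum_apply]
    simp_rw [Kernel.restrict_apply]
    rw [← Measure.restrict_iUnion (disjoint_disjointed K) hmeas, iUnion_disjointed,
      iUnion_compactCovering, Measure.restrict_univ]

/-! ### Integrating a family of measures against a measure on a second space -/

section Product

variable [SecondCountableTopology X] [TopologicalSpace Z] [MeasurableSpace Z] [BorelSpace Z]
  {l : Z → B}

theorem measurable_lintegral (hm : IsMeasureFamily p m) (hp : Continuous p) (hl : Continuous l)
    {f : Z × X → ℝ≥0∞} (hf : Measurable f) : Measurable fun z => ∫⁻ x, f (z, x) ∂m (l z) := by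
  letI : MeasurableSpace B := borel B
  haveI : BorelSpace B := ⟨rfl⟩
  exact hf.lintegral_kernel_prod_right' (κ := (hm.kernel hp).comap l hl.measurable)

/-- The measure `∫ m (l z) dM(z)` on the product. -/
noncomputable def prodMeasure (hm : IsMeasureFamily p m) (hp : Continuous p) (hl : Continuous l)
    (M : Measure Z) : Measure (Z × X) :=
  letI : MeasurableSpace B := borel B
  haveI : BorelSpace B := ⟨rfl⟩
  M ⊗ₘ (hm.kernel hp).comap l hl.measurable

variable (hm : IsMeasureFamily p m) (hp : Continuous p) (hl : Continuous l) (M : Measure Z)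

theorem lintegral_prodMeasure [SFinite M] {f : Z × X → ℝ≥0∞} (hf : Measurable f) :
    ∫⁻ q, f q ∂hm.prodMeasure hp hl M = ∫⁻ z, ∫⁻ x, f (z, x) ∂m (l z) ∂M := by
  letI : MeasurableSpace B := borel B
  haveI : BorelSpace B := ⟨rfl⟩
  exact Measure.lintegral_compProd hf

theorem integral_prodMeasure [SFinite M] {f : Z × X → ℝ}
    (hf : Integrable f (hm.prodMeasure hp hl M)) :
    ∫ q, f q ∂hm.prodMeasure hp hl M = ∫ z, ∫ x, f (z, x) ∂m (l z) ∂M := by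
  letI : MeasurableSpace B := borel B
  haveI : BorelSpace B := ⟨rfl⟩
  exact Measure.integral_compProd hf

theorem prodMeasure_apply [SFinite M] {s : Set (Z × X)} (hs : MeasurableSet s) :
    hm.prodMeasure hp hl M s = ∫⁻ z, m (l z) (Prod.mk z ⁻¹' s) ∂M := by
  letI : MeasurableSpace B := borel B
  haveI : BorelSpace B := ⟨rfl⟩
  exact Measure.compProd_apply hs

theorem ae_prodMeasure [T2Space B] [SFinite M] :
    ∀ᵐ q ∂hm.prodMeasure hp hl M, l q.1 = p q.2 := by
  have hs : IsClosed {q : Z × X | l q.1 = p q.2} :=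
    isClosed_eq (hl.comp continuous_fst) (hp.comp continuous_snd)
  rw [ae_iff]
  change hm.prodMeasure hp hl M {q : Z × X | l q.1 = p q.2}ᶜ = 0
  rw [prodMeasure_apply hm hp hl M hs.measurableSet.compl]
  refine lintegral_eq_zero_of_ae_eq_zero (.of_forall fun z => ?_)
  have := ae_iff.1 (hm.ae_eq (l z))
  exact measure_mono_null (fun x (hx : ¬ l z = p x) (h : p x = l z) => hx h.symm) this

theorem isFiniteMeasureOnCompacts_prodMeasure [T2Space Z] [SFinite M]
    [IsFiniteMeasureOnCompacts M] : IsFiniteMeasureOnCompacts (hm.prodMeasure hp hl M) := by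
  refine ⟨fun K hK => ?_⟩
  have h1 : IsCompact (Prod.fst '' K) := hK.image continuous_fst
  have h2 : IsCompact (Prod.snd '' K) := hK.image continuous_snd
  obtain ⟨C, hC⟩ := hm.exists_measure_le h2 (h1.image hl)
  have hs : MeasurableSet ((Prod.fst '' K) ×ˢ (Prod.snd '' K)) :=
    h1.measurableSet.prod h2.measurableSet
  calc hm.prodMeasure hp hl M K ≤ hm.prodMeasure hp hl M ((Prod.fst '' K) ×ˢ (Prod.snd '' K)) :=
        measure_mono fun q hq => ⟨⟨q, hq, rfl⟩, ⟨q, hq, rfl⟩⟩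
    _ ≤ ∫⁻ z in Prod.fst '' K, C ∂M := by
        rw [prodMeasure_apply hm hp hl M hs, ← lintegral_indicator h1.measurableSet]
        refine lintegral_mono fun z => ?_
        by_cases hz : z ∈ Prod.fst '' K
        · rw [Set.mk_preimage_prod_right hz, Set.indicator_of_mem hz]
          exact hC _ ⟨z, hz, rfl⟩
        · rw [Set.mk_preimage_prod_right_eq_empty hz]
          simp
    _ < ⊤ := by
        rw [setLIntegral_const]
        exact ENNReal.mul_lt_top ENNReal.coe_lt_top h1.measure_lt_top

/-- Since `p` is open, every `z'` near `z` has a fibre that meets a given open neighbourhood of `x`,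
and that neighbourhood then has positive mass for `m (l z')`. The `z'` in question form a set of
positive `M`-measure. -/
theorem mem_support_prodMeasure [SFinite M] {z : Z} {x : X} (hz : z ∈ M.support)
    (h : l z = p x) : (z, x) ∈ (hm.prodMeasure hp hl M).support := by
  rw [Measure.mem_support_iff_forall]
  intro W hW
  obtain ⟨U, hU, V, hV, hUV⟩ := mem_nhds_prod_iff.1 hW
  obtain ⟨V', hV', hVo, hxV⟩ := mem_nhds_iff.1 hV
  obtain ⟨U', hU', hUo, hzU⟩ := mem_nhds_iff.1
    (Filter.inter_mem hU (hl.continuousAt.preimage_mem_nhds (h ▸ hm.isOpenMap.image_mem_nhds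
      (hVo.mem_nhds hxV))))
  refine lt_of_lt_of_le ?_ (measure_mono
    ((Set.prod_mono (hU'.trans Set.inter_subset_left) hV').trans hUV))
  rw [prodMeasure_apply hm hp hl M (hUo.measurableSet.prod hVo.measurableSet), pos_iff_ne_zero,
    Ne, lintegral_eq_zero_iff (by
      letI : MeasurableSpace B := borel B
      haveI : BorelSpace B := ⟨rfl⟩
      exact Kernel.measurable_kernel_prodMk_left (κ := (hm.kernel hp).comap l hl.measurable)
        (hUo.measurableSet.prod hVo.measurableSet))]
  intro hae
  refine ((Measure.mem_support_iff_forall z).1 hz U' (hUo.mem_nhds hzU)).ne'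
    (measure_mono_null (fun z' hz' => ?_) (ae_iff.1 hae))
  obtain ⟨x', hx', e⟩ := (hU' hz').2
  have : 0 < m (l z') V' := e ▸ hm.measure_pos (hVo.mem_nhds hx')
  simpa [Set.mk_preimage_prod_right hz'] using this.ne'

/-- By Tietze, `g` extends from the closed fibre product to a continuous `G` on `Z × X`, and locally
in `z` a compactly supported `φ` can be inserted without changing the integral. With the first
argument of `G` frozen at `z₀`, continuity is that of the family; the error is controlled by uniform
convergence of `G (z, ·)` on the support of `φ`. -/
theorem continuous_integral_of_hasProperSupport [T2Space B] [T2Space Z] [LocallyCompactSpace Z]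
    [SecondCountableTopology Z] {g : Z × X → ℝ}
    (hm : IsMeasureFamily p m) (hp : Continuous p) (hl : Continuous l)
    (hg : ContinuousOn g {q | l q.1 = p q.2})
    (hs : ∀ z₀, ∃ A ∈ 𝓝 z₀, ∃ K, IsCompact K ∧
      ∀ z ∈ A, ∀ x, l z = p x → x ∉ K → g (z, x) = 0) :
    (∀ z, Integrable (fun x => g (z, x)) (m (l z))) ∧
      Continuous fun z => ∫ x, g (z, x) ∂m (l z) := by
  have hC : IsClosed {q : Z × X | l q.1 = p q.2} :=
    isClosed_eq (hl.comp continuous_fst) (hp.comp continuous_snd)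
  obtain ⟨G, hG⟩ := ContinuousMap.exists_restrict_eq hC ⟨_, hg.domRestrict⟩
  have hG' : ∀ z x, l z = p x → G (z, x) = g (z, x) := fun z x h =>
    DFunLike.congr_fun hG ⟨(z, x), h⟩
  have main : ∀ z₀, ∃ A ∈ 𝓝 z₀, ∃ φ : C_c(X, ℝ), (∀ x, 0 ≤ φ x) ∧
      ∀ z ∈ A, (fun x => g (z, x)) =ᵐ[m (l z)] fun x => G (z, x) * φ x := by
    intro z₀
    obtain ⟨A, hA, K, hK, h⟩ := hs z₀
    obtain ⟨φ, h1, h0, -, -⟩ := exists_compactlySupported_one hK isOpen_univ (Set.subset_univ _)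
    refine ⟨A, hA, φ, h0, fun z hz => ?_⟩
    filter_upwards [hm.ae_eq (l z)] with x hx
    by_cases hxK : x ∈ K
    · rw [h1 x hxK, mul_one, hG' z x hx.symm]
    · rw [hG' z x hx.symm, h z hz x hx.symm hxK, zero_mul]
  let F (z : Z) (φ : C_c(X, ℝ)) : C_c(X, ℝ) := ⟨⟨fun x => G (z, x) * φ x, by fun_prop⟩,
    φ.hasCompactSupport.mul_left⟩
  have hint : ∀ z (φ : C_c(X, ℝ)) b, Integrable (fun x => G (z, x) * φ x) (m b) := fun z φ b => by
    have := hm.finiteOnCompacts b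
    exact (map_continuous (F z φ)).integrable_of_hasCompactSupport (F z φ).hasCompactSupport
  refine ⟨fun z => ?_, ?_⟩
  · obtain ⟨A, hA, φ, -, h⟩ := main z
    exact (integrable_congr (h z (mem_of_mem_nhds hA))).2 (hint z φ _)
  rw [continuous_iff_continuousAt]
  intro z₀
  obtain ⟨A, hA, φ, hφ, h⟩ := main z₀
  have e : (fun z => ∫ x, g (z, x) ∂m (l z)) =ᶠ[𝓝 z₀]
      fun z => (∫ x, G (z₀, x) * φ x ∂m (l z)) + ∫ x, (G (z, x) - G (z₀, x)) * φ x ∂m (l z) := by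
    filter_upwards [hA] with z hz
    rw [integral_congr_ae (h z hz)]
    simp_rw [sub_mul]
    rw [integral_sub (hint z φ _) (hint z₀ φ _), add_sub_cancel]
  rw [ContinuousAt, Filter.tendsto_congr' e, integral_congr_ae (h z₀ (mem_of_mem_nhds hA)),
    ← add_zero (∫ x, G (z₀, x) * φ x ∂m (l z₀))]
  refine (((hm.continuous_integral (F z₀ φ)).comp hl).tendsto z₀).add ?_
  rw [Metric.tendsto_nhds]
  intro ε hε
  have hΦ := ((hm.continuous_integral φ).comp hl).continuousAt (x := z₀)
  set c := ∫ x, φ x ∂m (l z₀) with hc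
  have hc0 : 0 ≤ c := integral_nonneg hφ
  have hunif := ContinuousMap.tendsto_iff_forall_isCompact_tendstoUniformlyOn.1
    (G.curry.continuous.tendsto z₀) (tsupport φ) φ.hasCompactSupport
  rw [Metric.tendstoUniformlyOn_iff] at hunif
  -- Near `z₀` the integral of `φ` stays below `c + 1`, so a uniform error of `ε / (c + 1)`
  -- contributes less than `ε`.
  filter_upwards [hunif (ε / (c + 1)) (by positivity),
    hΦ.eventually_mem (isOpen_Iio.mem_nhds (show c < c + 1 by linarith))] with z hz hzc
  have hzc' : ∫ x, φ x ∂m (l z) < c + 1 := hzc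
  rw [dist_zero_right]
  have hφi : Integrable φ (m (l z)) := by
    have := hm.finiteOnCompacts (l z)
    exact (map_continuous φ).integrable_of_hasCompactSupport φ.hasCompactSupport
  calc ‖∫ x, (G (z, x) - G (z₀, x)) * φ x ∂m (l z)‖
      ≤ ∫ x, ε / (c + 1) * φ x ∂m (l z) := by
        refine norm_integral_le_of_norm_le (hφi.const_mul _) (.of_forall fun x => ?_)
        by_cases hx : x ∈ tsupport φ
        · have := (hz x hx).le
          rw [dist_comm, Real.dist_eq] at this
          rw [norm_mul, Real.norm_of_nonneg (hφ x)]
          exact mul_le_mul_of_nonneg_right this (hφ x)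
        · simp [image_eq_zero_of_notMem_tsupport hx]
    _ = ε / (c + 1) * ∫ x, φ x ∂m (l z) := integral_const_mul _ _
    _ < ε / (c + 1) * (c + 1) := mul_lt_mul_of_pos_left hzc' (by positivity)
    _ = ε := div_mul_cancel₀ _ (by positivity)

end Product

end IsMeasureFamily
end Families

/-! ### Groupoids -/

namespace LCGroupoid

variable (G : LCGroupoid.{u})

theorem isClosedEmbedding_one : IsClosedEmbedding G.one :=
  Function.LeftInverse.isClosedEmbedding G.src_one G.continuous_src G.continuous_one

instance : T2Space G.Obj := G.isClosedEmbedding_one.isEmbedding.t2Space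

/-- The multiplication, extended by the junk value `g` to pairs that are not composable. -/
noncomputable def tmul (g k : G.Arr) : G.Arr :=
  if h : G.src g = G.rng k then G.mul ⟨(g, k), h⟩ else g

variable {G} {g k l : G.Arr}

theorem tmul_eq (h : G.src g = G.rng k) : G.tmul g k = G.mul ⟨(g, k), h⟩ := dif_pos h

@[simp]
theorem rng_tmul : G.rng (G.tmul g k) = G.rng g := by
  unfold tmul
  split_ifs
  · exact G.rng_mul _
  · rfl

theorem src_tmul (h : G.src g = G.rng k) : G.src (G.tmul g k) = G.src k := by
  rw [tmul_eq h, G.src_mul]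

theorem tmul_assoc (h : G.src g = G.rng k) (h' : G.src k = G.rng l) :
    G.tmul (G.tmul g k) l = G.tmul g (G.tmul k l) := by
  have e₁ : G.src (G.mul ⟨(g, k), h⟩) = G.rng l := by rw [G.src_mul]; exact h'
  have e₂ : G.src g = G.rng (G.mul ⟨(k, l), h'⟩) := by rw [G.rng_mul]; exact h
  rw [tmul_eq h, tmul_eq h', tmul_eq e₁, tmul_eq e₂]
  exact G.mul_assoc g k l h h' e₁ e₂

attribute [simp] rng_one src_one rng_inv src_inv

@[simp]
theorem tmul_one : G.tmul g (G.one (G.src g)) = g := by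
  rw [tmul_eq (by simp)]
  exact G.mul_one g _

@[simp]
theorem one_tmul : G.tmul (G.one (G.rng g)) g = g := by
  rw [tmul_eq (by simp)]
  exact G.one_mul g _

@[simp]
theorem tmul_inv : G.tmul g (G.inv g) = G.one (G.rng g) := by
  rw [tmul_eq (by simp)]
  exact G.mul_inv g _

@[simp]
theorem inv_tmul : G.tmul (G.inv g) g = G.one (G.src g) := by
  rw [tmul_eq (by simp)]
  exact G.inv_mul g _

theorem tmul_one' {a : G.Obj} (h : G.src g = a) : G.tmul g (G.one a) = g := by
  rw [← h, tmul_one]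

theorem one_tmul' {a : G.Obj} (h : G.rng g = a) : G.tmul (G.one a) g = g := by
  rw [← h, one_tmul]

theorem inv_tmul_cancel_left (h : G.src g = G.rng k) : G.tmul (G.inv g) (G.tmul g k) = k := by
  rw [← tmul_assoc (by simp) h, inv_tmul, one_tmul' h.symm]

theorem tmul_inv_cancel_left (h : G.rng g = G.rng k) : G.tmul g (G.tmul (G.inv g) k) = k := by
  rw [← tmul_assoc (by simp) (by simpa using h), tmul_inv, one_tmul' h.symm]

theorem tmul_inv_cancel_right (h : G.src g = G.rng k) : G.tmul (G.tmul g k) (G.inv k) = g := by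
  rw [tmul_assoc h (by simp), tmul_inv, tmul_one' h]

theorem inv_tmul_cancel_right (h : G.src g = G.src k) : G.tmul (G.tmul g (G.inv k)) k = g := by
  rw [tmul_assoc (by simpa using h) (by simp), inv_tmul, tmul_one' h]

@[simp]
theorem inv_inv : G.inv (G.inv g) = g := by
  conv_lhs => rw [← tmul_one (g := G.inv (G.inv g)), G.src_inv, G.rng_inv, ← inv_tmul (g := g),
    inv_tmul_cancel_left (by simp)]

theorem inv_tmul_rev (h : G.src g = G.rng k) :
    G.inv (G.tmul g k) = G.tmul (G.inv k) (G.inv g) := by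
  have e : G.src (G.tmul g k) = G.rng (G.inv k) := by rw [src_tmul h, G.rng_inv]
  rw [← inv_tmul_cancel_left (g := G.tmul g k) (k := G.tmul (G.inv k) (G.inv g)) (by simpa using e),
    ← tmul_assoc e (by simpa using h.symm), tmul_inv_cancel_right h, tmul_inv,
    tmul_one' (by simp)]

@[simp]
theorem inv_one (a : G.Obj) : G.inv (G.one a) = G.one a := by
  have h := inv_tmul (g := G.one a)
  rwa [tmul_one' (by simp), G.src_one] at h

variable (G)

theorem continuousOn_tmul :
    ContinuousOn (fun q : G.Arr × G.Arr => G.tmul q.1 q.2) {q | G.src q.1 = G.rng q.2} := by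
  rw [continuousOn_iff_continuous_domRestrict]
  exact G.continuous_mul.congr fun q => (tmul_eq q.2).symm

/-- Inversion as a homeomorphism. -/
@[simps]
def invHomeo : G.Arr ≃ₜ G.Arr where
  toFun := G.inv
  invFun := G.inv
  left_inv _ := inv_inv
  right_inv _ := inv_inv
  continuous_toFun := G.continuous_inv
  continuous_invFun := G.continuous_inv

end LCGroupoid

theorem continuousOn_of_forall_eq {X Y : Type*} [TopologicalSpace X] [TopologicalSpace Y]
    {f : X → Y} {s : Set X} {f' : s → Y} (hf' : Continuous f') (h : ∀ x (hx : x ∈ s),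
    f x = f' ⟨x, hx⟩) : ContinuousOn f s :=
  continuousOn_iff_continuous_domRestrict.2 (hf'.congr fun x => (h x x.2).symm)

namespace HaarGroupoid

open scoped ENNReal

variable (G : HaarGroupoid.{u})

/-- Applied to products, actions and densities that are continuous on the closed set of composable
pairs and take a measurable junk value elsewhere. -/
theorem measurable_of_continuousOn {X Y : Type*} [TopologicalSpace X] [MeasurableSpace X]
    [BorelSpace X] [TopologicalSpace Y] [MeasurableSpace Y] [BorelSpace Y] {f : X → Y} {s : Set X}
    (hs : IsClosed s) (hf : ContinuousOn f s) {f' : X → Y} (hf' : Measurable f')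
    (h : ∀ x ∉ s, f x = f' x) : Measurable f := by
  have : f = s.piecewise f f' := by
    ext x
    by_cases hx : x ∈ s
    · rw [Set.piecewise_eq_of_mem _ _ _ hx]
    · rw [Set.piecewise_eq_of_notMem _ _ _ hx, h x hx]
  exact measurable_of_restrict_of_restrict_compl hs.measurableSet
    (continuousOn_iff_continuous_domRestrict.1 hf).measurable (by
      have : sᶜ.domRestrict f = sᶜ.domRestrict f' := by
        ext x
        exact h x x.2
      rw [this]
      exact hf'.comp measurable_subtype_coe)

theorem measurable_tmul : Measurable fun q : G.Arr × G.Arr => G.tmul q.1 q.2 :=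
  measurable_of_continuousOn
    (isClosed_eq (G.continuous_src.comp continuous_fst) (G.continuous_rng.comp continuous_snd))
    G.continuousOn_tmul measurable_fst fun _ hq => dif_neg hq

theorem ae_rng (a : G.Obj) : ∀ᵐ k ∂G.haar a, G.rng k = a := G.haar_family.ae_eq a

/-- The invariance axiom concerns compactly supported continuous functions. As an equality of
measures it applies to all nonnegative Borel functions. Multiplication by `g⁻¹` supplies the compact
sets needed to compare the measures. -/
theorem map_tmul_haar (g : G.Arr) :
    (G.haar (G.src g)).map (G.tmul g) = G.haar (G.rng g) := by
  have := G.haar_family.finiteOnCompacts (G.src g)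
  have := G.haar_family.finiteOnCompacts (G.rng g)
  refine map_eq_of_integral_eq (G.measurable_tmul.comp measurable_prodMk_left) (fun K hK => ?_)
    fun f => ?_
  · refine ⟨(fun k => G.tmul (G.inv g) k) '' (K ∩ {k | G.rng g = G.rng k}),
      (hK.inter_right (isClosed_eq continuous_const G.continuous_rng)).image_of_continuousOn ?_, ?_⟩
    · exact G.continuousOn_tmul.comp (f := fun k => (G.inv g, k)) (by fun_prop)
        fun k hk => by simpa using hk.2
    · filter_upwards [G.ae_rng (G.src g)] with k hk hkK
      exact ⟨G.tmul g k, ⟨hkK, by simp⟩, G.inv_tmul_cancel_left hk.symm⟩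
  · rw [← G.haar_invariant g f]
    refine integral_congr_ae ?_
    filter_upwards [G.ae_rng (G.src g)] with k hk
    rw [dif_pos hk.symm, G.tmul_eq hk.symm]

theorem lintegral_tmul (g : G.Arr) {f : G.Arr → ℝ≥0∞} (hf : Measurable f) :
    ∫⁻ k, f (G.tmul g k) ∂G.haar (G.src g) = ∫⁻ k, f k ∂G.haar (G.rng g) := by
  have : Measurable (G.tmul g) := G.measurable_tmul.comp measurable_prodMk_left
  rw [← G.map_tmul_haar g, lintegral_map hf this]

theorem lintegral_inv_tmul (g : G.Arr) {f : G.Arr → ℝ≥0∞} (hf : Measurable f) :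
    ∫⁻ k, f (G.tmul (G.inv g) k) ∂G.haar (G.rng g) = ∫⁻ k, f k ∂G.haar (G.src g) := by
  simpa using G.lintegral_tmul (G.inv g) hf

theorem isOpenMap_rng : IsOpenMap G.rng := G.haar_family.isOpenMap

end HaarGroupoid

theorem lintegral_withDensity_mul {Z : Type*} [MeasurableSpace Z] {M : Measure Z}
    {e f : Z → ENNReal} (he : Measurable e) (hf : Measurable f) :
    ∫⁻ z, f z ∂M.withDensity e = ∫⁻ z, e z * f z ∂M :=
  lintegral_withDensity_eq_lintegral_mul _ he hf

/-! ### Actions of groupoids with Haar systems -/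

/-- A continuous right action of `H` on `Z` with momentum map `mom`. The action is extended by the
junk value `act z γ = z` to the pairs with `mom z ≠ rng γ`. -/
structure RAct (H : HaarGroupoid.{u}) (Z : Type*) [TopologicalSpace Z] where
  mom : Z → H.Obj
  act : Z → H.Arr → Z
  continuous_mom : Continuous mom
  continuousOn_act : ContinuousOn (fun q : Z × H.Arr => act q.1 q.2) {q | mom q.1 = H.rng q.2}
  act_junk : ∀ z γ, mom z ≠ H.rng γ → act z γ = z
  mom_act : ∀ {z γ}, mom z = H.rng γ → mom (act z γ) = H.src γ
  act_one : ∀ z, act z (H.one (mom z)) = z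
  act_tmul : ∀ {z γ η}, mom z = H.rng γ → H.src γ = H.rng η →
    act z (H.tmul γ η) = act (act z γ) η

namespace RAct

open scoped ENNReal

variable {H : HaarGroupoid.{u}} {Z Ω : Type*} [TopologicalSpace Z] [TopologicalSpace Ω]
  (S : RAct H Z)

theorem isClosed_domain : IsClosed {q : Z × H.Arr | S.mom q.1 = H.rng q.2} :=
  isClosed_eq (S.continuous_mom.comp continuous_fst) (H.continuous_rng.comp continuous_snd)

variable {S} in
theorem act_act_inv {z : Z} {γ : H.Arr} (h : S.mom z = H.rng γ) :
    S.act (S.act z γ) (H.inv γ) = z := by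
  rw [← S.act_tmul h (by simp), H.tmul_inv, ← h, S.act_one]

/-- The action is proper. -/
def IsProper : Prop := ∀ A B : Set Z, IsCompact A → IsCompact B → ∃ Γ : Set H.Arr, IsCompact Γ ∧
  ∀ z ∈ A, ∀ γ, S.mom z = H.rng γ → S.act z γ ∈ B → γ ∈ Γ

/-- The map `π` is an open quotient map whose fibres are the orbits. -/
structure IsQuot (π : Z → Ω) : Prop where
  isOpenQuotientMap : IsOpenQuotientMap π
  eq_iff : ∀ {z z'}, π z = π z' ↔ ∃ γ, S.mom z = H.rng γ ∧ z' = S.act z γ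

namespace IsQuot

variable {S} {π : Z → Ω} (hπ : S.IsQuot π)
include hπ

theorem map_act {z : Z} {γ : H.Arr} (h : S.mom z = H.rng γ) : π (S.act z γ) = π z :=
  (hπ.eq_iff.2 ⟨γ, h, rfl⟩).symm

theorem exists_descend {Y : Type*} (φ : Z → Y)
    (h : ∀ z γ, S.mom z = H.rng γ → φ (S.act z γ) = φ z) : ∃ F : Ω → Y, ∀ z, F (π z) = φ z := by
  refine ⟨fun ω => φ (Function.surjInv hπ.isOpenQuotientMap.surjective ω), fun z => ?_⟩
  obtain ⟨γ, hγ, e⟩ := hπ.eq_iff.1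
    (Function.surjInv_eq hπ.isOpenQuotientMap.surjective (π z)).symm
  beta_reduce
  rw [e, h _ _ hγ]

theorem exists_continuous_descend {Y : Type*} [TopologicalSpace Y] {φ : Z → Y} (hφ : Continuous φ)
    (h : ∀ z γ, S.mom z = H.rng γ → φ (S.act z γ) = φ z) :
    ∃ F : Ω → Y, Continuous F ∧ ∀ z, F (π z) = φ z := by
  obtain ⟨F, hF⟩ := hπ.exists_descend φ h
  exact ⟨F, hπ.isOpenQuotientMap.continuous_comp_iff.1 (hφ.congr fun z => (hF z).symm), hF⟩

end IsQuot

/-! ### Orbit averages, inversion-invariant measures and lifts -/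

section Measure

variable [T2Space Z] [LocallyCompactSpace Z] [SecondCountableTopology Z] [MeasurableSpace Z]
  [BorelSpace Z]

theorem measurable_act : Measurable fun q : Z × H.Arr => S.act q.1 q.2 :=
  HaarGroupoid.measurable_of_continuousOn S.isClosed_domain S.continuousOn_act measurable_fst
    fun q hq => S.act_junk q.1 q.2 hq

theorem measurable_act_left (z : Z) : Measurable (S.act z) :=
  S.measurable_act.comp measurable_prodMk_left

/-- The integral `∫ f(z γ) dχ(γ)` of a function over the orbit of `z`. -/
noncomputable def avg (f : Z → ℝ≥0∞) (z : Z) : ℝ≥0∞ :=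
  ∫⁻ γ, f (S.act z γ) ∂H.haar (S.mom z)

theorem measurable_lintegral_haar {f : Z × H.Arr → ℝ≥0∞} (hf : Measurable f) :
    Measurable fun z => ∫⁻ γ, f (z, γ) ∂H.haar (S.mom z) :=
  H.haar_family.measurable_lintegral H.continuous_rng S.continuous_mom hf

theorem measurable_avg {f : Z → ℝ≥0∞} (hf : Measurable f) : Measurable (S.avg f) :=
  S.measurable_lintegral_haar (f := fun q => f (S.act q.1 q.2)) (hf.comp S.measurable_act)

/-- Left invariance of the Haar system, transported to an orbit. -/
theorem lintegral_act {z : Z} {γ : H.Arr} (h : S.mom z = H.rng γ) {f : Z → H.Arr → ℝ≥0∞}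
    (hf : Measurable fun q : Z × H.Arr => f q.1 q.2) :
    ∫⁻ η, f (S.act (S.act z γ) η) (H.tmul γ η) ∂H.haar (S.mom (S.act z γ)) =
      ∫⁻ η, f (S.act z η) η ∂H.haar (S.mom z) := by
  rw [S.mom_act h, h, ← H.lintegral_tmul γ (f := fun η => f (S.act z η) η)
    (hf.comp ((S.measurable_act_left z).prodMk measurable_id))]
  refine lintegral_congr_ae ?_
  filter_upwards [H.ae_rng (H.src γ)] with η hη
  rw [S.act_tmul h hη.symm]

theorem avg_act {z : Z} {γ : H.Arr} (h : S.mom z = H.rng γ) {f : Z → ℝ≥0∞} (hf : Measurable f) :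
    S.avg f (S.act z γ) = S.avg f z :=
  S.lintegral_act h (f := fun z _ => f z) (hf.comp measurable_fst)

theorem lintegral_const_mul_act (c : ℝ≥0∞) {f : Z → ℝ≥0∞} (hf : Measurable f) (z : Z) :
    ∫⁻ γ, c * f (S.act z γ) ∂H.haar (S.mom z) = c * S.avg f z :=
  lintegral_const_mul c (hf.comp (S.measurable_act_left z))

theorem avg_mul_of_invariant {f φ : Z → ℝ≥0∞} (hf : Measurable f)
    (hφ : ∀ z γ, S.mom z = H.rng γ → φ (S.act z γ) = φ z) (z : Z) :
    S.avg (fun z => f z * φ z) z = S.avg f z * φ z := by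
  unfold avg
  rw [← lintegral_mul_const _ (f := fun γ => f (S.act z γ)) (hf.comp (S.measurable_act_left z))]
  refine lintegral_congr_ae ?_
  filter_upwards [H.ae_rng (S.mom z)] with γ hγ
  rw [hφ z γ hγ.symm]

/-- The measure `M` is quasi-invariant, with density `δ`, under inversion of the transformation
groupoid. -/
def QInv (M : Measure Z) (δ : Z → H.Arr → ℝ) : Prop :=
  ∀ F : Z × H.Arr → ℝ≥0∞, Measurable F →
    ∫⁻ z, ∫⁻ γ, F (z, γ) ∂H.haar (S.mom z) ∂M =
      ∫⁻ z, ∫⁻ γ, F (S.act z γ, H.inv γ) * ENNReal.ofReal (δ z γ) ∂H.haar (S.mom z) ∂M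

variable [MeasurableSpace Ω] [BorelSpace Ω]

/-- The measure `M` on `Z` is the integral of the orbit measures with respect to `μ`. -/
def IsLift (π : Z → Ω) (μ : Measure Ω) (M : Measure Z) : Prop :=
  ∀ f : Z → ℝ≥0∞, Measurable f → ∀ F : Ω → ℝ≥0∞, (∀ z, F (π z) = S.avg f z) →
    ∫⁻ ω, F ω ∂μ = ∫⁻ z, f z ∂M

/-- A normalised measurable cutoff function. -/
structure IsCutoff (e : Z → ℝ≥0∞) : Prop where
  measurable : Measurable e
  avg_eq_one : ∀ z, S.avg e z = 1

variable {S} {π : Z → Ω} {μ μ' : Measure Ω} {M M' : Measure Z}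

/-- The function `e · (1_s ∘ π)` has orbit average `1_s`, so testing the lift on it computes `μ s`
in terms of `M` alone. -/
theorem IsLift.eq_map {e : Z → ℝ≥0∞} (hπ : S.IsQuot π) (he : S.IsCutoff e)
    (h : S.IsLift π μ M) : μ = (M.withDensity e).map π := by
  have hc := hπ.isOpenQuotientMap.continuous.measurable
  ext s hs
  rw [← lintegral_indicator_one hs, ← lintegral_indicator_one hs,
    lintegral_map (measurable_one.indicator hs) hc,
    lintegral_withDensity_mul (f := fun z => s.indicator 1 (π z)) he.measurable
      ((measurable_one.indicator hs).comp hc)]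
  refine h _ (he.measurable.mul ((measurable_one.indicator hs).comp hc)) _ fun z => ?_
  have := S.avg_mul_of_invariant he.measurable (φ := fun z => s.indicator 1 (π z))
    (fun z γ h => by rw [hπ.map_act h]) z
  rw [he.avg_eq_one, one_mul] at this
  exact this.symm

theorem IsLift.unique {e : Z → ℝ≥0∞} (hπ : S.IsQuot π) (he : S.IsCutoff e)
    (h : S.IsLift π μ M) (h' : S.IsLift π μ' M) : μ = μ' :=
  (h.eq_map hπ he).trans (h'.eq_map hπ he).symm

/-- A lifted measure is invariant under inversion. -/
theorem IsLift.qinv (hπ : S.IsQuot π) (h : S.IsLift π μ M) : S.QInv M fun _ _ => 1 := by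
  intro F hF
  simp only [ENNReal.ofReal_one, mul_one]
  have hF' : Measurable fun q : Z × H.Arr => F (S.act q.1 q.2, H.inv q.2) :=
    hF.comp (S.measurable_act.prodMk (H.continuous_inv.measurable.comp measurable_snd))
  have hf := S.measurable_lintegral_haar hF
  have hf' := S.measurable_lintegral_haar hF'
  obtain ⟨Φ, hΦ⟩ := hπ.exists_descend _ fun z γ hγ => S.avg_act hγ hf
  -- Both sides are integrals against `M`, so it is enough that the two integrands have the same
  -- orbit average. By left invariance both averages become double integrals over the fibre at `mom
  -- z`, and these differ by interchanging the two variables.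
  rw [← h _ hf Φ hΦ, ← h _ hf' Φ]
  intro z
  rw [hΦ]
  symm
  have e₁ : ∀ γ, S.mom z = H.rng γ →
      ∫⁻ η, F (S.act z γ, η) ∂H.haar (S.mom (S.act z γ)) =
        ∫⁻ η, F (S.act z γ, H.tmul (H.inv γ) η) ∂H.haar (S.mom z) := fun γ hγ => by
    rw [S.mom_act hγ, hγ, H.lintegral_inv_tmul γ (f := fun η => F (S.act z γ, η))
      (hF.comp measurable_prodMk_left)]
  have e₂ : ∀ γ, S.mom z = H.rng γ →
      ∫⁻ η, F (S.act (S.act z γ) η, H.inv η) ∂H.haar (S.mom (S.act z γ)) =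
        ∫⁻ η, F (S.act z η, H.tmul (H.inv η) γ) ∂H.haar (S.mom z) := fun γ hγ => by
    have hm : Measurable fun q : Z × H.Arr => F (q.1, H.tmul (H.inv q.2) γ) :=
      hF.comp (measurable_fst.prodMk (H.measurable_tmul.comp
        ((H.continuous_inv.measurable.comp measurable_snd).prodMk measurable_const)))
    rw [← S.lintegral_act hγ (f := fun z η => F (z, H.tmul (H.inv η) γ)) hm, S.mom_act hγ]
    refine lintegral_congr_ae ?_
    filter_upwards [H.ae_rng (H.src γ)] with η hη
    rw [H.inv_tmul_rev hη.symm, H.inv_tmul_cancel_right (by simpa using hη)]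
  have hfin := H.haar_family.finiteOnCompacts (S.mom z)
  have hm : Measurable fun q : H.Arr × H.Arr => F (S.act z q.1, H.tmul (H.inv q.1) q.2) :=
    hF.comp (((S.measurable_act_left z).comp measurable_fst).prodMk (H.measurable_tmul.comp
      ((H.continuous_inv.measurable.comp measurable_fst).prodMk measurable_snd)))
  calc S.avg (fun z => ∫⁻ γ, F (S.act z γ, H.inv γ) ∂H.haar (S.mom z)) z
      = ∫⁻ γ, ∫⁻ η, F (S.act z η, H.tmul (H.inv η) γ) ∂H.haar (S.mom z) ∂H.haar (S.mom z) := by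
        refine lintegral_congr_ae ?_
        filter_upwards [H.ae_rng (S.mom z)] with γ hγ using e₂ γ hγ.symm
    _ = ∫⁻ γ, ∫⁻ η, F (S.act z γ, H.tmul (H.inv γ) η) ∂H.haar (S.mom z) ∂H.haar (S.mom z) :=
        (lintegral_lintegral_swap
          (f := fun γ η => F (S.act z γ, H.tmul (H.inv γ) η)) hm.aemeasurable).symm
    _ = S.avg (fun z => ∫⁻ γ, F (z, γ) ∂H.haar (S.mom z)) z := by
        refine (lintegral_congr_ae ?_).symm
        filter_upwards [H.ae_rng (S.mom z)] with γ hγ using e₁ γ hγ.symm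

/-- Inversion of the transformation groupoid turns `e(z) f(z γ)` into `f(z) e(z γ)`, and the orbit
average of `e` is `1`. -/
theorem QInv.isLift {e : Z → ℝ≥0∞} [MeasurableSpace.CountablySeparated Ω] (hπ : S.IsQuot π)
    (he : S.IsCutoff e)
    (h : S.QInv M fun _ _ => 1) : S.IsLift π ((M.withDensity e).map π) M := by
  intro f hf F hF
  have hc := hπ.isOpenQuotientMap.continuous.measurable
  have hFm : Measurable F := by
    refine measurable_of_comp_surjective hc hπ.isOpenQuotientMap.surjective ?_
    simp_rw [hF]
    exact S.measurable_avg hf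
  have hm : Measurable fun q : Z × H.Arr => e q.1 * f (S.act q.1 q.2) :=
    (he.measurable.comp measurable_fst).mul (hf.comp S.measurable_act)
  rw [lintegral_map hFm hc, lintegral_withDensity_mul (f := fun z => F (π z)) he.measurable (hFm.comp hc)]
  calc ∫⁻ z, e z * F (π z) ∂M
      = ∫⁻ z, ∫⁻ γ, e z * f (S.act z γ) ∂H.haar (S.mom z) ∂M := by
        refine lintegral_congr fun z => ?_
        rw [hF, S.lintegral_const_mul_act _ hf]
    _ = ∫⁻ z, ∫⁻ γ, f z * e (S.act z γ) ∂H.haar (S.mom z) ∂M := by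
        rw [h (fun q => e q.1 * f (S.act q.1 q.2)) hm]
        refine lintegral_congr fun z => lintegral_congr_ae ?_
        filter_upwards [H.ae_rng (S.mom z)] with γ hγ
        rw [act_act_inv hγ.symm, ENNReal.ofReal_one, mul_one, mul_comm]
    _ = ∫⁻ z, f z ∂M := by
        refine lintegral_congr fun z => ?_
        rw [S.lintegral_const_mul_act _ he.measurable, he.avg_eq_one, mul_one]

end Measure

end RAct

/-- The densities agree almost everywhere. The set of points of `C` where they agree is closed
because both are continuous on `C`, and a closed conull set contains the support. -/
theorem eq_on_support_of_lintegral_eq {V : Type*} [TopologicalSpace V] [MeasurableSpace V]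
    [OpensMeasurableSpace V] {N : Measure V} [SigmaFinite N] {C : Set V} (hC : IsClosed C)
    (hN : ∀ᵐ v ∂N, v ∈ C) {g₁ g₂ : V → ℝ} (m₁ : Measurable g₁) (m₂ : Measurable g₂)
    (c₁ : ContinuousOn g₁ C) (c₂ : ContinuousOn g₂ C) (n₁ : ∀ v ∈ C, 0 ≤ g₁ v)
    (n₂ : ∀ v ∈ C, 0 ≤ g₂ v)
    (h : ∀ F : V → ENNReal, Measurable F → ∫⁻ v, F v * ENNReal.ofReal (g₁ v) ∂N =
      ∫⁻ v, F v * ENNReal.ofReal (g₂ v) ∂N) : ∀ v ∈ N.support, g₁ v = g₂ v := by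
  have e : N.withDensity (fun v => ENNReal.ofReal (g₁ v)) =
      N.withDensity fun v => ENNReal.ofReal (g₂ v) := by
    ext s hs
    rw [← lintegral_indicator_one hs, ← lintegral_indicator_one hs,
      lintegral_withDensity_mul m₁.ennreal_ofReal (measurable_one.indicator hs),
      lintegral_withDensity_mul m₂.ennreal_ofReal (measurable_one.indicator hs)]
    simpa only [mul_comm] using h _ (measurable_one.indicator hs)
  have hae := (withDensity_eq_iff_of_sigmaFinite m₁.ennreal_ofReal.aemeasurable
    m₂.ennreal_ofReal.aemeasurable).1 e
  have hcl : IsClosed {v | v ∈ C ∧ g₁ v = g₂ v} := by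
    have : {v | v ∈ C ∧ g₁ v = g₂ v} = C ∩ (fun v => g₁ v - g₂ v) ⁻¹' {0} := by
      ext v
      simp [sub_eq_zero]
    rw [this]
    exact (c₁.sub c₂).preimage_isClosed_of_isClosed hC isClosed_singleton
  refine fun v hv => (Measure.support_subset_of_isClosed hcl ?_ hv).2
  filter_upwards [hN, hae] with v hv hv'
  exact ⟨hv, (ENNReal.ofReal_eq_ofReal_iff (n₁ v hv) (n₂ v hv)).1 hv'⟩

namespace RAct

open scoped ENNReal

variable {H : HaarGroupoid.{u}} {Z Ω : Type*} [TopologicalSpace Z] [TopologicalSpace Ω]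
  {S : RAct H Z}

/-! #### Topology of the orbit space -/

/-- Orbit maps are open because the range map of `H` is: if `z₀ γ₀` lies in `U`, then each `z` near
`z₀` admits an arrow `γ` near `γ₀` with range `mom z`, and `z γ` still lies in `U`. -/
theorem IsQuot.of_isQuotientMap {π : Z → Ω} (h : IsQuotientMap π)
    (h' : ∀ {z z'}, π z = π z' ↔ ∃ γ, S.mom z = H.rng γ ∧ z' = S.act z γ) : S.IsQuot π := by
  refine ⟨.of_isOpenMap_isQuotientMap (fun U hU => ?_) h, h'⟩
  rw [← h.isOpen_preimage, isOpen_iff_mem_nhds]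
  rintro z₀ ⟨z₁, hz₁, e⟩
  obtain ⟨γ₀, hγ₀, rfl⟩ := h'.1 e.symm
  have := (S.continuousOn_act (z₀, γ₀) hγ₀).preimage_mem_nhdsWithin (hU.mem_nhds hz₁)
  obtain ⟨W, hW, hWU⟩ := mem_nhdsWithin_iff_exists_mem_nhds_inter.1 this
  obtain ⟨A, hA, V, hV, hAV⟩ := mem_nhds_prod_iff.1 hW
  filter_upwards [hA, S.continuous_mom.continuousAt.preimage_mem_nhds
    (hγ₀ ▸ H.isOpenMap_rng.image_mem_nhds hV)] with z hzA hz
  obtain ⟨γ, hγ, e⟩ := hz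
  have hU : (z, γ) ∈ (fun q : Z × H.Arr => S.act q.1 q.2) ⁻¹' U := hWU ⟨hAV ⟨hzA, hγ⟩, e.symm⟩
  exact ⟨S.act z γ, hU, (h'.2 ⟨γ, e.symm, rfl⟩).symm⟩

variable (S) in
/-- The orbit relation. -/
def setoid : Setoid Z where
  r z z' := ∃ γ, S.mom z = H.rng γ ∧ z' = S.act z γ
  iseqv := by
    refine ⟨fun z => ⟨H.one (S.mom z), (H.rng_one _).symm, (S.act_one z).symm⟩, ?_, ?_⟩
    · rintro z _ ⟨γ, h, rfl⟩
      exact ⟨H.inv γ, by rw [S.mom_act h, H.rng_inv], (act_act_inv h).symm⟩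
    · rintro z _ _ ⟨γ, h, rfl⟩ ⟨η, h', rfl⟩
      have e : H.src γ = H.rng η := (S.mom_act h).symm.trans h'
      exact ⟨H.tmul γ η, by rw [H.rng_tmul, h], (S.act_tmul h e).symm⟩

theorem isQuot_mk : S.IsQuot (Quotient.mk S.setoid) :=
  .of_isQuotientMap isQuotientMap_quotient_mk' Quotient.eq

section

variable {π : Z → Ω} (hπ : S.IsQuot π)
include hπ

/-- Inside a product of compact neighbourhoods, properness confines the arrows that realise the
relation to a compact set. There the relation is contained in a compact image that itself consists
of related pairs, so limit points are related as well. -/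
theorem IsQuot.isClosed_rel [T2Space Z] [LocallyCompactSpace Z] (hS : S.IsProper) :
    IsClosed {q : Z × Z | π q.1 = π q.2} := by
  refine isClosed_of_closure_subset fun ⟨z, z'⟩ hz => ?_
  obtain ⟨A, hA, hAz⟩ := exists_compact_mem_nhds z
  obtain ⟨B, hB, hBz⟩ := exists_compact_mem_nhds z'
  obtain ⟨Γ, hΓ, h⟩ := hS A B hA hB
  let L : Set (Z × H.Arr) := (A ×ˢ Γ) ∩ {q | S.mom q.1 = H.rng q.2}
  have hL : IsCompact ((fun q : Z × H.Arr => (q.1, S.act q.1 q.2)) '' L) :=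
    ((hA.prod hΓ).inter_right S.isClosed_domain).image_of_continuousOn
      (continuousOn_fst.prodMk (S.continuousOn_act.mono Set.inter_subset_right))
  have hsub : (fun q : Z × H.Arr => (q.1, S.act q.1 q.2)) '' L ⊆ {q | π q.1 = π q.2} := by
    rintro _ ⟨⟨y, γ⟩, ⟨-, hγ⟩, rfl⟩
    exact (hπ.map_act hγ).symm
  refine hsub (hL.isClosed.closure_subset ?_)
  rw [mem_closure_iff_nhds] at hz ⊢
  intro t ht
  obtain ⟨⟨y, y'⟩, ⟨hyt, hyA, hyB⟩, hy⟩ := hz _ (Filter.inter_mem ht (prod_mem_nhds hAz hBz))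
  obtain ⟨γ, hγ, rfl⟩ := hπ.eq_iff (z := y) (z' := y') |>.1 hy
  exact ⟨(y, S.act y γ), hyt, ⟨(y, γ), ⟨⟨hyA, h y hyA γ hγ hyB⟩, hγ⟩, rfl⟩⟩

theorem IsQuot.t2Space [T2Space Z] [LocallyCompactSpace Z] (hS : S.IsProper) : T2Space Ω :=
  (t2Space_iff_of_isOpenQuotientMap hπ.isOpenQuotientMap).2 (hπ.isClosed_rel hS)

theorem IsQuot.secondCountableTopology [SecondCountableTopology Z] : SecondCountableTopology Ω :=
  hπ.isOpenQuotientMap.isQuotientMap.secondCountableTopology hπ.isOpenQuotientMap.isOpenMap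

theorem IsQuot.exists_isCompact_image [LocallyCompactSpace Z] {K : Set Ω} (hK : IsCompact K) :
    ∃ A : Set Z, IsCompact A ∧ K ⊆ π '' A := by
  choose A hA hAz using fun z : Z => exists_compact_mem_nhds z
  obtain ⟨t, ht⟩ := hK.elim_finite_subcover (fun z => π '' interior (A z))
    (fun z => hπ.isOpenQuotientMap.isOpenMap _ isOpen_interior) fun ω _ => by
      obtain ⟨z, rfl⟩ := hπ.isOpenQuotientMap.surjective ω
      exact Set.mem_iUnion.2 ⟨z, z, mem_interior_iff_mem_nhds.2 (hAz z), rfl⟩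
  refine ⟨⋃ z ∈ t, A z, t.isCompact_biUnion fun z _ => hA z, ht.trans ?_⟩
  simp only [Set.image_iUnion]
  exact Set.iUnion₂_mono fun z _ => Set.image_mono interior_subset

theorem IsQuot.locallyCompactSpace [LocallyCompactSpace Z] [T2Space Ω] :
    LocallyCompactSpace Ω := by
  have : WeaklyLocallyCompactSpace Ω := ⟨fun ω => by
    obtain ⟨z, rfl⟩ := hπ.isOpenQuotientMap.surjective ω
    obtain ⟨A, hA, hAz⟩ := exists_compact_mem_nhds z
    exact ⟨π '' A, hA.image hπ.isOpenQuotientMap.continuous,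
      hπ.isOpenQuotientMap.isOpenMap.image_mem_nhds hAz⟩⟩
  infer_instance

end

/-! ### Cutoff functions of proper actions -/

section Cutoff

variable [T2Space Z] [LocallyCompactSpace Z] [SecondCountableTopology Z]

variable (S) in
/-- The function `w` has compact support on the orbits, uniformly on compact sets. -/
def HasProperSupport (w : Z → ℝ) : Prop :=
  ∀ A : Set Z, IsCompact A → ∃ Γ : Set H.Arr, IsCompact Γ ∧
    ∀ z ∈ A, ∀ γ, S.mom z = H.rng γ → γ ∉ Γ → w (S.act z γ) = 0

/-- A partition of unity on the orbit space, subordinate to images of relatively compact open sets,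
is pulled back and multiplied term by term by bump functions equal to `1` on those sets. Over a
compact set only finitely many terms survive, and properness bounds the arrows that reach their
supports. -/
theorem IsProper.exists_properSupport (hS : S.IsProper) : ∃ w : Z → ℝ, Continuous w ∧
    (∀ z, 0 ≤ w z) ∧ (∀ z, ∃ γ, S.mom z = H.rng γ ∧ 0 < w (S.act z γ)) ∧
    S.HasProperSupport w := by
  let π : Z → Quotient S.setoid := Quotient.mk S.setoid
  have hπ : S.IsQuot π := isQuot_mk
  have := hπ.t2Space hS
  have := hπ.secondCountableTopology
  have := hπ.locallyCompactSpace
  choose A hA hAz using fun z : Z => exists_compact_mem_nhds z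
  choose φ h1 h0 hle _ using fun z : Z => exists_compactlySupported_one (hA z) isOpen_univ
    (Set.subset_univ _)
  obtain ⟨ψ, hψ⟩ := PartitionOfUnity.exists_isSubordinate (s := (Set.univ : Set (Quotient S.setoid)))
    isClosed_univ (fun z => π '' interior (A z))
    (fun z => hπ.isOpenQuotientMap.isOpenMap _ isOpen_interior) fun ω _ => by
      obtain ⟨z, rfl⟩ := hπ.isOpenQuotientMap.surjective ω
      exact Set.mem_iUnion.2 ⟨z, z, mem_interior_iff_mem_nhds.2 (hAz z), rfl⟩
  have hlf : LocallyFinite fun i => Function.support fun z => ψ i (π z) * φ i z := by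
    refine (ψ.locallyFinite.preimage_continuous hπ.isOpenQuotientMap.continuous).subset
      fun i z hz => ?_
    exact left_ne_zero_of_mul hz
  have hnn : ∀ i z, 0 ≤ ψ i (π z) * φ i z := fun i z => mul_nonneg (ψ.nonneg _ _) (h0 _ _)
  refine ⟨fun z => ∑ᶠ i, ψ i (π z) * φ i z, continuous_finsum (fun i => ?_) hlf,
    fun z => finsum_nonneg fun i => hnn i z, fun z => ?_, fun K hK => ?_⟩
  · exact ((ψ i).continuous.comp hπ.isOpenQuotientMap.continuous).mul (map_continuous (φ i))
  · obtain ⟨i, hi⟩ := ψ.exists_pos (Set.mem_univ (π z))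
    obtain ⟨z', hz', e⟩ := hψ i (subset_tsupport _ hi.ne')
    obtain ⟨γ, hγ, rfl⟩ := hπ.eq_iff.1 e.symm
    refine ⟨γ, hγ, ?_⟩
    have hfin : (Function.support fun j => ψ j (π (S.act z γ)) * φ j (S.act z γ)).Finite :=
      hlf.point_finite _
    refine lt_of_lt_of_le ?_ (single_le_finsum i hfin fun j => hnn j _)
    rw [h1 i _ (interior_subset hz'), mul_one, e]
    exact hi
  · have hfin := ψ.locallyFinite.finite_nonempty_inter_compact
      (hK.image hπ.isOpenQuotientMap.continuous)
    have hB : IsCompact (⋃ i ∈ hfin.toFinset, tsupport (φ i)) :=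
      hfin.toFinset.isCompact_biUnion fun i _ => (φ i).hasCompactSupport
    obtain ⟨Γ, hΓ, h⟩ := hS K _ hK hB
    refine ⟨Γ, hΓ, fun z hz γ hγ hγΓ => finsum_eq_zero_of_forall_eq_zero fun i => ?_⟩
    by_contra hne
    refine hγΓ (h z hz γ hγ (Set.mem_biUnion (x := i) ?_ (subset_tsupport _
      (right_ne_zero_of_mul hne))))
    simp only [Set.Finite.coe_toFinset, Set.mem_ofPred_eq]
    exact ⟨π (S.act z γ), left_ne_zero_of_mul hne, z, hz, (hπ.map_act hγ).symm⟩

variable [MeasurableSpace Z] [BorelSpace Z]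

theorem continuous_integral_haar {g : Z × H.Arr → ℝ}
    (hg : ContinuousOn g {q | S.mom q.1 = H.rng q.2})
    (hs : ∀ A : Set Z, IsCompact A → ∃ Γ : Set H.Arr, IsCompact Γ ∧
      ∀ z ∈ A, ∀ γ, S.mom z = H.rng γ → γ ∉ Γ → g (z, γ) = 0) :
    (∀ z, Integrable (fun γ => g (z, γ)) (H.haar (S.mom z))) ∧
      Continuous fun z => ∫ γ, g (z, γ) ∂H.haar (S.mom z) := by
  refine H.haar_family.continuous_integral_of_hasProperSupport H.continuous_rng S.continuous_mom hg
    fun z₀ => ?_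
  obtain ⟨A, hA, hAz⟩ := exists_compact_mem_nhds z₀
  obtain ⟨Γ, hΓ, h⟩ := hs A hA
  exact ⟨A, hAz, Γ, hΓ, h⟩

theorem continuousOn_comp_act {Y : Type*} [TopologicalSpace Y] {f : Z → Y} (hf : Continuous f) :
    ContinuousOn (fun q : Z × H.Arr => f (S.act q.1 q.2)) {q | S.mom q.1 = H.rng q.2} :=
  hf.comp_continuousOn S.continuousOn_act

theorem integral_haar_pos {z : Z} {f : H.Arr → ℝ} (hf : ContinuousOn f {γ | S.mom z = H.rng γ})
    (h0 : ∀ γ, S.mom z = H.rng γ → 0 ≤ f γ) (hi : Integrable f (H.haar (S.mom z)))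
    (hpos : ∃ γ, S.mom z = H.rng γ ∧ 0 < f γ) : 0 < ∫ γ, f γ ∂H.haar (S.mom z) := by
  obtain ⟨γ₀, hγ₀, hpos⟩ := hpos
  have hae : ∀ᵐ γ ∂H.haar (S.mom z), 0 ≤ f γ := by
    filter_upwards [H.ae_rng (S.mom z)] with γ hγ using h0 γ hγ.symm
  rw [integral_pos_iff_support_of_nonneg_ae hae hi]
  have hn := (hf γ₀ hγ₀).preimage_mem_nhdsWithin (isOpen_Ioi.mem_nhds hpos)
  obtain ⟨V, hV, hVf⟩ := mem_nhdsWithin_iff_exists_mem_nhds_inter.1 hn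
  have hVpos : 0 < H.haar (S.mom z) V := by
    rw [hγ₀]
    exact H.haar_family.measure_pos hV
  refine lt_of_lt_of_le hVpos (measure_mono_ae ?_)
  filter_upwards [H.ae_rng (S.mom z)] with γ hγ hγV
  exact (show (0 : ℝ) < f γ from hVf ⟨hγV, hγ.symm⟩).ne'

/-- A normalised continuous cutoff function for a proper action. -/
theorem IsProper.exists_cutoff (hS : S.IsProper) : ∃ e : Z → ℝ, Continuous e ∧ (∀ z, 0 ≤ e z) ∧
    S.HasProperSupport e ∧ S.IsCutoff fun z => ENNReal.ofReal (e z) := by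
  obtain ⟨w, hw, h0, hpos, hs⟩ := hS.exists_properSupport
  have hw' := S.continuousOn_comp_act hw
  obtain ⟨hi, hc⟩ := continuous_integral_haar hw' hs
  -- The orbit integral of `w` is continuous, positive and constant on orbits, so division by it
  -- normalises the average without affecting the support properties.
  let W : Z → ℝ := fun z => ∫ γ, w (S.act z γ) ∂H.haar (S.mom z)
  have hW : ∀ z, 0 < W z := fun z => integral_haar_pos
    (hw'.comp (f := fun γ => (z, γ)) (by fun_prop) fun γ hγ => hγ) (fun _ _ => h0 _) (hi z) (hpos z)
  have hWavg : ∀ z, ENNReal.ofReal (W z) = S.avg (fun z => ENNReal.ofReal (w z)) z := fun z =>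
    ofReal_integral_eq_lintegral_ofReal (hi z) (.of_forall fun γ => h0 _)
  have hWinv : ∀ z γ, S.mom z = H.rng γ → ENNReal.ofReal (W (S.act z γ))⁻¹ =
      ENNReal.ofReal (W z)⁻¹ := fun z γ hγ => by
    rw [ENNReal.ofReal_inv_of_pos (hW _), ENNReal.ofReal_inv_of_pos (hW _), hWavg, hWavg,
      S.avg_act hγ hw.measurable.ennreal_ofReal]
  refine ⟨fun z => w z * (W z)⁻¹, hw.mul (hc.inv₀ fun z => (hW z).ne'),
    fun z => mul_nonneg (h0 z) (inv_nonneg.2 (hW z).le), fun A hA => ?_, ?_, fun z => ?_⟩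
  · obtain ⟨Γ, hΓ, h⟩ := hs A hA
    exact ⟨Γ, hΓ, fun z hz γ hγ hγΓ =>
      mul_eq_zero_of_left (h z hz γ hγ hγΓ) _⟩
  · exact (hw.mul (hc.inv₀ fun z => (hW z).ne')).measurable.ennreal_ofReal
  · simp_rw [ENNReal.ofReal_mul (h0 _)]
    rw [S.avg_mul_of_invariant hw.measurable.ennreal_ofReal hWinv, ← hWavg,
      ENNReal.ofReal_inv_of_pos (hW _), ENNReal.mul_inv_cancel (ENNReal.ofReal_pos.2 (hW z)).ne'
        ENNReal.ofReal_ne_top]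

end Cutoff

/-! ### Uniqueness, invariance and descent of densities -/

section Density

variable [T2Space Z] [LocallyCompactSpace Z] [SecondCountableTopology Z] [MeasurableSpace Z]
  [BorelSpace Z]

variable (S) in
/-- The measure on the transformation groupoid induced by a measure on `Z`. -/
noncomputable def groupoidMeasure (M : Measure Z) : Measure (Z × H.Arr) :=
  H.haar_family.prodMeasure H.continuous_rng S.continuous_mom M

theorem lintegral_groupoidMeasure (M : Measure Z) [SFinite M] {F : Z × H.Arr → ℝ≥0∞}
    (hF : Measurable F) :
    ∫⁻ q, F q ∂S.groupoidMeasure M = ∫⁻ z, ∫⁻ γ, F (z, γ) ∂H.haar (S.mom z) ∂M :=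
  IsMeasureFamily.lintegral_prodMeasure _ _ _ _ hF

theorem ae_groupoidMeasure (M : Measure Z) [SFinite M] :
    ∀ᵐ q ∂S.groupoidMeasure M, S.mom q.1 = H.rng q.2 :=
  IsMeasureFamily.ae_prodMeasure _ _ _ _

instance (M : Measure Z) [IsFiniteMeasureOnCompacts M] :
    IsFiniteMeasureOnCompacts (S.groupoidMeasure M) :=
  IsMeasureFamily.isFiniteMeasureOnCompacts_prodMeasure _ _ _ _

/-- Two continuous densities on the transformation groupoid that define the same functional agree
on the support. -/
theorem eq_of_lintegral_mul_eq {M : Measure Z} [IsFiniteMeasureOnCompacts M]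
    {g₁ g₂ : Z × H.Arr → ℝ} (m₁ : Measurable g₁) (m₂ : Measurable g₂)
    (c₁ : ContinuousOn g₁ {q | S.mom q.1 = H.rng q.2})
    (c₂ : ContinuousOn g₂ {q | S.mom q.1 = H.rng q.2})
    (n₁ : ∀ z γ, S.mom z = H.rng γ → 0 ≤ g₁ (z, γ)) (n₂ : ∀ z γ, S.mom z = H.rng γ → 0 ≤ g₂ (z, γ))
    (h : ∀ F : Z × H.Arr → ℝ≥0∞, Measurable F →
      ∫⁻ z, ∫⁻ γ, F (z, γ) * ENNReal.ofReal (g₁ (z, γ)) ∂H.haar (S.mom z) ∂M =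
        ∫⁻ z, ∫⁻ γ, F (z, γ) * ENNReal.ofReal (g₂ (z, γ)) ∂H.haar (S.mom z) ∂M)
    {z : Z} {γ : H.Arr} (hz : z ∈ M.support) (hγ : S.mom z = H.rng γ) :
    g₁ (z, γ) = g₂ (z, γ) := by
  refine eq_on_support_of_lintegral_eq (N := S.groupoidMeasure M) S.isClosed_domain
    (ae_groupoidMeasure M) m₁ m₂ c₁ c₂ (fun q => n₁ q.1 q.2) (fun q => n₂ q.1 q.2)
    (fun F hF => ?_) _ (IsMeasureFamily.mem_support_prodMeasure _ _ _ _ hz hγ)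
  exact (lintegral_groupoidMeasure M (hF.mul m₁.ennreal_ofReal)).trans
    ((h F hF).trans (lintegral_groupoidMeasure M (hF.mul m₂.ennreal_ofReal)).symm)

/-- Comparing the inversion invariance of `M` with that of `D M` shows that `D(z γ)` and `D(z)` are
densities of the same measure on the transformation groupoid. They are continuous on the domain of
the action, hence equal over the support of `M`. -/
theorem QInv.density_invariant {M : Measure Z} [IsFiniteMeasureOnCompacts M] {D : Z → ℝ}
    (hD : Continuous D) (hpos : ∀ z, 0 < D z) (h : S.QInv M fun _ _ => 1)
    (h' : S.QInv (M.withDensity fun z => ENNReal.ofReal (D z)) fun _ _ => 1)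
    {z : Z} {γ : H.Arr} (hz : z ∈ M.support) (hγ : S.mom z = H.rng γ) : D (S.act z γ) = D z := by
  have hDm := hD.measurable
  refine eq_of_lintegral_mul_eq (g₁ := fun q => D (S.act q.1 q.2)) (g₂ := fun q => D q.1)
    (hDm.comp S.measurable_act) (hDm.comp measurable_fst) (S.continuousOn_comp_act hD)
    (hD.comp continuous_fst).continuousOn (fun _ _ _ => (hpos _).le) (fun _ _ _ => (hpos _).le)
    (fun F hF => ?_) hz hγ
  have hF' : Measurable fun q : Z × H.Arr => F (S.act q.1 q.2, H.inv q.2) :=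
    hF.comp (S.measurable_act.prodMk (H.continuous_inv.measurable.comp measurable_snd))
  have e₁ := h (fun q => F (S.act q.1 q.2, H.inv q.2) * ENNReal.ofReal (D q.1))
    (hF'.mul (hDm.comp measurable_fst).ennreal_ofReal)
  have e₂ := h' F hF
  simp only [ENNReal.ofReal_one, mul_one] at e₁ e₂
  have m₁ := S.measurable_lintegral_haar hF
  have m₂ := S.measurable_lintegral_haar hF'
  rw [lintegral_withDensity_mul hDm.ennreal_ofReal m₁,
    lintegral_withDensity_mul hDm.ennreal_ofReal m₂] at e₂
  have c : ∀ (f : Z × H.Arr → ℝ≥0∞), Measurable f → ∀ z,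
      ∫⁻ γ, f (z, γ) * ENNReal.ofReal (D z) ∂H.haar (S.mom z) =
        ENNReal.ofReal (D z) * ∫⁻ γ, f (z, γ) ∂H.haar (S.mom z) := fun f hf z => by
    rw [lintegral_mul_const _ (f := fun γ => f (z, γ)) (hf.comp measurable_prodMk_left), mul_comm]
  simp_rw [c F hF, e₂, ← c _ hF', e₁]
  refine lintegral_congr fun z => lintegral_congr_ae ?_
  filter_upwards [H.ae_rng (S.mom z)] with γ hγ
  rw [act_act_inv hγ.symm, H.inv_inv]

/-- This descends a continuous Radon–Nikodym derivative from `Z` to the orbit space. Each measure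
yields invariance of `D` only on its own support; `hsupp` says that these supports cover `Z`.
Uniqueness of lifts then identifies the measures downstairs. -/
theorem IsLift.exists_density {ι : Type*} [MeasurableSpace Ω] [BorelSpace Ω] [T2Space Ω]
    [SecondCountableTopology Ω] {π : Z → Ω} {μ μ' : ι → Measure Ω} {M : ι → Measure Z}
    (hπ : S.IsQuot π) {e : Z → ℝ≥0∞} (he : S.IsCutoff e)
    (hM : ∀ a, IsFiniteMeasureOnCompacts (M a)) (hsupp : ∀ z, ∃ a, z ∈ (M a).support)
    {D : Z → ℝ} (hD : Continuous D) (hpos : ∀ z, 0 < D z) (h : ∀ a, S.IsLift π (μ a) (M a))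
    (h' : ∀ a, S.IsLift π (μ' a) ((M a).withDensity fun z => ENNReal.ofReal (D z))) :
    ∃ D' : Ω → ℝ, Continuous D' ∧ (∀ ω, 0 < D' ω) ∧ (∀ z, D' (π z) = D z) ∧
      ∀ a, μ' a = (μ a).withDensity fun ω => ENNReal.ofReal (D' ω) := by
  have hinv : ∀ z γ, S.mom z = H.rng γ → D (S.act z γ) = D z := fun z γ hγ => by
    obtain ⟨a, ha⟩ := hsupp z
    have := hM a
    exact ((h a).qinv hπ).density_invariant hD hpos ((h' a).qinv hπ) ha hγ
  obtain ⟨D', hD', e'⟩ := hπ.exists_continuous_descend hD hinv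
  refine ⟨D', hD', fun ω => ?_, e', fun a => (h' a).unique hπ he fun f hf F hF => ?_⟩
  · obtain ⟨z, rfl⟩ := hπ.isOpenQuotientMap.surjective ω
    rw [e']
    exact hpos z
  · have hFm : Measurable F := by
      refine measurable_of_comp_surjective hπ.isOpenQuotientMap.continuous.measurable
        hπ.isOpenQuotientMap.surjective ?_
      simp_rw [hF]
      exact S.measurable_avg hf
    have hDm := hD.measurable.ennreal_ofReal
    rw [lintegral_withDensity_mul hD'.measurable.ennreal_ofReal hFm,
      lintegral_withDensity_mul hDm hf, ← h a (fun z => ENNReal.ofReal (D z) * f z) (hDm.mul hf)]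
    intro z
    simp_rw [mul_comm (ENNReal.ofReal (D _))]
    rw [S.avg_mul_of_invariant hf fun z γ hγ => by rw [hinv z γ hγ], mul_comm, hF, e']

end Density

end RAct

namespace RAct

open scoped ENNReal

variable {H : HaarGroupoid.{u}} {Z : Type*} [TopologicalSpace Z]
  {S : RAct H Z} [T2Space Z] [LocallyCompactSpace Z] [SecondCountableTopology Z]
  [MeasurableSpace Z] [BorelSpace Z]

/-! #### The modular cocycle of a quasi-invariant measure -/

section Cocycle

variable {M : Measure Z} {δ : Z → H.Arr → ℝ}

theorem measurable_triple {F : Z → H.Arr → H.Arr → ℝ≥0∞}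
    (hF : Measurable fun q : (Z × H.Arr) × H.Arr => F q.1.1 q.1.2 q.2) {Y : Type*}
    [MeasurableSpace Y] {a : Y → Z} {b c : Y → H.Arr} (ha : Measurable a) (hb : Measurable b)
    (hc : Measurable c) : Measurable fun y => F (a y) (b y) (c y) :=
  hF.comp ((ha.prodMk hb).prodMk hc)

/-- The integral over the triples `(z, γ, η)` with `rng γ = rng η = mom z`. -/
noncomputable def tripleIntegral (S : RAct H Z) (M : Measure Z)
    (F : Z → H.Arr → H.Arr → ℝ≥0∞) : ℝ≥0∞ :=
  ∫⁻ z, ∫⁻ γ, ∫⁻ η, F z γ η ∂H.haar (S.mom z) ∂H.haar (S.mom z) ∂M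

theorem tripleIntegral_congr {F F' : Z → H.Arr → H.Arr → ℝ≥0∞}
    (h : ∀ z γ η, S.mom z = H.rng γ → S.mom z = H.rng η → F z γ η = F' z γ η) :
    S.tripleIntegral M F = S.tripleIntegral M F' := by
  refine lintegral_congr fun z => lintegral_congr_ae ?_
  filter_upwards [H.ae_rng (S.mom z)] with γ hγ
  refine lintegral_congr_ae ?_
  filter_upwards [H.ae_rng (S.mom z)] with η hη using h z γ η hγ.symm hη.symm

theorem tripleIntegral_swap {F : Z → H.Arr → H.Arr → ℝ≥0∞}
    (hF : Measurable fun q : (Z × H.Arr) × H.Arr => F q.1.1 q.1.2 q.2) :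
    S.tripleIntegral M F = S.tripleIntegral M fun z γ η => F z η γ := by
  refine lintegral_congr fun z => ?_
  have := H.haar_family.finiteOnCompacts (S.mom z)
  exact lintegral_lintegral_swap
    (measurable_triple hF measurable_const measurable_fst measurable_snd).aemeasurable

/-- Quasi-invariance is applied to the function integrated over the third variable, and left
invariance then shifts that variable by `γ⁻¹`. -/
theorem QInv.tripleIntegral (h : S.QInv M δ)
    {F : Z → H.Arr → H.Arr → ℝ≥0∞}
    (hF : Measurable fun q : (Z × H.Arr) × H.Arr => F q.1.1 q.1.2 q.2) :
    S.tripleIntegral M F = S.tripleIntegral M fun z γ η =>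
      F (S.act z γ) (H.inv γ) (H.tmul (H.inv γ) η) * ENNReal.ofReal (δ z γ) := by
  have e := h (fun q => ∫⁻ η, F q.1 q.2 η ∂H.haar (S.mom q.1))
    (H.haar_family.measurable_lintegral H.continuous_rng
      (S.continuous_mom.comp continuous_fst) hF)
  refine e.trans (lintegral_congr fun z => lintegral_congr_ae ?_)
  filter_upwards [H.ae_rng (S.mom z)] with γ hγ
  have m : Measurable fun η => F (S.act z γ) (H.inv γ) η :=
    measurable_triple hF measurable_const measurable_const measurable_id
  have m' : Measurable fun η => F (S.act z γ) (H.inv γ) (H.tmul (H.inv γ) η) :=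
    m.comp (H.measurable_tmul.comp measurable_prodMk_left)
  rw [lintegral_mul_const _ m', ← hγ, H.lintegral_inv_tmul γ m, S.mom_act hγ.symm]

/-- A triple `(z, γ, η)` is a triangle with vertices `z`, `z γ`, `z η`. Quasi-invariance exchanges
the first two vertices at the cost of a factor `δ z γ`, and Fubini exchanges the last two freely.
These transpositions satisfy the braid relation; comparing the factors collected along its two sides
gives the cocycle identity as an equality of densities on the space of triples. -/
theorem QInv.cocycle [IsFiniteMeasureOnCompacts M] (h : S.QInv M δ)
    (hδ : Measurable fun q : Z × H.Arr => δ q.1 q.2)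
    (hδc : ContinuousOn (fun q : Z × H.Arr => δ q.1 q.2) {q | S.mom q.1 = H.rng q.2})
    (hδ0 : ∀ z γ, S.mom z = H.rng γ → 0 < δ z γ) {z : Z} {γ η : H.Arr} (hz : z ∈ M.support)
    (hγ : S.mom z = H.rng γ) (hη : S.mom z = H.rng η) :
    δ z γ * δ (S.act z γ) (H.tmul (H.inv γ) η) = δ z η := by
  have hinv := H.continuous_inv.measurable
  have hm := H.measurable_tmul
  have hact := S.measurable_act
  have p1 : Measurable fun q : (Z × H.Arr) × H.Arr => q.1.1 := measurable_fst.comp measurable_fst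
  have p2 : Measurable fun q : (Z × H.Arr) × H.Arr => q.1.2 := measurable_snd.comp measurable_fst
  have p3 : Measurable fun q : (Z × H.Arr) × H.Arr => q.2 := measurable_snd
  have i2 : Measurable fun q : (Z × H.Arr) × H.Arr => H.inv q.1.2 := hinv.comp p2
  have i3 : Measurable fun q : (Z × H.Arr) × H.Arr => H.inv q.2 := hinv.comp p3
  have m23 : Measurable fun q : (Z × H.Arr) × H.Arr => H.tmul (H.inv q.1.2) q.2 := hm.comp (i2.prodMk p3)
  have m32 : Measurable fun q : (Z × H.Arr) × H.Arr => H.tmul (H.inv q.2) q.1.2 := hm.comp (i3.prodMk p2)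
  have a12 : Measurable fun q : (Z × H.Arr) × H.Arr => S.act q.1.1 q.1.2 := hact.comp (p1.prodMk p2)
  have a13 : Measurable fun q : (Z × H.Arr) × H.Arr => S.act q.1.1 q.2 := hact.comp (p1.prodMk p3)
  have d12 : Measurable fun q : (Z × H.Arr) × H.Arr => δ q.1.1 q.1.2 := hδ.comp (p1.prodMk p2)
  have d13 : Measurable fun q : (Z × H.Arr) × H.Arr => δ q.1.1 q.2 := hδ.comp (p1.prodMk p3)
  have d123 : Measurable fun q : (Z × H.Arr) × H.Arr => δ (S.act q.1.1 q.1.2) (H.tmul (H.inv q.1.2) q.2) :=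
    hδ.comp (a12.prodMk m23)
  have key : ∀ E : (Z × H.Arr) × H.Arr → ℝ≥0∞, Measurable E →
      S.tripleIntegral M (fun z γ η => E ((z, γ), η) *
        ENNReal.ofReal (δ z γ * δ (S.act z γ) (H.tmul (H.inv γ) η))) =
      S.tripleIntegral M (fun z γ η => E ((z, γ), η) * ENNReal.ofReal (δ z η)) := by
    intro E hE
    -- Both sides of the braid relation exchange the first and third vertices. `F` is `E` composed
    -- with this exchange, so that `E` itself reappears at the end.
    let F : Z → H.Arr → H.Arr → ℝ≥0∞ := fun z γ η =>
      E ((S.act z η, H.tmul (H.inv η) γ), H.inv η)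
    have hF : Measurable fun q : (Z × H.Arr) × H.Arr => F q.1.1 q.1.2 q.2 :=
      hE.comp ((a13.prodMk m32).prodMk i3)
    have hF1 : Measurable fun q : (Z × H.Arr) × H.Arr => F (S.act q.1.1 q.1.2) (H.inv q.1.2)
        (H.tmul (H.inv q.1.2) q.2) * ENNReal.ofReal (δ q.1.1 q.1.2) :=
      (measurable_triple hF a12 i2 m23).mul d12.ennreal_ofReal
    have hF2 : Measurable fun q : (Z × H.Arr) × H.Arr => F (S.act q.1.1 q.2) (H.inv q.2)
        (H.tmul (H.inv q.2) q.1.2) * ENNReal.ofReal (δ q.1.1 q.2) :=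
      (measurable_triple hF a13 i3 m32).mul d13.ennreal_ofReal
    have hG : Measurable fun q : (Z × H.Arr) × H.Arr => F q.1.1 q.2 q.1.2 := measurable_triple hF p1 p3 p2
    have hG2 : Measurable fun q : (Z × H.Arr) × H.Arr => F (S.act q.1.1 q.1.2) (H.tmul (H.inv q.1.2) q.2)
        (H.inv q.1.2) * ENNReal.ofReal (δ q.1.1 q.1.2) :=
      (measurable_triple hF a12 m23 i2).mul d12.ennreal_ofReal
    have e₁ := (h.tripleIntegral hF).trans ((tripleIntegral_swap hF1).trans
      (h.tripleIntegral hF2))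
    have e₂ := (tripleIntegral_swap hF).trans ((h.tripleIntegral hG).trans
      (tripleIntegral_swap hG2))
    have e₃ := e₁.symm.trans e₂
    have l1 : ∀ z γ η, S.mom z = H.rng γ → S.mom z = H.rng η →
        H.inv (H.tmul (H.inv γ) η) = H.tmul (H.inv η) γ := fun z γ η hγ hη => by
      rw [H.inv_tmul_rev (by simp [← hγ, ← hη]), H.inv_inv]
    have l2 : ∀ z γ η, S.mom z = H.rng γ → S.mom z = H.rng η →
        S.act (S.act z γ) (H.tmul (H.inv γ) η) = S.act z η := fun z γ η hγ hη => by
      rw [← S.act_tmul hγ (by simp), H.tmul_inv_cancel_left (hγ.symm.trans hη)]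
    refine Eq.trans (tripleIntegral_congr fun z γ η hγ hη => ?_)
      (e₃.trans (tripleIntegral_congr fun z γ η hγ hη => ?_))
    · have hr : H.rng γ = H.rng η := hγ.symm.trans hη
      simp only [F]
      rw [l1 z γ η hγ hη, l2 z γ η hγ hη, H.tmul_inv_cancel_right (by simpa using hr.symm),
        act_act_inv hη, H.inv_inv, H.tmul_inv_cancel_left hr.symm, ENNReal.ofReal_mul
          (hδ0 z γ hγ).le, mul_assoc, mul_comm (ENNReal.ofReal (δ z γ))]
    · have hr : H.rng γ = H.rng η := hγ.symm.trans hη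
      simp only [F]
      rw [act_act_inv hη, H.inv_inv, H.tmul_inv_cancel_left hr.symm]
  let C : Set ((Z × H.Arr) × H.Arr) := {q | S.mom q.1.1 = H.rng q.1.2 ∧ S.mom q.1.1 = H.rng q.2}
  have hC : IsClosed C := by
    have c1 := S.continuous_mom
    have c2 := H.continuous_rng
    exact (isClosed_eq (by fun_prop) (by fun_prop)).inter (isClosed_eq (by fun_prop) (by fun_prop))
  have hl : Continuous fun q : Z × H.Arr => S.mom q.1 := S.continuous_mom.comp continuous_fst
  -- The support of this measure contains every triple in `C` whose first entry lies in the support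
  -- of `M`, so an equality of densities for `N` yields a pointwise identity there.
  let N : Measure ((Z × H.Arr) × H.Arr) := H.haar_family.prodMeasure H.continuous_rng hl (S.groupoidMeasure M)
  have hNi : ∀ F : (Z × H.Arr) × H.Arr → ℝ≥0∞, Measurable F →
      ∫⁻ q, F q ∂N = S.tripleIntegral M fun z γ η => F ((z, γ), η) := fun F hF => by
    refine (IsMeasureFamily.lintegral_prodMeasure _ _ _ _ hF).trans ?_
    exact lintegral_groupoidMeasure M
      (H.haar_family.measurable_lintegral H.continuous_rng hl hF)
  have : IsFiniteMeasureOnCompacts N :=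
    IsMeasureFamily.isFiniteMeasureOnCompacts_prodMeasure _ _ _ _
  have hNC : ∀ᵐ v ∂N, v ∈ C := by
    refine (lintegral_eq_zero_iff (measurable_one.indicator hC.measurableSet.compl)).1 ?_ |>.mono
      fun v hv => ?_
    · rw [hNi _ (measurable_one.indicator hC.measurableSet.compl)]
      refine (tripleIntegral_congr (F' := fun _ _ _ => 0) fun z γ η hγ hη => ?_).trans ?_
      · exact Set.indicator_of_notMem (fun hn : ((z, γ), η) ∈ Cᶜ => hn ⟨hγ, hη⟩) _
      · simp [RAct.tripleIntegral]
    · by_contra hvC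
      simp [Set.indicator_of_mem (show v ∈ Cᶜ from hvC)] at hv
  have c12 : ContinuousOn (fun q : (Z × H.Arr) × H.Arr => δ q.1.1 q.1.2) C :=
    hδc.comp (f := fun q : (Z × H.Arr) × H.Arr => q.1) (by fun_prop) fun q hq => hq.1
  have c13 : ContinuousOn (fun q : (Z × H.Arr) × H.Arr => δ q.1.1 q.2) C :=
    hδc.comp (f := fun q : (Z × H.Arr) × H.Arr => (q.1.1, q.2)) (by fun_prop) fun q hq => hq.2
  have ca : ContinuousOn (fun q : (Z × H.Arr) × H.Arr => S.act q.1.1 q.1.2) C :=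
    S.continuousOn_act.comp (f := fun q : (Z × H.Arr) × H.Arr => q.1) (by fun_prop) fun q hq => hq.1
  have cm : ContinuousOn (fun q : (Z × H.Arr) × H.Arr => H.tmul (H.inv q.1.2) q.2) C :=
    H.continuousOn_tmul.comp (f := fun q : (Z × H.Arr) × H.Arr => (H.inv q.1.2, q.2))
      (((H.continuous_inv.comp (continuous_snd.comp continuous_fst)).prodMk
        continuous_snd).continuousOn) fun q hq => by
        simpa using hq.1.symm.trans hq.2
  have hdom : ∀ q ∈ C, S.mom (S.act q.1.1 q.1.2) = H.rng (H.tmul (H.inv q.1.2) q.2) :=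
    fun q hq => by rw [S.mom_act hq.1, H.rng_tmul, H.rng_inv]
  have c123 : ContinuousOn (fun q : (Z × H.Arr) × H.Arr => δ (S.act q.1.1 q.1.2) (H.tmul (H.inv q.1.2) q.2)) C :=
    hδc.comp (ca.prodMk cm) hdom
  refine eq_on_support_of_lintegral_eq (N := N) hC hNC (g₁ := fun q : (Z × H.Arr) × H.Arr => δ q.1.1 q.1.2 *
      δ (S.act q.1.1 q.1.2) (H.tmul (H.inv q.1.2) q.2)) (g₂ := fun q => δ q.1.1 q.2)
    (d12.mul d123) d13 (c12.mul c123) c13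
    (fun q hq => (mul_pos (hδ0 _ _ hq.1) (hδ0 _ _ (hdom q hq))).le)
    (fun q hq => (hδ0 _ _ hq.2).le) (fun F hF => ?_) ((z, γ), η)
    (IsMeasureFamily.mem_support_prodMeasure _ _ _ _
      (IsMeasureFamily.mem_support_prodMeasure _ _ _ _ hz hγ) hη)
  refine (hNi _ (hF.mul (d12.mul d123).ennreal_ofReal)).trans ((key F hF).trans ?_)
  exact (hNi _ (hF.mul d13.ennreal_ofReal)).symm

end Cocycle

end RAct

/-! ### Densities that are continuous on a closed set of full measure -/

section

variable {V : Type*} [TopologicalSpace V] [T2Space V] [MeasurableSpace V] [BorelSpace V]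
  {N : Measure V} [IsFiniteMeasureOnCompacts N] {C : Set V} {g : V → ℝ}

theorem isFiniteMeasureOnCompacts_withDensity (hC : IsClosed C) (hN : ∀ᵐ v ∂N, v ∈ C)
    (hg : ContinuousOn g C) :
    IsFiniteMeasureOnCompacts (N.withDensity fun v => ENNReal.ofReal (g v)) := by
  refine ⟨fun K hK => ?_⟩
  have hKC : IsCompact (K ∩ C) := hK.inter_right hC
  obtain ⟨c, hc⟩ := (hKC.image_of_continuousOn (hg.mono Set.inter_subset_right)).bddAbove
  rw [withDensity_apply _ hK.measurableSet]
  calc ∫⁻ v in K, ENNReal.ofReal (g v) ∂N ≤ ∫⁻ _ in K, ENNReal.ofReal c ∂N := by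
        refine lintegral_mono_ae ?_
        filter_upwards [ae_restrict_of_ae hN, ae_restrict_mem hK.measurableSet] with v hv hvK
        exact ENNReal.ofReal_le_ofReal (hc ⟨v, ⟨hvK, hv⟩, rfl⟩)
    _ < ⊤ := by
        rw [setLIntegral_const]
        exact ENNReal.mul_lt_top ENNReal.ofReal_lt_top hK.measure_lt_top

theorem integrable_of_continuousOn_of_isCompact (hC : IsClosed C) (hN : ∀ᵐ v ∂N, v ∈ C)
    (hg : ContinuousOn g C) {L : Set V} (hL : IsCompact L) (h0 : ∀ v ∈ C, v ∉ L → g v = 0) :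
    Integrable g N := by
  have hLC : IsCompact (L ∩ C) := hL.inter_right hC
  have : IntegrableOn g (L ∩ C) N :=
    (hg.mono Set.inter_subset_right).integrableOn_compact hLC
  refine this.integrable_of_ae_notMem_eq_zero ?_
  filter_upwards [hN] with v hv hvL
  exact h0 v hv fun h => hvL ⟨h, hv⟩

end

/-! ### Inversion of the transformation groupoid -/

namespace RAct

variable {H : HaarGroupoid.{u}} {Z : Type*} [TopologicalSpace Z] {S : RAct H Z}

theorem isCompact_image_act {K : Set (Z × H.Arr)} (hK : IsCompact K) :
    IsCompact ((fun q : Z × H.Arr => S.act q.1 q.2) '' (K ∩ {q | S.mom q.1 = H.rng q.2})) :=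
  (hK.inter_right S.isClosed_domain).image_of_continuousOn
    (S.continuousOn_act.mono Set.inter_subset_right)

/-- Inversion of the transformation groupoid. -/
def flip (S : RAct H Z) (q : Z × H.Arr) : Z × H.Arr := (S.act q.1 q.2, H.inv q.2)

theorem flip_flip {q : Z × H.Arr} (h : S.mom q.1 = H.rng q.2) : S.flip (S.flip q) = q := by
  unfold flip
  rw [act_act_inv h, H.inv_inv]

theorem flip_mem {q : Z × H.Arr} (h : S.mom q.1 = H.rng q.2) :
    S.mom (S.flip q).1 = H.rng (S.flip q).2 := by
  simp [flip, S.mom_act h]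

theorem continuousOn_flip : ContinuousOn S.flip {q | S.mom q.1 = H.rng q.2} :=
  S.continuousOn_act.prodMk (H.continuous_inv.comp continuous_snd).continuousOn

theorem measurable_flip [T2Space Z] [LocallyCompactSpace Z] [SecondCountableTopology Z]
    [MeasurableSpace Z] [BorelSpace Z] : Measurable S.flip :=
  S.measurable_act.prodMk (H.continuous_inv.measurable.comp measurable_snd)

theorem exists_isCompact_flip {K : Set (Z × H.Arr)} (hK : IsCompact K) :
    ∃ L, IsCompact L ∧ ∀ q : Z × H.Arr, S.mom q.1 = H.rng q.2 → S.flip q ∈ K → q ∈ L :=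
  ⟨_, (hK.inter_right S.isClosed_domain).image_of_continuousOn
    (S.continuousOn_flip.mono Set.inter_subset_right),
    fun q hq hqK => ⟨S.flip q, ⟨hqK, flip_mem hq⟩, flip_flip hq⟩⟩

end RAct

/-! ### The two actions of a correspondence -/

namespace Corr

open scoped ENNReal

variable {G H : HaarGroupoid.{u}} (P : Corr G H)

instance : T2Space P.carrier := P.str.t2
instance : LocallyCompactSpace P.carrier := P.str.locallyCompact
instance : SecondCountableTopology P.carrier := P.str.secondCountable
instance : BorelSpace P.carrier := P.str.borel
instance (a : H.Obj) : IsFiniteMeasureOnCompacts (P.str.meas a) :=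
  P.str.meas_family.finiteOnCompacts a

/-- The right action. -/
noncomputable def right : RAct H P.carrier where
  mom := P.str.rmom
  act x k := if h : P.str.rmom x = H.rng k then P.str.ract ⟨(x, k), h⟩ else x
  continuous_mom := P.str.continuous_rmom
  continuousOn_act := continuousOn_of_forall_eq P.str.continuous_ract fun _ hq => dif_pos hq
  act_junk z γ h := dif_neg h
  mom_act h := by rw [dif_pos h]; exact P.str.rmom_ract _
  act_one z := by rw [dif_pos (H.rng_one _).symm]; exact P.str.ract_one _ _
  act_tmul {z γ η} h h' := by
    have h₁ : P.str.rmom z = H.rng (H.tmul γ η) := by rwa [H.rng_tmul]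
    have h₂ : P.str.rmom (P.str.ract ⟨(z, γ), h⟩) = H.rng η := (P.str.rmom_ract _).trans h'
    have h₃ : P.str.rmom z = H.rng (H.mul ⟨(γ, η), h'⟩) := by rwa [H.rng_mul]
    rw [dif_pos h₁, dif_pos h, dif_pos h₂, ← P.str.ract_mul z γ η h h' h₃ h₂]
    exact P.str.ract_congr (H.tmul_eq h') rfl _ _

/-- The left action, as a right action: `x · g = g⁻¹ x`. -/
noncomputable def left : RAct G P.carrier where
  mom := P.str.lmom
  act x g := if h : P.str.lmom x = G.rng g then
    P.str.lact ⟨(G.inv g, x), (G.src_inv g).trans h.symm⟩ else x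
  continuous_mom := P.str.continuous_lmom
  continuousOn_act := by
    refine continuousOn_of_forall_eq
      (f' := fun q : {q : P.carrier × G.Arr | P.str.lmom q.1 = G.rng q.2} =>
        P.str.lact ⟨(G.inv q.1.2, q.1.1), (G.src_inv q.1.2).trans q.2.symm⟩)
      (P.str.continuous_lact.comp (Continuous.subtype_mk ?_ _)) fun _ hq => dif_pos hq
    exact (G.continuous_inv.comp (continuous_snd.comp continuous_subtype_val)).prodMk
      (continuous_fst.comp continuous_subtype_val)
  act_junk z γ h := dif_neg h
  mom_act h := by rw [dif_pos h, P.str.lmom_lact, G.rng_inv]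
  act_one z := by
    rw [dif_pos (G.rng_one _).symm, P.str.lact_congr (G.inv_one _) rfl _ (by simp)]
    exact P.str.lact_one _ _
  act_tmul {z γ η} h h' := by
    have h₁ : P.str.lmom z = G.rng (G.tmul γ η) := by rwa [G.rng_tmul]
    have h₂ : G.src (G.inv γ) = P.str.lmom z := (G.src_inv γ).trans h.symm
    have h₃ : P.str.lmom (P.str.lact ⟨(G.inv γ, z), h₂⟩) = G.rng η := by
      rw [P.str.lmom_lact, G.rng_inv, h']
    have h₄ : G.src (G.inv η) = G.rng (G.inv γ) := by simp [h']
    have h₅ : G.src (G.mul ⟨(G.inv η, G.inv γ), h₄⟩) = P.str.lmom z := by rw [G.src_mul, h₂]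
    rw [dif_pos h₁, dif_pos h, dif_pos h₃, ← P.str.lact_mul (G.inv η) (G.inv γ) z h₄ h₂ h₅]
    exact P.str.lact_congr ((G.inv_tmul_rev h').trans (G.tmul_eq h₄)) rfl _ _

variable {P}

theorem right_act_eq {x : P.carrier} {k : H.Arr} (h : P.str.rmom x = H.rng k) :
    P.right.act x k = P.str.ract ⟨(x, k), h⟩ := dif_pos h

theorem left_act_eq {x : P.carrier} {g : G.Arr} (h : P.str.lmom x = G.rng g) :
    P.left.act x g = P.str.lact ⟨(G.inv g, x), (G.src_inv g).trans h.symm⟩ := dif_pos h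

theorem lact_eq_left_act {x : P.carrier} {g : G.Arr} (h : G.src g = P.str.lmom x) :
    P.str.lact ⟨(g, x), h⟩ = P.left.act x (G.inv g) := by
  rw [left_act_eq (by simp [h])]
  exact P.str.lact_congr G.inv_inv.symm rfl _ _

theorem lmom_left_act {x : P.carrier} {g : G.Arr} (h : P.str.lmom x = G.rng g) :
    P.str.lmom (P.left.act x g) = G.src g := P.left.mom_act h

theorem rmom_right_act {x : P.carrier} {k : H.Arr} (h : P.str.rmom x = H.rng k) :
    P.str.rmom (P.right.act x k) = H.src k := P.right.mom_act h

@[simp]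
theorem left_mom (x : P.carrier) : P.left.mom x = P.str.lmom x := rfl

@[simp]
theorem right_mom (x : P.carrier) : P.right.mom x = P.str.rmom x := rfl

@[simp]
theorem rmom_left_act (x : P.carrier) (g : G.Arr) :
    P.str.rmom (P.left.act x g) = P.str.rmom x := by
  by_cases h : P.str.lmom x = G.rng g
  · rw [left_act_eq h, P.str.rmom_lact]
  · rw [P.left.act_junk _ _ h]

@[simp]
theorem lmom_right_act (x : P.carrier) (k : H.Arr) :
    P.str.lmom (P.right.act x k) = P.str.lmom x := by
  by_cases h : P.str.rmom x = H.rng k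
  · rw [right_act_eq h, P.str.lmom_ract]
  · rw [P.right.act_junk _ _ h]

theorem left_right_act (x : P.carrier) (g : G.Arr) (k : H.Arr) :
    P.left.act (P.right.act x k) g = P.right.act (P.left.act x g) k := by
  by_cases h : P.str.lmom x = G.rng g
  · by_cases h' : P.str.rmom x = H.rng k
    · rw [left_act_eq (by simpa using h), right_act_eq (x := P.left.act x g) (by simpa using h'),
        P.str.lact_congr (x' := P.str.ract ⟨(x, k), h'⟩) rfl (right_act_eq h') _
          (by rw [P.str.lmom_ract, G.src_inv, h]),
        P.str.ract_congr (x' := P.str.lact ⟨(G.inv g, x), (G.src_inv g).trans h.symm⟩) rfl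
          (left_act_eq h) _ (by rw [P.str.rmom_lact]; exact h')]
      exact (P.str.lact_ract _ _ _ _ _ _ _).symm
    · rw [P.right.act_junk _ _ h', P.right.act_junk _ _ (by
        simpa using h')]
  · rw [P.left.act_junk x _ h, P.left.act_junk _ _ (by simpa using h)]

theorem right_isProper : P.right.IsProper := by
  intro A B hA hB
  refine ⟨(fun p : P.str.rmom.Pullback H.rng => p.1.2) ''
    ((fun p : P.str.rmom.Pullback H.rng => (P.str.ract p, p.1.1)) ⁻¹' (B ×ˢ A)),
    (P.str.proper.isCompact_preimage (hB.prod hA)).image (by fun_prop), fun z hz γ hγ h => ?_⟩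
  rw [right_act_eq hγ] at h
  exact ⟨⟨(z, γ), hγ⟩, ⟨h, hz⟩, rfl⟩

theorem measurable_right_act_const (k : H.Arr) : Measurable fun x => P.right.act x k :=
  P.right.measurable_act.comp measurable_prodMk_right

theorem ae_rmom (a : H.Obj) : ∀ᵐ x ∂P.str.meas a, P.str.rmom x = a :=
  P.str.meas_family.ae_eq a

theorem map_right_act_meas (k : H.Arr) :
    (P.str.meas (H.rng k)).map (fun x => P.right.act x k) = P.str.meas (H.src k) := by
  refine map_eq_of_integral_eq (measurable_right_act_const k) (fun K hK => ?_) fun f => ?_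
  · refine ⟨_, P.right.isCompact_image_act (hK.prod (isCompact_singleton (x := H.inv k))), ?_⟩
    filter_upwards [P.ae_rmom (H.rng k)] with x hx hxK
    exact ⟨(P.right.act x k, H.inv k), ⟨⟨hxK, rfl⟩,
      (P.right.mom_act hx).trans (H.rng_inv k).symm⟩, RAct.act_act_inv hx⟩
  · rw [← P.str.meas_invariant k f]
    refine integral_congr_ae ?_
    filter_upwards [P.ae_rmom (H.rng k)] with x hx
    rw [dif_pos hx, right_act_eq hx]

theorem lintegral_right_act (k : H.Arr) {f : P.carrier → ℝ≥0∞} (hf : Measurable f) :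
    ∫⁻ x, f (P.right.act x k) ∂P.str.meas (H.rng k) = ∫⁻ x, f x ∂P.str.meas (H.src k) := by
  rw [← map_right_act_meas, lintegral_map hf (measurable_right_act_const k)]

variable (P) in
/-- The density `(x, g) ↦ Δ(g, g⁻¹ x)`. -/
noncomputable def dens (x : P.carrier) (g : G.Arr) : ℝ :=
  if h : P.str.lmom x = G.rng g then P.str.adj ⟨(g, P.left.act x g), (lmom_left_act h).symm⟩ else 1

theorem dens_pos (x : P.carrier) (g : G.Arr) : 0 < P.dens x g := by
  unfold dens
  split_ifs
  · exact P.str.adj_pos _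
  · exact one_pos

theorem adj_eq_dens (g : G.Arr) (x : P.carrier) (h : G.src g = P.str.lmom x) :
    P.str.adj ⟨(g, x), h⟩ = P.dens (P.left.act x (G.inv g)) g := by
  have h' : P.str.lmom x = G.rng (G.inv g) := by rw [G.rng_inv, h]
  have e : P.str.lmom (P.left.act x (G.inv g)) = G.rng g := by
    rw [lmom_left_act h', G.src_inv]
  have e' : x = P.left.act (P.left.act x (G.inv g)) g := by
    conv_rhs => rw [← G.inv_inv (g := g), G.inv_inv (g := G.inv g), RAct.act_act_inv h']
  rw [dens, dif_pos e]
  congr 1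
  exact Subtype.ext (Prod.ext rfl e')

theorem continuousOn_dens : ContinuousOn (fun q : P.carrier × G.Arr => P.dens q.1 q.2)
    {q | P.left.mom q.1 = G.rng q.2} := by
  refine continuousOn_of_forall_eq
    (f' := fun q : {q : P.carrier × G.Arr | P.left.mom q.1 = G.rng q.2} =>
      P.str.adj ⟨(q.1.2, P.left.act q.1.1 q.1.2), (lmom_left_act q.2).symm⟩)
    (P.str.continuous_adj.comp (Continuous.subtype_mk ?_ _)) fun _ hq => dif_pos hq
  exact (continuous_snd.comp continuous_subtype_val).prodMk
    (continuousOn_iff_continuous_domRestrict.1 P.left.continuousOn_act)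

theorem measurable_dens : Measurable fun q : P.carrier × G.Arr => P.dens q.1 q.2 :=
  HaarGroupoid.measurable_of_continuousOn P.left.isClosed_domain continuousOn_dens
    measurable_const fun _ hq => dif_neg hq

/-- The adjoining function as a density for inversion of the left action groupoid. -/
theorem left_qinv (a : H.Obj) : P.left.QInv (P.str.meas a) P.dens := by
  let N := P.left.groupoidMeasure (P.str.meas a)
  have hae : ∀ᵐ q ∂N, P.left.mom q.1 = G.rng q.2 := RAct.ae_groupoidMeasure _
  let N' := N.withDensity fun q => ENNReal.ofReal (P.dens q.1 q.2)
  have : IsFiniteMeasureOnCompacts N' :=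
    isFiniteMeasureOnCompacts_withDensity P.left.isClosed_domain hae continuousOn_dens
  have hd := P.measurable_dens.ennreal_ofReal
  have hac : ∀ᵐ q ∂N', P.left.mom q.1 = G.rng q.2 := withDensity_absolutelyContinuous _ _ hae
  -- Quasi-invariance is equivalent to this equality of measures, which may be tested on compactly
  -- supported continuous functions. There it is the defining equation of the adjoining function,
  -- transported along the closed embedding `(γ, x) ↦ (x, γ⁻¹)`.
  have key : N'.map P.left.flip = N := by
    refine map_eq_of_integral_eq RAct.measurable_flip (fun K hK => ?_) fun f => ?_
    · obtain ⟨L, hL, h⟩ := P.left.exists_isCompact_flip hK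
      exact ⟨L, hL, hac.mono fun q hq => h q hq⟩
    · have hfi : Integrable f N :=
        (map_continuous f).integrable_of_hasCompactSupport f.hasCompactSupport
      have hc : ContinuousOn (fun q : P.carrier × G.Arr => f (P.left.flip q) * P.dens q.1 q.2)
          {q | P.left.mom q.1 = G.rng q.2} :=
        ((map_continuous f).comp_continuousOn P.left.continuousOn_flip).mul continuousOn_dens
      obtain ⟨L, hL, h⟩ := P.left.exists_isCompact_flip f.hasCompactSupport
      have hi : Integrable (fun q : P.carrier × G.Arr => f (P.left.flip q) * P.dens q.1 q.2) N := by
        refine integrable_of_continuousOn_of_isCompact P.left.isClosed_domain hae hc hL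
          fun q hq hqL => ?_
        rw [image_eq_zero_of_notMem_tsupport fun hn => hqL (h q hq hn), zero_mul]
      have e : ∫ q, f (P.left.flip q) ∂N' = ∫ q, f (P.left.flip q) * P.dens q.1 q.2 ∂N := by
        rw [integral_withDensity_eq_integral_toReal_smul hd (by simp)]
        refine integral_congr_ae (.of_forall fun q => ?_)
        simp [ENNReal.toReal_ofReal (dens_pos q.1 q.2).le, mul_comm]
      rw [e]
      refine (IsMeasureFamily.integral_prodMeasure _ _ _ _ hi).trans
        (Eq.trans ?_ (IsMeasureFamily.integral_prodMeasure _ _ _ _ hfi).symm)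
      let ι : G.src.Pullback P.str.lmom → P.carrier × G.Arr := fun p => (p.1.2, G.inv p.1.1)
      have hι : IsClosedEmbedding ι := by
        refine IsClosedEmbedding.comp (g := fun q : G.Arr × P.carrier => (q.2, G.inv q.1))
          (((Homeomorph.prodComm _ _).trans
            ((Homeomorph.refl _).prodCongr G.invHomeo)).isClosedEmbedding)
          (IsClosed.isClosedEmbedding_subtypeVal ?_)
        exact isClosed_eq (G.continuous_src.comp continuous_fst)
          (P.str.continuous_lmom.comp continuous_snd)
      let F : C_c(G.src.Pullback P.str.lmom, ℝ) :=
        ⟨⟨fun p => f (ι p), (map_continuous f).comp hι.continuous⟩,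
          f.hasCompactSupport.comp_isClosedEmbedding hι⟩
      refine Eq.trans ?_ ((P.str.adj_eq a F).symm.trans ?_)
      · refine integral_congr_ae (.of_forall fun x => integral_congr_ae ?_)
        filter_upwards [G.ae_rng (P.str.lmom x)] with γ hγ
        have h₁ : P.str.lmom x = G.rng γ := hγ.symm
        rw [dif_pos hγ, dens, dif_pos h₁]
        have e₁ : P.left.flip (x, γ) = (P.str.lact ⟨(G.inv γ, x), (G.src_inv γ).trans hγ⟩,
            G.inv γ) := Prod.ext (left_act_eq h₁) rfl
        have e₂ : ∀ h h', P.str.adj ⟨(γ, P.left.act x γ), h⟩ =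
            P.str.adj ⟨(γ, P.str.lact ⟨(G.inv γ, x), (G.src_inv γ).trans hγ⟩), h'⟩ := by
          rw [left_act_eq h₁]
          exact fun _ _ => rfl
        rw [e₁, e₂]
        rfl
      · refine integral_congr_ae (.of_forall fun x => integral_congr_ae ?_)
        filter_upwards [G.ae_rng (P.str.lmom x)] with γ hγ
        rw [dif_pos hγ]
        show f (x, G.inv (G.inv γ)) = _
        rw [G.inv_inv]
  intro F hF
  have hF' : Measurable fun q : P.carrier × G.Arr => F (P.left.flip q) := hF.comp RAct.measurable_flip
  rw [← RAct.lintegral_groupoidMeasure _ hF]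
  change ∫⁻ q, F q ∂N = _
  rw [← key, lintegral_map hF RAct.measurable_flip, lintegral_withDensity_mul hd hF']
  simp_rw [mul_comm (ENNReal.ofReal _)]
  exact RAct.lintegral_groupoidMeasure _ (hF'.mul hd)

end Corr

/-! ### Fibre products of families of measures -/

namespace IsMeasureFamily

open scoped ENNReal

variable {X B Z : Type*} [TopologicalSpace X] [T2Space X] [LocallyCompactSpace X]
  [TopologicalSpace B] [T2Space B] [MeasurableSpace X] [BorelSpace X] [SecondCountableTopology X]
  [TopologicalSpace Z] [MeasurableSpace Z] [BorelSpace Z]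
  {p : X → B} {m : B → Measure X} {l : Z → B}
  (hm : IsMeasureFamily p m) (hp : Continuous p) (hl : Continuous l) (M : Measure Z)

theorem isClosed_pullback (hp : Continuous p) (hl : Continuous l) :
    IsClosed {q : X × Z | p q.1 = l q.2} :=
  isClosed_eq (hp.comp continuous_fst) (hl.comp continuous_snd)

theorem locallyCompactSpace_pullback [LocallyCompactSpace Z] (hp : Continuous p)
    (hl : Continuous l) : LocallyCompactSpace (p.Pullback l) :=
  (isClosed_pullback hp hl).isClosedEmbedding_subtypeVal.locallyCompactSpace

/-- The measure `∫ m (l z) dM(z)` on the fibre product. -/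
noncomputable def pullbackMeasure : Measure (p.Pullback l) :=
  ((hm.prodMeasure hp hl M).map Prod.swap).comap Subtype.val

theorem measurable_extend_pullback (hp : Continuous p) (hl : Continuous l) {Y : Type*}
    [MeasurableSpace Y] [Zero Y] {f : p.Pullback l → Y} (hf : Measurable f) :
    Measurable fun q : X × Z => if h : p q.1 = l q.2 then f ⟨q, h⟩ else 0 := by
  refine measurable_of_restrict_of_restrict_compl (isClosed_pullback hp hl).measurableSet ?_ ?_
  · have e : {q : X × Z | p q.1 = l q.2}.domRestrict
        (fun q : X × Z => if h : p q.1 = l q.2 then f ⟨q, h⟩ else 0) = f :=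
      funext fun q => dif_pos q.2
    rw [e]
    exact hf
  · have e : ({q : X × Z | p q.1 = l q.2}ᶜ).domRestrict
        (fun q : X × Z => if h : p q.1 = l q.2 then f ⟨q, h⟩ else 0) = fun _ => 0 :=
      funext fun q => dif_neg q.2
    rw [e]
    exact measurable_const

theorem map_val_pullbackMeasure [SFinite M] :
    (hm.pullbackMeasure hp hl M).map Subtype.val = (hm.prodMeasure hp hl M).map Prod.swap := by
  have hC := (isClosed_pullback hp hl).measurableSet
  refine (map_comap_subtype_coe hC _).trans (Measure.restrict_eq_self_of_ae_mem ?_)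
  refine (ae_map_iff measurable_swap.aemeasurable hC).2 ?_
  filter_upwards [hm.ae_prodMeasure hp hl M] with q hq using hq.symm

theorem lintegral_pullbackMeasure [SFinite M] {f : X × Z → ℝ≥0∞} (hf : Measurable f) :
    ∫⁻ q, f q.1 ∂hm.pullbackMeasure hp hl M = ∫⁻ z, ∫⁻ x, f (x, z) ∂m (l z) ∂M := by
  rw [← lintegral_map hf measurable_subtype_coe, hm.map_val_pullbackMeasure hp hl M,
    lintegral_map hf measurable_swap,
    hm.lintegral_prodMeasure hp hl M (f := fun q => f q.swap) (hf.comp measurable_swap)]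
  rfl

theorem lintegral_pullbackMeasure_dite [SFinite M] {f : p.Pullback l → ℝ≥0∞} (hf : Measurable f) :
    ∫⁻ q, f q ∂hm.pullbackMeasure hp hl M =
      ∫⁻ z, ∫⁻ x, (if h : p x = l z then f ⟨(x, z), h⟩ else 0) ∂m (l z) ∂M := by
  rw [← hm.lintegral_pullbackMeasure hp hl M (measurable_extend_pullback hp hl hf)]
  exact lintegral_congr fun q => by rw [dif_pos q.2]

theorem integral_pullbackMeasure [SFinite M] {f : p.Pullback l → ℝ} (hf : Measurable f)
    (hi : Integrable f (hm.pullbackMeasure hp hl M)) :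
    ∫ q, f q ∂hm.pullbackMeasure hp hl M =
      ∫ z, ∫ x, (if h : p x = l z then f ⟨(x, z), h⟩ else 0) ∂m (l z) ∂M := by
  have hC := (isClosed_pullback hp hl).measurableSet
  have hm' := measurable_extend_pullback hp hl hf
  have e : ∀ q : p.Pullback l, f q = if h : p q.1.1 = l q.1.2 then f ⟨q.1, h⟩ else 0 :=
    fun q => by rw [dif_pos q.2]
  have hi' : Integrable (fun q : X × Z => if h : p q.1 = l q.2 then f ⟨q, h⟩ else 0)
      ((hm.prodMeasure hp hl M).map Prod.swap) := by
    rw [← hm.map_val_pullbackMeasure hp hl M, integrable_map_measure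
      hm'.aestronglyMeasurable measurable_subtype_coe.aemeasurable]
    exact hi.congr (.of_forall e)
  rw [integral_congr_ae (.of_forall e), ← integral_map (φ := Subtype.val)
    (f := fun q : X × Z => if h : p q.1 = l q.2 then f ⟨q, h⟩ else 0)
    measurable_subtype_coe.aemeasurable hm'.aestronglyMeasurable, hm.map_val_pullbackMeasure hp hl M,
    integral_map measurable_swap.aemeasurable hm'.aestronglyMeasurable]
  exact hm.integral_prodMeasure hp hl M (f := fun q => if h : p q.2 = l q.1 then f ⟨q.swap, h⟩ else 0)
    ((integrable_map_measure hm'.aestronglyMeasurable measurable_swap.aemeasurable).1 hi')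

theorem isFiniteMeasureOnCompacts_pullbackMeasure [T2Space Z] [SFinite M]
    [IsFiniteMeasureOnCompacts M] : IsFiniteMeasureOnCompacts (hm.pullbackMeasure hp hl M) := by
  have := hm.isFiniteMeasureOnCompacts_prodMeasure hp hl M
  refine ⟨fun K hK => ?_⟩
  have hK' := hK.image continuous_subtype_val
  have : hm.pullbackMeasure hp hl M K ≤ (hm.pullbackMeasure hp hl M).map Subtype.val
      (Subtype.val '' K) := by
    rw [Measure.map_apply measurable_subtype_coe hK'.measurableSet]
    exact measure_mono (Set.subset_preimage_image _ _)
  refine this.trans_lt ?_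
  rw [hm.map_val_pullbackMeasure hp hl M, Measure.map_apply measurable_swap hK'.measurableSet,
    ← Set.image_swap_eq_preimage_swap]
  exact (hK'.image continuous_swap).measure_lt_top

theorem mem_support_pullbackMeasure [SFinite M] (q : p.Pullback l) (hq : q.1.2 ∈ M.support) :
    q ∈ (hm.pullbackMeasure hp hl M).support := by
  rw [Measure.mem_support_iff_forall]
  intro U hU
  obtain ⟨V, hV, hVU⟩ := mem_nhds_subtype _ q U |>.1 hU
  obtain ⟨W, hWV, hW, hqW⟩ := mem_nhds_iff.1 hV
  refine lt_of_lt_of_le ?_ (measure_mono ((Set.preimage_mono hWV).trans hVU))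
  have e : hm.pullbackMeasure hp hl M (Subtype.val ⁻¹' W) = hm.prodMeasure hp hl M (Prod.swap ⁻¹' W) :=
    (Measure.map_apply measurable_subtype_coe hW.measurableSet).symm.trans (by
      rw [hm.map_val_pullbackMeasure hp hl M, Measure.map_apply measurable_swap hW.measurableSet])
  refine lt_of_lt_of_eq ?_ e.symm
  exact (Measure.mem_support_iff_forall _).1
    (hm.mem_support_prodMeasure hp hl M hq (x := q.1.1) q.2.symm) _
    (continuous_swap.continuousAt.preimage_mem_nhds (hW.mem_nhds hqW))

/-- Continuity in the base point of iterated integrals of functions with compact support on the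
fibre product. -/
theorem continuous_integral_pullbackMeasure {A : Type*} [TopologicalSpace A] {r : Z → A}
    {n : A → Measure Z} [T2Space Z] [LocallyCompactSpace Z] [SecondCountableTopology Z]
    (hn : IsMeasureFamily r n) (f : C_c(p.Pullback l, ℝ)) :
    Continuous fun a => ∫ q, f q ∂hm.pullbackMeasure hp hl (n a) := by
  let g : Z × X → ℝ := fun q => if h : p q.2 = l q.1 then f ⟨q.swap, h⟩ else 0
  have hg : ContinuousOn g {q | l q.1 = p q.2} := by
    refine continuousOn_of_forall_eq
      (f' := fun q : {q : Z × X | l q.1 = p q.2} => f ⟨q.1.swap, q.2.symm⟩)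
      ((map_continuous f).comp (Continuous.subtype_mk (continuous_swap.comp
        continuous_subtype_val) _)) fun _ hq => dif_pos (Eq.symm hq)
  let K := tsupport f
  have hK : IsCompact K := f.hasCompactSupport
  have hK1 : IsCompact ((fun q : p.Pullback l => q.1.1) '' K) := hK.image (by fun_prop)
  have hK2 : IsCompact ((fun q : p.Pullback l => q.1.2) '' K) := hK.image (by fun_prop)
  have h1 : ∀ z x, x ∉ (fun q : p.Pullback l => q.1.1) '' K → g (z, x) = 0 := fun z x hx => by
    by_cases h : p x = l z
    · exact (dif_pos h).trans (image_eq_zero_of_notMem_tsupport fun hn => hx ⟨_, hn, rfl⟩)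
    · exact dif_neg h
  have h2 : ∀ z x, z ∉ (fun q : p.Pullback l => q.1.2) '' K → g (z, x) = 0 := fun z x hx => by
    by_cases h : p x = l z
    · exact (dif_pos h).trans (image_eq_zero_of_notMem_tsupport fun hn => hx ⟨_, hn, rfl⟩)
    · exact dif_neg h
  obtain ⟨-, hc⟩ := hm.continuous_integral_of_hasProperSupport hp hl hg
    fun z₀ => ⟨Set.univ, Filter.univ_mem, _, hK1, fun z _ x _ hx => h1 z x hx⟩
  let φ : C_c(Z, ℝ) := ⟨⟨_, hc⟩, HasCompactSupport.intro hK2 fun z hz => by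
    simp [h2 z _ hz]⟩
  refine (hn.continuous_integral φ).congr fun a => ?_
  have := hn.finiteOnCompacts a
  have := hm.isFiniteMeasureOnCompacts_pullbackMeasure hp hl (n a)
  rw [hm.integral_pullbackMeasure hp hl (n a) (map_continuous f).measurable
    ((map_continuous f).integrable_of_hasCompactSupport f.hasCompactSupport)]
  rfl

end IsMeasureFamily

/-! ### The adjoining function as an invariant cocycle -/

namespace Corr

variable {G H : HaarGroupoid.{u}} {P : Corr G H}

theorem mem_support (x : P.carrier) : x ∈ (P.str.meas (P.str.rmom x)).support := by
  rw [P.str.meas_family.support_eq]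
  rfl

/-- The support condition in the general cocycle identity is harmless here: `x` lies in the support
of the measure at its own right momentum. -/
theorem dens_cocycle {x : P.carrier} {γ η : G.Arr} (hγ : P.str.lmom x = G.rng γ)
    (hη : P.str.lmom x = G.rng η) :
    P.dens x γ * P.dens (P.left.act x γ) (G.tmul (G.inv γ) η) = P.dens x η :=
  (left_qinv (P.str.rmom x)).cocycle measurable_dens continuousOn_dens (fun _ _ _ => dens_pos _ _)
    (mem_support x) hγ hη

theorem dens_tmul {x : P.carrier} {γ η : G.Arr} (hγ : P.str.lmom x = G.rng γ)
    (hη : G.src γ = G.rng η) :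
    P.dens x (G.tmul γ η) = P.dens x γ * P.dens (P.left.act x γ) η := by
  rw [← dens_cocycle hγ (η := G.tmul γ η) (by simpa using hγ), G.inv_tmul_cancel_left hη]

theorem dens_one (x : P.carrier) : P.dens x (G.one (P.str.lmom x)) = 1 := by
  have h := dens_tmul (x := x) (γ := G.one (P.str.lmom x)) (η := G.one (P.str.lmom x))
    (by simp) (by simp)
  rw [show P.left.act x (G.one (P.str.lmom x)) = x from P.left.act_one x,
    G.tmul_one' (by simp)] at h
  exact (mul_eq_left₀ (dens_pos _ _).ne').1 h.symm

theorem dens_left_act_inv {x : P.carrier} {γ : G.Arr} (hγ : P.str.lmom x = G.rng γ) :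
    P.dens (P.left.act x γ) (G.inv γ) = (P.dens x γ)⁻¹ := by
  have h := dens_tmul hγ (η := G.inv γ) (by simp)
  rw [G.tmul_inv, ← hγ, dens_one] at h
  exact eq_inv_of_mul_eq_one_right h.symm

/-- Translation by `k` commutes with the left action and carries the measure at `rng k` to the one
at `src k`. The density and its translate therefore both describe inversion for the measure at `rng
k`, and continuous densities are unique on the support. This gives the `K`-invariance of the cochain
of a composite and lets its left density descend. -/
theorem dens_right_act (x : P.carrier) (k : H.Arr) (g : G.Arr) (hg : P.str.lmom x = G.rng g) :
    P.dens (P.right.act x k) g = P.dens x g := by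
  by_cases hk : P.str.rmom x = H.rng k
  swap
  · rw [P.right.act_junk _ _ hk]
  let T : P.carrier → P.carrier := fun x => P.right.act x k
  let T' : P.carrier → P.carrier := fun x => P.right.act x (H.inv k)
  have hT : Measurable T := measurable_right_act_const k
  have hT' : Measurable T' := measurable_right_act_const _
  have hTT : ∀ x, P.str.rmom x = H.rng k → T' (T x) = x := fun x hx => RAct.act_act_inv hx
  have hxM : x ∈ (P.str.meas (H.rng k)).support := hk ▸ mem_support x
  let C : Set (P.carrier × G.Arr) :=
    {q | P.left.mom q.1 = G.rng q.2} ∩ {q | P.str.rmom q.1 = H.rng k}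
  have hC : IsClosed C := P.left.isClosed_domain.inter
    (isClosed_eq (P.str.continuous_rmom.comp continuous_fst) continuous_const)
  let M := P.str.meas (H.rng k)
  have hM : ∀ᵐ x ∂M, P.str.rmom x = H.rng k := ae_rmom _
  have m₁ : Measurable fun q : P.carrier × G.Arr => P.dens (T q.1) q.2 :=
    measurable_dens.comp ((hT.comp measurable_fst).prodMk measurable_snd)
  have hNC : ∀ᵐ q ∂P.left.groupoidMeasure M, q ∈ C := by
    have h0 : ∫⁻ q, (Cᶜ).indicator 1 q ∂P.left.groupoidMeasure M = 0 := by
      rw [RAct.lintegral_groupoidMeasure M (measurable_one.indicator hC.measurableSet.compl)]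
      refine lintegral_eq_zero_of_ae_eq_zero ?_
      filter_upwards [hM] with x hx
      refine lintegral_eq_zero_of_ae_eq_zero ?_
      filter_upwards [G.ae_rng (P.left.mom x)] with γ hγ
      exact Set.indicator_of_notMem (fun hn : (x, γ) ∈ Cᶜ => hn ⟨hγ.symm, hx⟩) _
    rw [lintegral_indicator_one hC.measurableSet.compl] at h0
    exact h0
  have cT : ContinuousOn (fun q : P.carrier × G.Arr => T q.1) C :=
    P.right.continuousOn_act.comp (f := fun q : P.carrier × G.Arr => (q.1, k)) (by fun_prop)
      fun q hq => hq.2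
  have c₁ : ContinuousOn (fun q : P.carrier × G.Arr => P.dens (T q.1) q.2) C :=
    continuousOn_dens.comp (cT.prodMk continuousOn_snd) fun q hq =>
      (lmom_right_act q.1 k).trans hq.1
  refine eq_on_support_of_lintegral_eq (N := P.left.groupoidMeasure M) hC hNC
    (g₁ := fun q => P.dens (T q.1) q.2) (g₂ := fun q => P.dens q.1 q.2) m₁ measurable_dens c₁
    (continuousOn_dens.mono Set.inter_subset_left) (fun _ _ => (dens_pos _ _).le)
    (fun _ _ => (dens_pos _ _).le) (fun E hE => ?_) (x, g)
    (IsMeasureFamily.mem_support_prodMeasure _ _ _ _ hxM hg)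
  refine (RAct.lintegral_groupoidMeasure M (hE.mul m₁.ennreal_ofReal)).trans (Eq.trans ?_
    (RAct.lintegral_groupoidMeasure M (hE.mul measurable_dens.ennreal_ofReal)).symm)
  -- The test function is chosen so that translating by `k` and then inverting the groupoid element
  -- returns `E`.
  let F : P.carrier × G.Arr → ENNReal := fun q => E (P.left.act (T' q.1) q.2, G.inv q.2)
  have hF : Measurable F := hE.comp ((P.left.measurable_act.comp
    ((hT'.comp measurable_fst).prodMk measurable_snd)).prodMk
      (G.continuous_inv.measurable.comp measurable_snd))
  have hFT : Measurable fun q : P.carrier × G.Arr => F (T q.1, q.2) :=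
    hF.comp ((hT.comp measurable_fst).prodMk measurable_snd)
  have e₁ := left_qinv (P := P) (H.rng k) _ hFT
  have e₂ := left_qinv (P := P) (H.src k) F hF
  have i₁ : Measurable fun x => ∫⁻ γ, F (x, γ) ∂G.haar (P.left.mom x) :=
    P.left.measurable_lintegral_haar hF
  have i₂ : Measurable fun x => ∫⁻ γ, F (P.left.act x γ, G.inv γ) * ENNReal.ofReal (P.dens x γ)
      ∂G.haar (P.left.mom x) :=
    P.left.measurable_lintegral_haar (f := fun q => F (P.left.act q.1 q.2, G.inv q.2) *
      ENNReal.ofReal (P.dens q.1 q.2))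
      ((hF.comp RAct.measurable_flip).mul measurable_dens.ennreal_ofReal)
  rw [← lintegral_right_act k i₁, ← lintegral_right_act k i₂] at e₂
  simp only [left_mom, lmom_right_act] at e₁ e₂ ⊢
  refine Eq.trans (lintegral_congr_ae ?_) (e₂.symm.trans (e₁.trans (lintegral_congr_ae ?_)))
  · filter_upwards [hM] with x hx
    refine lintegral_congr_ae ?_
    filter_upwards [G.ae_rng (P.left.mom x)] with γ hγ
    simp only [F, Pi.mul_apply]
    rw [left_right_act x γ k, show T' (P.right.act (P.left.act x γ) k) = P.left.act x γ from
      hTT _ (by simpa using hx), RAct.act_act_inv hγ.symm, G.inv_inv]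
  · filter_upwards [hM] with x hx
    refine lintegral_congr_ae ?_
    filter_upwards [G.ae_rng (P.left.mom x)] with γ hγ
    simp only [F, Pi.mul_apply]
    rw [hTT _ (by simpa using hx), RAct.act_act_inv hγ.symm, G.inv_inv]

end Corr

/-! ### Constructing correspondences from actions -/

/-- Openness makes neighbourhood filters push forward. It also passes to products, so with `π × id`
this gives continuity of the actions and densities induced on orbit spaces. -/
theorem IsOpenQuotientMap.continuousOn_of_comp {X Y W : Type*} [TopologicalSpace X]
    [TopologicalSpace Y] [TopologicalSpace W] {π : X → Y} (hπ : IsOpenQuotientMap π) {f : Y → W}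
    {D : Set Y} (h : ContinuousOn (fun x => f (π x)) (π ⁻¹' D)) : ContinuousOn f D := by
  intro y hy
  obtain ⟨x, rfl⟩ := hπ.surjective y
  have := h x hy
  rw [ContinuousWithinAt, nhdsWithin] at this ⊢
  rw [← hπ.map_nhds_eq, ← Filter.map_inf_principal_preimage, Filter.tendsto_map'_iff]
  exact this

namespace RAct

variable {H : HaarGroupoid.{u}} {Z : Type*} [TopologicalSpace Z] {S : RAct H Z}

theorem IsProper.isProperMap [T2Space Z] [LocallyCompactSpace Z] (hS : S.IsProper) :
    IsProperMap fun p : S.mom.Pullback H.rng => (S.act p.1.1 p.1.2, p.1.1) := by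
  have hc : Continuous fun p : S.mom.Pullback H.rng => S.act p.1.1 p.1.2 :=
    continuousOn_iff_continuous_domRestrict.1 S.continuousOn_act
  refine isProperMap_iff_isCompact_preimage.2
    ⟨hc.prodMk (continuous_fst.comp continuous_subtype_val), fun K hK => ?_⟩
  obtain ⟨Γ, hΓ, h⟩ := hS _ _ (hK.image continuous_snd) (hK.image continuous_fst)
  have hemb : IsClosedEmbedding (Subtype.val : S.mom.Pullback H.rng → Z × H.Arr) :=
    S.isClosed_domain.isClosedEmbedding_subtypeVal
  refine (hemb.isCompact_preimage ((hK.image continuous_snd).prod hΓ)).of_isClosed_subset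
    (hK.isClosed.preimage (hc.prodMk (continuous_fst.comp continuous_subtype_val))) ?_
  intro p hp
  exact ⟨⟨_, hp, rfl⟩, h _ ⟨_, hp, rfl⟩ _ p.2 ⟨_, hp, rfl⟩⟩

end RAct

/-- A correspondence from a commuting pair of actions, with the left action of `G` turned into a
right action. -/
noncomputable def CorrOn.ofRAct {G H : HaarGroupoid.{u}} {X : Type u} [TopologicalSpace X]
    [MeasurableSpace X] [BorelSpace X] [T2Space X] [LocallyCompactSpace X]
    [SecondCountableTopology X] (L : RAct G X) (R : RAct H X)
    (hR : ∀ x g, R.mom (L.act x g) = R.mom x) (hL : ∀ x k, L.mom (R.act x k) = L.mom x)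
    (hLR : ∀ x g k, L.act (R.act x k) g = R.act (L.act x g) k) (hproper : R.IsProper)
    (meas : H.Obj → Measure X) (hmeas : IsMeasureFamily R.mom meas)
    (hinv : ∀ k, (meas (H.rng k)).map (fun x => R.act x k) = meas (H.src k))
    (adj : G.src.Pullback L.mom → ℝ) (hadj : Continuous adj) (hpos : ∀ p, 0 < adj p)
    (δ : X → G.Arr → ℝ)
    (hδ : ∀ x g (h : L.mom x = G.rng g), δ x g = adj ⟨(g, L.act x g), (L.mom_act h).symm⟩)
    (hδ' : ∀ x g, L.mom x ≠ G.rng g → δ x g = 1)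
    (hq : ∀ a, L.QInv (meas a) δ) : CorrOn G H X where
  borel := inferInstance
  t2 := inferInstance
  locallyCompact := inferInstance
  secondCountable := inferInstance
  lmom := L.mom
  rmom := R.mom
  lact p := L.act p.1.2 (G.inv p.1.1)
  ract p := R.act p.1.1 p.1.2
  continuous_lmom := L.continuous_mom
  continuous_rmom := R.continuous_mom
  continuous_lact := by
    refine L.continuousOn_act.comp_continuous (f := fun p : G.src.Pullback L.mom =>
      (p.1.2, G.inv p.1.1)) ((continuous_snd.comp continuous_subtype_val).prodMk
      (G.continuous_inv.comp (continuous_fst.comp continuous_subtype_val))) fun p => ?_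
    exact p.2.symm.trans (G.rng_inv _).symm
  continuous_ract := R.continuousOn_act.comp_continuous continuous_subtype_val fun p => p.2
  lmom_lact p := by rw [L.mom_act (by rw [G.rng_inv]; exact p.2.symm), G.src_inv]
  rmom_lact p := hR _ _
  rmom_ract p := R.mom_act p.2
  lmom_ract p := hL _ _
  lact_one x h := by
    show L.act x (G.inv (G.one (L.mom x))) = x
    rw [G.inv_one, L.act_one]
  ract_one x h := R.act_one x
  lact_mul g k x h₁ h₂ h₃ h₄ := by
    show L.act x (G.inv (G.mul ⟨(g, k), h₁⟩)) = L.act (L.act x (G.inv k)) (G.inv g)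
    rw [← G.tmul_eq h₁, G.inv_tmul_rev h₁, L.act_tmul (by simpa using h₂.symm)
      (by simpa using h₁.symm)]
  ract_mul x g k h₁ h₂ h₃ h₄ := by
    show R.act x (H.mul ⟨(g, k), h₂⟩) = R.act (R.act x g) k
    rw [← H.tmul_eq h₂, R.act_tmul h₁ h₂]
  lact_ract g x k h₁ h₂ h₃ h₄ := (hLR x (G.inv g) k).symm
  proper := hproper.isProperMap
  meas := meas
  meas_family := hmeas
  meas_invariant k f := by
    have hm : Measurable fun x => R.act x k := R.measurable_act.comp measurable_prodMk_right
    rw [← hinv k, integral_map hm.aemeasurable (map_continuous f).aestronglyMeasurable]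
    refine integral_congr_ae ?_
    filter_upwards [hmeas.ae_eq (H.rng k)] with x hx
    exact dif_pos hx
  adj := adj
  continuous_adj := hadj
  adj_pos := hpos
  adj_eq a F := by
    have := hmeas.finiteOnCompacts a
    have hcl := L.isClosed_domain
    have hae := RAct.ae_groupoidMeasure (S := L) (meas a)
    have hmem : ∀ q : X × G.Arr, L.mom q.1 = G.rng q.2 → G.src (G.inv q.2) = L.mom q.1 :=
      fun q h => (G.src_inv _).trans h.symm
    have hδc : ContinuousOn (fun q : X × G.Arr => δ q.1 q.2) {q | L.mom q.1 = G.rng q.2} := by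
      refine continuousOn_of_forall_eq (f' := fun q : {q : X × G.Arr | L.mom q.1 = G.rng q.2} =>
        adj ⟨(q.1.2, L.act q.1.1 q.1.2), (L.mom_act q.2).symm⟩)
        (hadj.comp (Continuous.subtype_mk ?_ _)) fun q hq => hδ _ _ hq
      exact (continuous_snd.comp continuous_subtype_val).prodMk
        (continuousOn_iff_continuous_domRestrict.1 L.continuousOn_act)
    have hδm : Measurable fun q : X × G.Arr => δ q.1 q.2 :=
      HaarGroupoid.measurable_of_continuousOn hcl hδc measurable_const fun q hq => hδ' _ _ hq
    have hδ0 : ∀ q : X × G.Arr, 0 ≤ δ q.1 q.2 := fun q => by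
      by_cases h : L.mom q.1 = G.rng q.2
      · rw [hδ _ _ h]
        exact (hpos _).le
      · rw [hδ' _ _ h]
        exact zero_le_one
    let f : X × G.Arr → ℝ := fun q => if h : L.mom q.1 = G.rng q.2 then
      F ⟨(G.inv q.2, q.1), hmem q h⟩ else 0
    have hf : ContinuousOn f {q | L.mom q.1 = G.rng q.2} := by
      refine continuousOn_of_forall_eq (f' := fun q : {q : X × G.Arr | L.mom q.1 = G.rng q.2} =>
        F ⟨(G.inv q.1.2, q.1.1), hmem q.1 q.2⟩)
        ((map_continuous F).comp (Continuous.subtype_mk ?_ _)) fun q hq => dif_pos hq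
      exact (G.continuous_inv.comp (continuous_snd.comp continuous_subtype_val)).prodMk
        (continuous_fst.comp continuous_subtype_val)
    have hfm : Measurable f := HaarGroupoid.measurable_of_continuousOn hcl hf measurable_const
      fun q hq => dif_neg hq
    let ι : G.src.Pullback L.mom → X × G.Arr := fun p => (p.1.2, G.inv p.1.1)
    have hι : Continuous ι := (continuous_snd.comp continuous_subtype_val).prodMk
        (G.continuous_inv.comp (continuous_fst.comp continuous_subtype_val))
    have hK : IsCompact (ι '' tsupport F) := IsCompact.image F.hasCompactSupport hι
    have hf0 : ∀ q : X × G.Arr, L.mom q.1 = G.rng q.2 → q ∉ ι '' tsupport F → f q = 0 :=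
      fun q h hq => (dif_pos h).trans (image_eq_zero_of_notMem_tsupport fun hn =>
        hq ⟨_, hn, Prod.ext rfl G.inv_inv⟩)
    have hfi : Integrable f (L.groupoidMeasure (meas a)) :=
      integrable_of_continuousOn_of_isCompact hcl hae hf hK hf0
    obtain ⟨K', hK', hKK'⟩ := L.exists_isCompact_flip hK
    have hgi : Integrable (fun q : X × G.Arr => f (L.flip q) * δ q.1 q.2)
        (L.groupoidMeasure (meas a)) := by
      refine integrable_of_continuousOn_of_isCompact hcl hae
        ((hf.comp L.continuousOn_flip fun q hq => RAct.flip_mem hq).mul hδc) hK' fun q h hq => ?_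
      exact mul_eq_zero_of_left (hf0 _ (RAct.flip_mem h) fun hn => hq (hKK' q h hn)) _
    -- Written as an equality of measures, quasi-invariance extends from nonnegative functions to
    -- Bochner integrals; Fubini on both sides then produces the iterated integrals.
    have key : ((L.groupoidMeasure (meas a)).withDensity fun q =>
        ENNReal.ofReal (δ q.1 q.2)).map L.flip = L.groupoidMeasure (meas a) := by
      ext s hs
      have hs1 : Measurable (s.indicator (1 : X × G.Arr → ENNReal)) := measurable_one.indicator hs
      rw [← lintegral_indicator_one hs, ← lintegral_indicator_one hs,
        lintegral_map hs1 RAct.measurable_flip,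
        lintegral_withDensity_mul (f := fun q => s.indicator 1 (L.flip q)) hδm.ennreal_ofReal
          (hs1.comp RAct.measurable_flip), RAct.lintegral_groupoidMeasure _ hs1, hq a _ hs1]
      simp_rw [mul_comm (ENNReal.ofReal _)]
      exact RAct.lintegral_groupoidMeasure (F := fun q => s.indicator 1 (L.flip q) *
        ENNReal.ofReal (δ q.1 q.2)) _ ((hs1.comp RAct.measurable_flip).mul hδm.ennreal_ofReal)
    have e : ∫ q, f q ∂L.groupoidMeasure (meas a) =
        ∫ q, f (L.flip q) * δ q.1 q.2 ∂L.groupoidMeasure (meas a) := by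
      conv_lhs => rw [← key]
      rw [integral_map RAct.measurable_flip.aemeasurable hfm.aestronglyMeasurable,
        integral_withDensity_eq_integral_toReal_smul hδm.ennreal_ofReal (by simp)]
      refine integral_congr_ae (.of_forall fun q => ?_)
      simp [ENNReal.toReal_ofReal (hδ0 q), mul_comm]
    have e₁ : ∫ q, f q ∂L.groupoidMeasure (meas a) =
        ∫ x, ∫ γ, f (x, γ) ∂G.haar (L.mom x) ∂meas a :=
      IsMeasureFamily.integral_prodMeasure _ _ _ _ hfi
    have e₂ : ∫ q, f (L.flip q) * δ q.1 q.2 ∂L.groupoidMeasure (meas a) =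
        ∫ x, ∫ γ, f (L.flip (x, γ)) * δ x γ ∂G.haar (L.mom x) ∂meas a :=
      IsMeasureFamily.integral_prodMeasure _ _ _ _ hgi
    refine Eq.trans (integral_congr_ae (.of_forall fun x => integral_congr_ae ?_))
      (e₁.symm.trans (e.trans (e₂.trans
        (integral_congr_ae (.of_forall fun x => integral_congr_ae ?_)))))
    · filter_upwards [G.ae_rng (L.mom x)] with γ hγ
      have e₄ : f (x, γ) = F ⟨(G.inv γ, x), (G.src_inv γ).trans hγ⟩ := dif_pos hγ.symm
      rw [dif_pos hγ, e₄]
    · filter_upwards [G.ae_rng (L.mom x)] with γ hγ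
      have hm := RAct.flip_mem (S := L) (q := (x, γ)) hγ.symm
      have e₃ : f (L.flip (x, γ)) = F ⟨(γ, L.act x γ), (L.mom_act hγ.symm).symm⟩ := by
        refine (dif_pos hm).trans (congrArg F (Subtype.ext (Prod.ext G.inv_inv rfl)))
      rw [e₃, hδ _ _ hγ.symm, dif_pos hγ]
      simp_rw [G.inv_inv]

/-! ### Descent along the quotient by a proper action -/

namespace IsMeasureFamily

variable {X B : Type*} [TopologicalSpace X] [T2Space X] [LocallyCompactSpace X]
  [SecondCountableTopology X] [TopologicalSpace B] [T2Space B] [MeasurableSpace X] [BorelSpace X]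
  {p : X → B} {m : B → Measure X}

theorem of_mem_support (hp : Continuous p) (hfin : ∀ b, IsFiniteMeasureOnCompacts (m b))
    (hae : ∀ b, ∀ᵐ x ∂m b, p x = b) (hsupp : ∀ x, x ∈ (m (p x)).support)
    (hc : ∀ f : C_c(X, ℝ), Continuous fun b => ∫ x, f x ∂m b) : IsMeasureFamily p m where
  finiteOnCompacts := hfin
  support_eq b := by
    refine Set.Subset.antisymm ?_ ?_
    · exact Measure.support_subset_of_isClosed (isClosed_singleton.preimage hp) (hae b)
    · rintro x rfl
      exact hsupp x
  continuous_integral := hc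

theorem mem_support (hm : IsMeasureFamily p m) (x : X) : x ∈ (m (p x)).support := by
  rw [hm.support_eq]
  rfl

theorem mem_support_withDensity {M : Measure X} {D : X → ℝ} (hD : Continuous D) {x : X}
    (hx : x ∈ M.support) (hpos : 0 < D x) :
    x ∈ (M.withDensity fun x => ENNReal.ofReal (D x)).support := by
  rw [Measure.mem_support_iff_forall] at hx ⊢
  intro U hU
  obtain ⟨V, hVU, hV, hxV⟩ := mem_nhds_iff.1
    (Filter.inter_mem hU (hD.continuousAt.preimage_mem_nhds (isOpen_Ioi.mem_nhds hpos)))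
  refine lt_of_lt_of_le ?_ (measure_mono (hVU.trans Set.inter_subset_left))
  rw [pos_iff_ne_zero, withDensity_apply _ hV.measurableSet, Ne,
    setLIntegral_eq_zero_iff hV.measurableSet hD.measurable.ennreal_ofReal]
  intro h0
  refine (hx V (hV.mem_nhds hxV)).ne' (measure_mono_null (fun x' hx' => ?_) (ae_iff.1 h0))
  have : 0 < D x' := (hVU hx').2
  simpa [hx'] using this

theorem integral_withDensity_ofReal {M : Measure X} {D : X → ℝ} (hD : Continuous D)
    (h0 : ∀ x, 0 ≤ D x) (f : X → ℝ) :
    ∫ x, f x ∂(M.withDensity fun x => ENNReal.ofReal (D x)) = ∫ x, D x * f x ∂M := by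
  rw [integral_withDensity_eq_integral_toReal_smul hD.measurable.ennreal_ofReal (by simp)]
  exact integral_congr_ae (.of_forall fun x => by simp [ENNReal.toReal_ofReal (h0 x)])

theorem withDensity (hm : IsMeasureFamily p m) (hp : Continuous p) {D : X → ℝ}
    (hD : Continuous D) (hpos : ∀ x, 0 < D x) :
    IsMeasureFamily p fun b => (m b).withDensity fun x => ENNReal.ofReal (D x) := by
  refine of_mem_support hp (fun b => ?_) (fun b => ?_) (fun x => ?_) fun f => ?_
  · have := hm.finiteOnCompacts b
    exact isFiniteMeasureOnCompacts_withDensity isClosed_univ (.of_forall fun _ => trivial)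
      hD.continuousOn
  · exact withDensity_absolutelyContinuous _ _ (hm.ae_eq b)
  · exact mem_support_withDensity hD (hm.mem_support x) (hpos x)
  · simp_rw [integral_withDensity_ofReal hD fun x => (hpos x).le]
    exact hm.continuous_integral ⟨⟨fun x => D x * f x, by fun_prop⟩, f.hasCompactSupport.mul_left⟩

theorem pullback {Z A : Type*} [TopologicalSpace Z] [T2Space Z] [LocallyCompactSpace Z]
    [SecondCountableTopology Z] [MeasurableSpace Z] [BorelSpace Z] [TopologicalSpace A] [T2Space A]
    {l : Z → B} {r : Z → A} {n : A → Measure Z} (hm : IsMeasureFamily p m) (hp : Continuous p)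
    (hl : Continuous l) (hn : IsMeasureFamily r n) (hr : Continuous r) :
    IsMeasureFamily (fun q : p.Pullback l => r q.1.2) fun a => hm.pullbackMeasure hp hl (n a) := by
  have := locallyCompactSpace_pullback (Z := Z) hp hl
  have : SecondCountableTopology (p.Pullback l) :=
    TopologicalSpace.Subtype.secondCountableTopology {q : X × Z | p q.1 = l q.2}
  have hf := fun a => hn.finiteOnCompacts a
  refine of_mem_support (by fun_prop)
    (fun a => hm.isFiniteMeasureOnCompacts_pullbackMeasure hp hl (n a)) (fun a => ?_)
    (fun q => hm.mem_support_pullbackMeasure hp hl _ q (hn.mem_support q.1.2))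
    (hm.continuous_integral_pullbackMeasure hp hl hn)
  have hs : MeasurableSet {q : X × Z | r q.2 = a}ᶜ :=
    (isClosed_singleton.preimage (hr.comp continuous_snd) :
      IsClosed ((fun q : X × Z => r q.2) ⁻¹' {a})).measurableSet.compl
  have hs' : MeasurableSet {q : p.Pullback l | r q.1.2 = a}ᶜ := measurable_subtype_coe hs
  have h0 := hm.lintegral_pullbackMeasure hp hl (n a)
    (f := {q : X × Z | r q.2 = a}ᶜ.indicator 1) (measurable_one.indicator hs)
  have h1 : ∫⁻ z, ∫⁻ x, {q : X × Z | r q.2 = a}ᶜ.indicator 1 (x, z) ∂m (l z) ∂n a = 0 := by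
    refine lintegral_eq_zero_of_ae_eq_zero ?_
    filter_upwards [hn.ae_eq a] with z hz
    refine lintegral_eq_zero_of_ae_eq_zero (.of_forall fun x => ?_)
    exact Set.indicator_of_notMem (fun hn : ¬ r z = a => hn hz) _
  rw [h1] at h0
  rw [ae_iff]
  exact (lintegral_indicator_one hs').symm.trans h0

end IsMeasureFamily

namespace RAct

open scoped ENNReal

variable {H K : HaarGroupoid.{u}} {Z Ω : Type*} [TopologicalSpace Z] [TopologicalSpace Ω]
  {S : RAct H Z} {T : RAct K Z} {π : Z → Ω}

/-- The actions `S` and `T` commute. -/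
structure Commute (S : RAct H Z) (T : RAct K Z) : Prop where
  mom_act_left : ∀ z γ, T.mom (S.act z γ) = T.mom z
  mom_act_right : ∀ z k, S.mom (T.act z k) = S.mom z
  act_act : ∀ z γ k, T.act (S.act z γ) k = S.act (T.act z k) γ

namespace Commute

theorem map_act_congr (c : S.Commute T) (hπ : S.IsQuot π) {z z' : Z} (h : π z = π z') (k : K.Arr) :
    π (T.act z k) = π (T.act z' k) := by
  obtain ⟨γ, hγ, rfl⟩ := hπ.eq_iff.1 h
  rw [c.act_act, hπ.map_act ((c.mom_act_right z k).trans hγ)]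

theorem mom_congr (c : S.Commute T) (hπ : S.IsQuot π) {z z' : Z} (h : π z = π z') :
    T.mom z = T.mom z' := by
  obtain ⟨γ, hγ, rfl⟩ := hπ.eq_iff.1 h
  rw [c.mom_act_left]

/-- The action induced on the orbit space. -/
noncomputable def quot (c : S.Commute T) (hπ : S.IsQuot π) : RAct K Ω :=
  have hs := Function.surjInv_eq hπ.isOpenQuotientMap.surjective
  have hm : ∀ z, T.mom (Function.surjInv hπ.isOpenQuotientMap.surjective (π z)) = T.mom z :=
    fun z => c.mom_congr hπ (hs _)
  have ha : ∀ z k, π (T.act (Function.surjInv hπ.isOpenQuotientMap.surjective (π z)) k) =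
    π (T.act z k) := fun z => c.map_act_congr hπ (hs _)
  { mom ω := T.mom (Function.surjInv hπ.isOpenQuotientMap.surjective ω)
    act ω k := π (T.act (Function.surjInv hπ.isOpenQuotientMap.surjective ω) k)
    continuous_mom := hπ.isOpenQuotientMap.continuous_comp_iff.1
      (T.continuous_mom.congr fun z => (hm z).symm)
    continuousOn_act := by
      refine (hπ.isOpenQuotientMap.prodMap IsOpenQuotientMap.id).continuousOn_of_comp ?_
      refine (hπ.isOpenQuotientMap.continuous.comp_continuousOn
        (T.continuousOn_act.mono fun q hq => (hm q.1).symm.trans hq)).congr fun q _ => ?_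
      exact ha q.1 q.2
    act_junk ω k h := by rw [T.act_junk _ _ h, hs]
    mom_act h := by rw [hm, T.mom_act h]
    act_one ω := by rw [T.act_one, hs]
    act_tmul h h' := by rw [T.act_tmul h h', ha] }

variable (c : S.Commute T) (hπ : S.IsQuot π)

@[simp]
theorem quot_mom (z : Z) : (c.quot hπ).mom (π z) = T.mom z :=
  c.mom_congr hπ (Function.surjInv_eq hπ.isOpenQuotientMap.surjective _)

@[simp]
theorem quot_act (z : Z) (k : K.Arr) : (c.quot hπ).act (π z) k = π (T.act z k) :=
  c.map_act_congr hπ (Function.surjInv_eq hπ.isOpenQuotientMap.surjective _) k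

end Commute

theorem IsProper.hasProperSupport (hS : S.IsProper) {f : Z → ℝ} (hf : HasCompactSupport f) :
    S.HasProperSupport f := fun A hA => by
  obtain ⟨Γ, hΓ, h⟩ := hS A _ hA hf
  refine ⟨Γ, hΓ, fun z hz γ hγ hn => ?_⟩
  by_contra h0
  exact hn (h z hz γ hγ (subset_tsupport _ h0))

/-- A point over `A` has the form `z' γ` with `z'` in a compact set that covers `A`, and `e ≠ 0`
confines `γ` to a compact set. Hence `e · (f ∘ π)` vanishes off a compact set whenever `f` has
compact support, which makes quotient measures finite on compact sets and continuous in the base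
point. -/
theorem HasProperSupport.exists_isCompact [T2Space Ω] [LocallyCompactSpace Z] {e : Z → ℝ}
    (he : S.HasProperSupport e) (hπ : S.IsQuot π)
    {A : Set Ω} (hA : IsCompact A) : ∃ L, IsCompact L ∧ ∀ z, π z ∈ A → e z ≠ 0 → z ∈ L := by
  obtain ⟨B, hB, hAB⟩ := hπ.exists_isCompact_image hA
  obtain ⟨Γ, hΓ, h⟩ := he B hB
  refine ⟨_, S.isCompact_image_act (hB.prod hΓ), fun z hz hez => ?_⟩
  obtain ⟨z', hz', e'⟩ := hAB hz
  obtain ⟨γ, hγ, rfl⟩ := hπ.eq_iff.1 e'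
  exact ⟨(z', γ), ⟨⟨hz', by_contra fun hn => hez (h z' hz' γ hγ hn)⟩, hγ⟩, rfl⟩

/-! ### Quotients of families of measures and of quasi-invariance -/

section Measure

variable [T2Space Z] [LocallyCompactSpace Z] [SecondCountableTopology Z] [MeasurableSpace Z]
  [BorelSpace Z] [MeasurableSpace Ω] [BorelSpace Ω]
  {μ : Measure Ω} {M : Measure Z}

theorem IsCutoff.exists_pos {e : Z → ℝ} (he : S.IsCutoff fun z => ENNReal.ofReal (e z)) (z : Z) :
    ∃ γ, S.mom z = H.rng γ ∧ 0 < e (S.act z γ) := by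
  by_contra! hn
  have : S.avg (fun z => ENNReal.ofReal (e z)) z = 0 := by
    refine lintegral_eq_zero_of_ae_eq_zero ?_
    filter_upwards [H.ae_rng (S.mom z)] with γ hγ
    exact ENNReal.ofReal_of_nonpos (hn γ hγ.symm)
  rw [he.avg_eq_one] at this
  exact one_ne_zero this

/-- The quotient of a measure family. -/
theorem IsCutoff.isMeasureFamily_map [T2Space Ω] [LocallyCompactSpace Ω]
    [SecondCountableTopology Ω] {A : Type*} [TopologicalSpace A] [T2Space A] {e : Z → ℝ}
    (he : S.IsCutoff fun z => ENNReal.ofReal (e z)) (hec : Continuous e) (he0 : ∀ z, 0 ≤ e z)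
    (hes : S.HasProperSupport e) (hπ : S.IsQuot π) {r : Ω → A} (hr : Continuous r)
    {m : A → Measure Z} (hm : IsMeasureFamily (fun z => r (π z)) m) :
    IsMeasureFamily r fun a => ((m a).withDensity fun z => ENNReal.ofReal (e z)).map π := by
  have hπc := hπ.isOpenQuotientMap.continuous
  have hemeas := hec.measurable.ennreal_ofReal
  refine IsMeasureFamily.of_mem_support hr (fun a => ⟨fun B hB => ?_⟩) (fun a => ?_) (fun ω => ?_)
    fun f => ?_
  · obtain ⟨L, hL, h⟩ := hes.exists_isCompact hπ hB
    have := hm.finiteOnCompacts a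
    have := isFiniteMeasureOnCompacts_withDensity (N := m a) isClosed_univ
      (.of_forall fun _ => trivial) hec.continuousOn
    rw [Measure.map_apply hπc.measurable hB.measurableSet]
    refine lt_of_le_of_lt (measure_mono_ae ?_) hL.measure_lt_top
    have h0 : ∀ᵐ z ∂((m a).withDensity fun z => ENNReal.ofReal (e z)), ENNReal.ofReal (e z) ≠ 0 :=
      ae_withDensity_iff hemeas |>.2 (.of_forall fun _ h => h)
    filter_upwards [h0] with z hz hzB
    exact h z hzB fun h0 => hz (by rw [h0, ENNReal.ofReal_zero])
  · refine (ae_map_iff hπc.measurable.aemeasurable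
      (isClosed_singleton.preimage hr).measurableSet).2 ?_
    exact withDensity_absolutelyContinuous _ _ (hm.ae_eq a)
  · obtain ⟨z, rfl⟩ := hπ.isOpenQuotientMap.surjective ω
    rw [Measure.mem_support_iff_forall]
    intro U hU
    obtain ⟨V, hVU, hV, hzV⟩ := mem_nhds_iff.1 hU
    obtain ⟨γ, hγ, hpos⟩ := he.exists_pos z
    refine lt_of_lt_of_le ?_ (measure_mono hVU)
    rw [Measure.map_apply hπc.measurable hV.measurableSet]
    refine (Measure.mem_support_iff_forall _).1 (IsMeasureFamily.mem_support_withDensity hec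
      (x := S.act z γ) ?_ hpos) _ ((hV.preimage hπc).mem_nhds ?_)
    · have := hm.mem_support (S.act z γ)
      rwa [hπ.map_act hγ] at this
    · rw [Set.mem_preimage, hπ.map_act hγ]
      exact hzV
  · have key : ∀ a, ∫ ω, f ω ∂(((m a).withDensity fun z => ENNReal.ofReal (e z)).map π) =
        ∫ z, e z * f (π z) ∂m a := fun a => by
      rw [integral_map hπc.measurable.aemeasurable (map_continuous f).aestronglyMeasurable,
        IsMeasureFamily.integral_withDensity_ofReal hec he0]
    simp_rw [key]
    obtain ⟨L, hL, h⟩ := hes.exists_isCompact hπ f.hasCompactSupport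
    refine hm.continuous_integral ⟨⟨fun z => e z * f (π z), by fun_prop⟩,
      HasCompactSupport.intro hL fun z hz => ?_⟩
    by_contra hne
    exact hz (h z (subset_tsupport _ (right_ne_zero_of_mul hne)) (left_ne_zero_of_mul hne))

/-- Lifts are compatible with commuting actions. -/
theorem IsLift.map_quot (h : S.IsLift π μ M) (c : S.Commute T) (hπ : S.IsQuot π)
    [MeasurableSpace.CountablySeparated Ω] (k : K.Arr)
    (hk : Measurable fun ω => (c.quot hπ).act ω k) :
    S.IsLift π (μ.map fun ω => (c.quot hπ).act ω k) (M.map fun z => T.act z k) := by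
  intro f hf F hF
  have hTk : Measurable fun z => T.act z k := T.measurable_act.comp measurable_prodMk_right
  have hFm : Measurable F := by
    refine measurable_of_comp_surjective hπ.isOpenQuotientMap.continuous.measurable
      hπ.isOpenQuotientMap.surjective ?_
    simp_rw [hF]
    exact S.measurable_avg hf
  rw [lintegral_map hFm hk, lintegral_map hf hTk]
  refine h _ (hf.comp hTk) _ fun z => ?_
  rw [c.quot_act, hF]
  unfold avg
  rw [c.mom_act_right]
  exact lintegral_congr fun γ => congrArg f (c.act_act z γ k).symm

/-- The quotient of a quasi-invariant measure is quasi-invariant. -/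
theorem IsLift.qinv_quot [T2Space Ω] [LocallyCompactSpace Ω] [SecondCountableTopology Ω]
    (h : S.IsLift π μ M) (c : S.Commute T) (hπ : S.IsQuot π)
    {e : Z → ℝ≥0∞} (he : S.IsCutoff e) {δ : Z → K.Arr → ℝ}
    {δ' : Ω → K.Arr → ℝ} (hδ : ∀ z k, δ' (π z) k = δ z k)
    (hδm : Measurable fun q : Ω × K.Arr => δ' q.1 q.2) (hq : T.QInv M δ) :
    (c.quot hπ).QInv μ δ' := by
  intro F hF
  have hπm := hπ.isOpenQuotientMap.continuous.measurable
  have hπ1 : Measurable fun q : Z × K.Arr => (π q.1, q.2) :=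
    (hπm.comp measurable_fst).prodMk measurable_snd
  let Φ : Ω × K.Arr → ℝ≥0∞ := fun q =>
    F ((c.quot hπ).act q.1 q.2, K.inv q.2) * ENNReal.ofReal (δ' q.1 q.2)
  have hΦ : Measurable Φ := (hF.comp ((c.quot hπ).measurable_act.prodMk
    (K.continuous_inv.measurable.comp measurable_snd))).mul hδm.ennreal_ofReal
  have hm : Measurable fun q : Z × K.Arr => e q.1 * F (π q.1, q.2) :=
    (he.measurable.comp measurable_fst).mul (hF.comp hπ1)
  have hm' : Measurable fun q : Z × K.Arr => e (T.act q.1 q.2) * Φ (π q.1, q.2) :=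
    (he.measurable.comp T.measurable_act).mul (hΦ.comp hπ1)
  have e₁ : ∫⁻ ω, ∫⁻ k, F (ω, k) ∂K.haar ((c.quot hπ).mom ω) ∂μ =
      ∫⁻ z, ∫⁻ k, e z * F (π z, k) ∂K.haar (T.mom z) ∂M := by
    conv_lhs => rw [h.eq_map hπ he]
    rw [lintegral_map (f := fun ω => ∫⁻ k, F (ω, k) ∂K.haar ((c.quot hπ).mom ω))
      ((c.quot hπ).measurable_lintegral_haar hF) hπm,
      lintegral_withDensity_mul (f := fun z => ∫⁻ k, F (π z, k) ∂K.haar ((c.quot hπ).mom (π z)))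
      he.measurable (((c.quot hπ).measurable_lintegral_haar hF).comp hπm)]
    refine lintegral_congr fun z => ?_
    rw [c.quot_mom, lintegral_const_mul _ (f := fun k => F (π z, k))
      (hF.comp measurable_prodMk_left)]
  -- After the change of variables upstairs the cutoff is evaluated at `z k`. Its average over the
  -- `H`-orbit of `z k` is still `1`, so the lift property removes it again; commutation of the
  -- actions allows the averages to be interchanged.
  rw [e₁, hq _ hm]
  have e₂ : ∫⁻ z, ∫⁻ k, e (T.act z k) * F (π (T.act z k), K.inv k) * ENNReal.ofReal (δ z k)
      ∂K.haar (T.mom z) ∂M = ∫⁻ z, ∫⁻ k, e (T.act z k) * Φ (π z, k) ∂K.haar (T.mom z) ∂M := by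
    refine lintegral_congr fun z => lintegral_congr fun k => ?_
    simp only [Φ]
    rw [c.quot_act, hδ, mul_assoc]
  rw [e₂]
  refine (h _ (T.measurable_lintegral_haar hm')
    (fun ω => ∫⁻ k, Φ (ω, k) ∂K.haar ((c.quot hπ).mom ω)) fun z => ?_).symm
  have hf1 := H.haar_family.finiteOnCompacts (S.mom z)
  have hf2 := K.haar_family.finiteOnCompacts (T.mom z)
  calc ∫⁻ k, Φ (π z, k) ∂K.haar ((c.quot hπ).mom (π z))
      = ∫⁻ k, ∫⁻ γ, e (S.act (T.act z k) γ) * Φ (π z, k) ∂H.haar (S.mom z) ∂K.haar (T.mom z) := by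
        rw [c.quot_mom]
        refine lintegral_congr fun k => ?_
        rw [lintegral_mul_const _ (f := fun γ => e (S.act (T.act z k) γ))
          (he.measurable.comp (S.measurable_act_left _)), ← c.mom_act_right z k]
        refine (one_mul _).symm.trans (congrArg (· * _) (he.avg_eq_one (T.act z k)).symm)
    _ = ∫⁻ γ, ∫⁻ k, e (S.act (T.act z k) γ) * Φ (π z, k) ∂K.haar (T.mom z) ∂H.haar (S.mom z) := by
        refine lintegral_lintegral_swap (f := fun k γ => e (S.act (T.act z k) γ) * Φ (π z, k)) ?_
        refine Measurable.aemeasurable ?_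
        exact (he.measurable.comp (S.measurable_act.comp
          (((T.measurable_act_left z).comp measurable_fst).prodMk measurable_snd))).mul
          (hΦ.comp (measurable_const.prodMk measurable_fst))
    _ = _ := by
        refine lintegral_congr_ae ?_
        filter_upwards [H.ae_rng (S.mom z)] with γ hγ
        rw [c.mom_act_left, hπ.map_act hγ.symm]
        simp_rw [c.act_act]

/-- The defining property of a lift, for Bochner integrals. -/
theorem IsLift.integral_eq (h : S.IsLift π μ M) (hS : S.IsProper) (hπ : S.IsQuot π)
    [MeasurableSpace.CountablySeparated Ω]
    [IsFiniteMeasureOnCompacts M] (f : C_c(Z, ℝ)) {F : Ω → ℝ}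
    (hF : ∀ z, F (π z) = ∫ γ, f (S.act z γ) ∂H.haar (S.mom z)) :
    ∫ ω, F ω ∂μ = ∫ z, f z ∂M := by
  have hfm := (map_continuous f).measurable
  have hi : Integrable f M := (map_continuous f).integrable_of_hasCompactSupport f.hasCompactSupport
  have hio := (continuous_integral_haar (S.continuousOn_comp_act (map_continuous f))
    (hS.hasProperSupport f.hasCompactSupport)).1
  -- The lift property concerns nonnegative functions, so positive and negative parts are treated
  -- separately. Integrability of `f` on `Z` and along each orbit keeps all terms finite.
  have key : ∀ g : Z → ℝ, Measurable g → Integrable g M →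
      (∀ z, Integrable (fun γ => g (S.act z γ)) (H.haar (S.mom z))) → (∀ z, 0 ≤ g z) →
      ∃ Fg : Ω → ℝ, Integrable Fg μ ∧ ∫ ω, Fg ω ∂μ = ∫ z, g z ∂M ∧
        ∀ z, Fg (π z) = ∫ γ, g (S.act z γ) ∂H.haar (S.mom z) := by
    intro g hg hgi hgo hg0
    have hgm := hg.ennreal_ofReal
    obtain ⟨Fg, hFg⟩ := hπ.exists_descend _ fun z γ hγ => S.avg_act hγ hgm
    have hFm : Measurable Fg := by
      refine measurable_of_comp_surjective hπ.isOpenQuotientMap.continuous.measurable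
        hπ.isOpenQuotientMap.surjective ?_
      simp_rw [hFg]
      exact S.measurable_avg hgm
    have hl := h _ hgm Fg hFg
    have hl' : ∫⁻ ω, Fg ω ∂μ ≠ ⊤ := by
      rw [hl, ← ofReal_integral_eq_lintegral_ofReal hgi (.of_forall hg0)]
      exact ENNReal.ofReal_ne_top
    have e : ∀ z, Fg (π z) = ENNReal.ofReal (∫ γ, g (S.act z γ) ∂H.haar (S.mom z)) := fun z => by
      rw [hFg, ofReal_integral_eq_lintegral_ofReal (hgo z) (.of_forall fun _ => hg0 _)]
      rfl
    have hlt : ∀ ω, Fg ω < ⊤ := fun ω => by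
      obtain ⟨z, rfl⟩ := hπ.isOpenQuotientMap.surjective ω
      rw [e]
      exact ENNReal.ofReal_lt_top
    refine ⟨fun ω => (Fg ω).toReal, integrable_toReal_of_lintegral_ne_top hFm.aemeasurable hl', ?_,
      fun z => ?_⟩
    · rw [integral_toReal hFm.aemeasurable (.of_forall hlt), hl,
        integral_eq_lintegral_of_nonneg_ae (.of_forall hg0) hg.aestronglyMeasurable]
    · show (Fg (π z)).toReal = _
      rw [e, ENNReal.toReal_ofReal (integral_nonneg fun _ => hg0 _)]
  obtain ⟨F₁, i₁, h₁, e₁⟩ := key (fun z => max (f z) 0) (hfm.max measurable_const) hi.pos_part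
    (fun z => (hio z).pos_part) fun z => le_max_right _ _
  obtain ⟨F₂, i₂, h₂, e₂⟩ := key (fun z => max (-f z) 0) (hfm.neg.max measurable_const) hi.neg_part
    (fun z => (hio z).neg_part) fun z => le_max_right _ _
  have eF : F = fun ω => F₁ ω - F₂ ω := funext fun ω => by
    obtain ⟨z, rfl⟩ := hπ.isOpenQuotientMap.surjective ω
    rw [hF, e₁, e₂, ← integral_sub (hio z).pos_part (hio z).neg_part]
    simp_rw [max_zero_sub_max_neg_zero_eq_self]
  rw [eF, integral_sub i₁ i₂, h₁, h₂, ← integral_sub hi.pos_part hi.neg_part]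
  simp_rw [max_zero_sub_max_neg_zero_eq_self]

/-- A measure on the orbit space that satisfies the lifting property on compactly supported
continuous functions is the quotient measure. -/
theorem IsCutoff.isLift_of_integral_eq [T2Space Ω] [LocallyCompactSpace Ω]
    [SecondCountableTopology Ω] {e : Z → ℝ}
    (he : S.IsCutoff fun z => ENNReal.ofReal (e z)) (hec : Continuous e) (he0 : ∀ z, 0 ≤ e z)
    (hes : S.HasProperSupport e) (hπ : S.IsQuot π) [IsFiniteMeasureOnCompacts μ]
    [IsFiniteMeasureOnCompacts M] (hM : S.QInv M fun _ _ => 1)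
    (h : ∀ f : C_c(Z, ℝ), ∀ F : Ω → ℝ,
      (∀ z, F (π z) = ∫ γ, f (S.act z γ) ∂H.haar (S.mom z)) → ∫ ω, F ω ∂μ = ∫ z, f z ∂M) :
    S.IsLift π μ M := by
  have hπc := hπ.isOpenQuotientMap.continuous
  have := isFiniteMeasureOnCompacts_withDensity (N := M) isClosed_univ
      (.of_forall fun _ => trivial) hec.continuousOn
  -- Testing on `e · (f ∘ π)`, which has compact support and orbit integral `f`, identifies `μ` with
  -- the quotient of `M`; the quotient has the lift property for all nonnegative Borel functions.
  have hμ : (M.withDensity fun z => ENNReal.ofReal (e z)).map π = μ := by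
    have h0 : ∀ᵐ z ∂(M.withDensity fun z => ENNReal.ofReal (e z)), ENNReal.ofReal (e z) ≠ 0 :=
      ae_withDensity_iff hec.measurable.ennreal_ofReal |>.2 (.of_forall fun _ h => h)
    refine map_eq_of_integral_eq hπc.measurable (fun A hA => ?_) fun f => ?_
    · obtain ⟨L, hL, h⟩ := hes.exists_isCompact hπ hA
      refine ⟨L, hL, ?_⟩
      filter_upwards [h0] with z hz hzB
      exact h z hzB fun h0 => hz (by rw [h0, ENNReal.ofReal_zero])
    · obtain ⟨L, hL, hL'⟩ := hes.exists_isCompact hπ f.hasCompactSupport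
      let f' : C_c(Z, ℝ) := ⟨⟨fun z => e z * f (π z), by fun_prop⟩,
        HasCompactSupport.intro hL fun z hz => by
          by_contra hne
          exact hz (hL' z (subset_tsupport _ (right_ne_zero_of_mul hne)) (left_ne_zero_of_mul hne))⟩
      rw [IsMeasureFamily.integral_withDensity_ofReal hec he0]
      refine (h f' f fun z => ?_).symm
      have e1 : ∫ γ, f' (S.act z γ) ∂H.haar (S.mom z) =
          ∫ γ, e (S.act z γ) * f (π z) ∂H.haar (S.mom z) := by
        refine integral_congr_ae ?_
        filter_upwards [H.ae_rng (S.mom z)] with γ hγ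
        show e (S.act z γ) * f (π (S.act z γ)) = _
        rw [hπ.map_act hγ.symm]
      rw [e1, integral_mul_const]
      have e2 : ∫ γ, e (S.act z γ) ∂H.haar (S.mom z) = 1 := by
        rw [integral_eq_lintegral_of_nonneg_ae (.of_forall fun _ => he0 _)
          (hec.measurable.comp (S.measurable_act_left z)).aestronglyMeasurable]
        exact (congrArg ENNReal.toReal (he.avg_eq_one z)).trans ENNReal.toReal_one
      rw [e2, one_mul]
  rw [← hμ]
  exact hM.isLift hπ he

end Measure

end RAct

/-! ### The fibre product of two correspondences -/

namespace FibProd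

open scoped ENNReal

variable {G H K : HaarGroupoid.{u}} (P : Corr G H) (Q : Corr H K)

instance : LocallyCompactSpace (FibProd P Q) :=
  IsMeasureFamily.locallyCompactSpace_pullback P.str.continuous_rmom Q.str.continuous_lmom

instance : SecondCountableTopology (FibProd P Q) :=
  TopologicalSpace.Subtype.secondCountableTopology
    {q : P.carrier × Q.carrier | P.str.rmom q.1 = Q.str.lmom q.2}

theorem isClosed : IsClosed {q : P.carrier × Q.carrier | P.str.rmom q.1 = Q.str.lmom q.2} :=
  IsMeasureFamily.isClosed_pullback P.str.continuous_rmom Q.str.continuous_lmom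

/-- The diagonal action of `H`. -/
noncomputable def diag : RAct H (FibProd P Q) where
  mom z := P.str.rmom z.1.1
  act z γ := ⟨(P.right.act z.1.1 γ, Q.left.act z.1.2 γ), by
    by_cases h : P.str.rmom z.1.1 = H.rng γ
    · rw [Corr.rmom_right_act h, Corr.lmom_left_act (z.2.symm.trans h)]
    · rw [P.right.act_junk _ _ h, Q.left.act_junk _ _ fun h' => h (z.2.trans h')]
      exact z.2⟩
  continuous_mom := P.str.continuous_rmom.comp (continuous_fst.comp continuous_subtype_val)
  continuousOn_act := by
    refine Topology.IsInducing.subtypeVal.continuousOn_iff.2 ?_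
    refine ContinuousOn.prodMk
      (P.right.continuousOn_act.comp (f := fun q : FibProd P Q × H.Arr => (q.1.1.1, q.2))
        (by fun_prop) fun q hq => hq)
      (Q.left.continuousOn_act.comp (f := fun q : FibProd P Q × H.Arr => (q.1.1.2, q.2))
        (by fun_prop) fun q hq => q.1.2.symm.trans hq)
  act_junk z γ h := Subtype.ext (Prod.ext (P.right.act_junk _ _ h)
    (Q.left.act_junk _ _ fun h' => h (z.2.trans h')))
  mom_act h := Corr.rmom_right_act h
  act_one z := Subtype.ext (Prod.ext (P.right.act_one _) (by
    show Q.left.act z.1.2 (H.one (P.str.rmom z.1.1)) = _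
    rw [z.2]
    exact Q.left.act_one _))
  act_tmul {z γ η} h h' := Subtype.ext (Prod.ext (P.right.act_tmul h h')
    (Q.left.act_tmul (z.2.symm.trans h) h'))

/-- The action of `K` on the second factor. -/
noncomputable def right : RAct K (FibProd P Q) where
  mom z := Q.str.rmom z.1.2
  act z k := ⟨(z.1.1, Q.right.act z.1.2 k), z.2.trans (Corr.lmom_right_act _ _).symm⟩
  continuous_mom := Q.str.continuous_rmom.comp (continuous_snd.comp continuous_subtype_val)
  continuousOn_act := by
    refine Topology.IsInducing.subtypeVal.continuousOn_iff.2 (ContinuousOn.prodMk (by fun_prop) ?_)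
    exact Q.right.continuousOn_act.comp (f := fun q : FibProd P Q × K.Arr => (q.1.1.2, q.2))
        (by fun_prop) fun q hq => hq
  act_junk z γ h := Subtype.ext (Prod.ext rfl (Q.right.act_junk _ _ h))
  mom_act h := Corr.rmom_right_act h
  act_one z := Subtype.ext (Prod.ext rfl (Q.right.act_one _))
  act_tmul h h' := Subtype.ext (Prod.ext rfl (Q.right.act_tmul h h'))

/-- The action of `G` on the first factor, as a right action. -/
noncomputable def left : RAct G (FibProd P Q) where
  mom z := P.str.lmom z.1.1
  act z g := ⟨(P.left.act z.1.1 g, z.1.2), (Corr.rmom_left_act _ _).trans z.2⟩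
  continuous_mom := P.str.continuous_lmom.comp (continuous_fst.comp continuous_subtype_val)
  continuousOn_act := by
    refine Topology.IsInducing.subtypeVal.continuousOn_iff.2
      (ContinuousOn.prodMk ?_ (by fun_prop))
    exact P.left.continuousOn_act.comp (f := fun q : FibProd P Q × G.Arr => (q.1.1.1, q.2))
        (by fun_prop) fun q hq => hq
  act_junk z γ h := Subtype.ext (Prod.ext (P.left.act_junk _ _ h) rfl)
  mom_act h := Corr.lmom_left_act h
  act_one z := Subtype.ext (Prod.ext (P.left.act_one _) rfl)
  act_tmul h h' := Subtype.ext (Prod.ext (P.left.act_tmul h h') rfl)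

variable {P Q}

theorem diag_act_eq {z : FibProd P Q} {γ : H.Arr} (h : P.str.rmom z.1.1 = H.rng γ) :
    (diag P Q).act z γ = diagAct z γ h :=
  Subtype.ext (Prod.ext (Corr.right_act_eq h) (Corr.left_act_eq (z.2.symm.trans h)))

variable (P Q)

theorem commute_right : (diag P Q).Commute (right P Q) where
  mom_act_left _ _ := Corr.rmom_left_act _ _
  mom_act_right _ _ := rfl
  act_act _ _ _ := Subtype.ext (Prod.ext rfl (Corr.left_right_act _ _ _).symm)

theorem commute_left : (diag P Q).Commute (left P Q) where
  mom_act_left _ _ := Corr.lmom_right_act _ _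
  mom_act_right _ _ := Corr.rmom_left_act _ _
  act_act _ _ _ := Subtype.ext (Prod.ext (Corr.left_right_act _ _ _) rfl)

theorem left_right_act (z : FibProd P Q) (g : G.Arr) (k : K.Arr) :
    (left P Q).act ((right P Q).act z k) g = (right P Q).act ((left P Q).act z g) k := rfl

theorem diag_isProper : (diag P Q).IsProper := fun A B hA hB => by
  obtain ⟨Γ, hΓ, h⟩ := P.right_isProper _ _
    (hA.image (f := fun z : FibProd P Q => z.1.1) (by fun_prop))
    (hB.image (f := fun z : FibProd P Q => z.1.1) (by fun_prop))
  exact ⟨Γ, hΓ, fun z hz γ hγ hB => h _ ⟨z, hz, rfl⟩ _ hγ ⟨_, hB, rfl⟩⟩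

/-- A cutoff function of the action on the first factor is one for the diagonal action. -/
theorem exists_cutoff : ∃ e : P.carrier → ℝ, Continuous e ∧ (∀ x, 0 ≤ e x) ∧
    (diag P Q).HasProperSupport (fun z => e z.1.1) ∧
    (diag P Q).IsCutoff fun z => ENNReal.ofReal (e z.1.1) := by
  obtain ⟨e, hc, h0, hs, he⟩ := P.right_isProper.exists_cutoff
  refine ⟨e, hc, h0, fun A hA => ?_, ?_, fun z => he.avg_eq_one z.1.1⟩
  · obtain ⟨Γ, hΓ, h⟩ := hs _ (hA.image (f := fun z : FibProd P Q => z.1.1) (by fun_prop))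
    exact ⟨Γ, hΓ, fun z hz γ hγ hn => h _ ⟨z, hz, rfl⟩ _ hγ hn⟩
  · exact he.measurable.comp (measurable_fst.comp measurable_subtype_coe)

/-- The measure `∫ α (lmom y) dβ_a(y)` on the fibre product. -/
noncomputable def meas (a : K.Obj) : Measure (FibProd P Q) :=
  P.str.meas_family.pullbackMeasure P.str.continuous_rmom Q.str.continuous_lmom (Q.str.meas a)

theorem isMeasureFamily_meas : IsMeasureFamily (fun z : FibProd P Q => Q.str.rmom z.1.2)
    (meas P Q) :=
  P.str.meas_family.pullback P.str.continuous_rmom Q.str.continuous_lmom Q.str.meas_family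
    Q.str.continuous_rmom

instance (a : K.Obj) : IsFiniteMeasureOnCompacts (meas P Q a) :=
  (isMeasureFamily_meas P Q).finiteOnCompacts a

variable {P Q}

/-- Extension by zero of a function on the fibre product. -/
noncomputable def extend (f : FibProd P Q → ℝ≥0∞) (x : P.carrier) (y : Q.carrier) : ℝ≥0∞ :=
  if h : P.str.rmom x = Q.str.lmom y then f ⟨(x, y), h⟩ else 0

theorem extend_eq {f : FibProd P Q → ℝ≥0∞} {x : P.carrier} {y : Q.carrier}
    (h : P.str.rmom x = Q.str.lmom y) : extend f x y = f ⟨(x, y), h⟩ := dif_pos h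

theorem measurable_extend {Y : Type*} [MeasurableSpace Y] {f : FibProd P Q → Y → ℝ≥0∞}
    (hf : Measurable fun q : FibProd P Q × Y => f q.1 q.2) :
    Measurable fun q : (P.carrier × Q.carrier) × Y =>
      extend (fun z => f z q.2) q.1.1 q.1.2 := by
  have hC : MeasurableSet
      {q : (P.carrier × Q.carrier) × Y | P.str.rmom q.1.1 = Q.str.lmom q.1.2} :=
    measurable_fst (isClosed P Q).measurableSet
  refine measurable_of_restrict_of_restrict_compl hC ?_ ?_
  · have e : {q : (P.carrier × Q.carrier) × Y | P.str.rmom q.1.1 = Q.str.lmom q.1.2}.domRestrict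
        (fun q => extend (fun z => f z q.2) q.1.1 q.1.2) = fun q => f ⟨q.1.1, q.2⟩ q.1.2 :=
      funext fun q => dif_pos q.2
    rw [e]
    exact hf.comp (Measurable.prodMk (Measurable.subtype_mk
      (measurable_fst.comp measurable_subtype_coe)) (measurable_snd.comp measurable_subtype_coe))
  · have e : ({q : (P.carrier × Q.carrier) × Y |
        P.str.rmom q.1.1 = Q.str.lmom q.1.2}ᶜ).domRestrict
        (fun q => extend (fun z => f z q.2) q.1.1 q.1.2) = fun _ => 0 :=
      funext fun q => dif_neg q.2
    rw [e]
    exact measurable_const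

theorem measurable_extend' {f : FibProd P Q → ℝ≥0∞} (hf : Measurable f) :
    Measurable fun q : P.carrier × Q.carrier => extend f q.1 q.2 :=
  IsMeasureFamily.measurable_extend_pullback P.str.continuous_rmom Q.str.continuous_lmom hf

theorem lintegral_meas {f : FibProd P Q → ℝ≥0∞} (hf : Measurable f) (a : K.Obj) :
    ∫⁻ z, f z ∂meas P Q a =
      ∫⁻ y, ∫⁻ x, extend f x y ∂P.str.meas (Q.str.lmom y) ∂Q.str.meas a :=
  IsMeasureFamily.lintegral_pullbackMeasure_dite _ _ _ _ hf

/-- A positive continuous `K`-invariant cochain whose coboundary is the adjoining function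
of `Q`. -/
structure IsCochain (b : FibProd P Q → ℝ) : Prop where
  continuous : Continuous b
  pos : ∀ z, 0 < b z
  right_act : ∀ z k, b ((right P Q).act z k) = b z
  diag_act : ∀ z γ, P.str.rmom z.1.1 = H.rng γ →
    b ((diag P Q).act z γ) = b z * (Q.dens z.1.2 γ)⁻¹

theorem measurable_right_act (k : K.Arr) : Measurable fun z => (right P Q).act z k :=
  (right P Q).measurable_act.comp measurable_prodMk_right

theorem map_right_act_meas (k : K.Arr) :
    (meas P Q (K.rng k)).map (fun z => (right P Q).act z k) = meas P Q (K.src k) := by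
  ext s hs
  have hs1 : Measurable (s.indicator (1 : FibProd P Q → ℝ≥0∞)) := measurable_one.indicator hs
  have hm : Measurable fun y => ∫⁻ x, extend (s.indicator 1) x y ∂P.str.meas (Q.str.lmom y) :=
    P.str.meas_family.measurable_lintegral P.str.continuous_rmom Q.str.continuous_lmom
      ((measurable_extend' hs1).comp measurable_swap)
  rw [← lintegral_indicator_one hs, ← lintegral_indicator_one hs,
    lintegral_map hs1 (measurable_right_act k), lintegral_meas hs1,
    lintegral_meas (f := fun z => s.indicator 1 ((right P Q).act z k))
      (hs1.comp (measurable_right_act k)), ← Corr.lintegral_right_act k hm]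
  refine lintegral_congr fun y => ?_
  rw [Corr.lmom_right_act]
  refine lintegral_congr_ae ?_
  filter_upwards [P.ae_rmom (Q.str.lmom y)] with x hx
  rw [extend_eq hx, extend_eq (by rwa [Corr.lmom_right_act])]
  rfl

namespace IsCochain

variable {b : FibProd P Q → ℝ} (hb : IsCochain b)
include hb

theorem measurable : Measurable b := hb.continuous.measurable

theorem isMeasureFamily : IsMeasureFamily (fun z : FibProd P Q => Q.str.rmom z.1.2)
    fun a => (meas P Q a).withDensity fun z => ENNReal.ofReal (b z) :=
  (isMeasureFamily_meas P Q).withDensity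
    (Q.str.continuous_rmom.comp (continuous_snd.comp continuous_subtype_val)) hb.continuous hb.pos

theorem map_right_act (k : K.Arr) :
    ((meas P Q (K.rng k)).withDensity fun z => ENNReal.ofReal (b z)).map
      (fun z => (right P Q).act z k) =
    (meas P Q (K.src k)).withDensity fun z => ENNReal.ofReal (b z) := by
  ext s hs
  have hs1 : Measurable (s.indicator (1 : FibProd P Q → ℝ≥0∞)) := measurable_one.indicator hs
  have hbm := hb.measurable.ennreal_ofReal
  rw [← lintegral_indicator_one hs, ← lintegral_indicator_one hs,
    lintegral_map hs1 (measurable_right_act k), lintegral_withDensity_mul hbm hs1,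
    lintegral_withDensity_mul (f := fun z => s.indicator 1 ((right P Q).act z k)) hbm
    (hs1.comp (measurable_right_act k)), ← map_right_act_meas k,
    lintegral_map (f := fun z => ENNReal.ofReal (b z) * s.indicator 1 z) (hbm.mul hs1)
      (measurable_right_act k)]
  simp_rw [hb.right_act]

/-- The measure `b (α × β)` is invariant under inversion of the groupoid of the diagonal
action. -/
theorem qinv (a : K.Obj) : (diag P Q).QInv
    ((meas P Q a).withDensity fun z => ENNReal.ofReal (b z)) fun _ _ => 1 := by
  intro F hF
  have hbm := hb.measurable.ennreal_ofReal
  have hbF : Measurable fun q : FibProd P Q × H.Arr => ENNReal.ofReal (b q.1) * F q :=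
    (hbm.comp measurable_fst).mul hF
  have hbF' : Measurable fun q : FibProd P Q × H.Arr =>
      ENNReal.ofReal (b q.1) * F ((diag P Q).act q.1 q.2, H.inv q.2) :=
    (hbm.comp measurable_fst).mul (hF.comp RAct.measurable_flip)
  -- The order of integration is changed to `x`, then `γ`, then `y`, so that the quasi-invariance of
  -- the measure of `Q` can be applied to the pair `(y, γ)`.
  have swap : ∀ E : FibProd P Q × H.Arr → ℝ≥0∞, Measurable E →
      (Measurable fun q : FibProd P Q × H.Arr => ENNReal.ofReal (b q.1) * E q) →
      ∫⁻ z, ∫⁻ γ, E (z, γ) ∂H.haar ((diag P Q).mom z)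
          ∂((meas P Q a).withDensity fun z => ENNReal.ofReal (b z)) =
        ∫⁻ y, ∫⁻ γ, ∫⁻ x, extend (fun z => ENNReal.ofReal (b z) * E (z, γ)) x y
          ∂P.str.meas (Q.str.lmom y) ∂H.haar (Q.str.lmom y) ∂Q.str.meas a := by
    intro E hE hbE
    have hE' := (diag P Q).measurable_lintegral_haar hE
    rw [lintegral_withDensity_mul hbm hE', lintegral_meas (f := fun z => ENNReal.ofReal (b z) *
      ∫⁻ γ, E (z, γ) ∂H.haar ((diag P Q).mom z)) (hbm.mul hE')]
    refine lintegral_congr fun y => ?_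
    have := H.haar_family.finiteOnCompacts (Q.str.lmom y)
    have hx := measurable_extend (f := fun z γ => ENNReal.ofReal (b z) * E (z, γ)) hbE
    rw [← lintegral_lintegral_swap (f := fun x γ => extend (fun z => ENNReal.ofReal (b z) * E (z, γ))
      x y) (hx.comp ((measurable_fst.prodMk measurable_const).prodMk measurable_snd)).aemeasurable]
    refine lintegral_congr_ae ?_
    filter_upwards [P.ae_rmom (Q.str.lmom y)] with x hx
    rw [extend_eq hx]
    simp_rw [extend_eq hx]
    rw [lintegral_const_mul _ (f := fun γ => E (_, γ)) (hE.comp measurable_prodMk_left)]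
    show _ * ∫⁻ γ, _ ∂H.haar (P.str.rmom x) = _
    rw [hx]
  simp only [ENNReal.ofReal_one, mul_one]
  rw [swap F hF hbF, swap (fun q => F ((diag P Q).act q.1 q.2, H.inv q.2)) (hF.comp RAct.measurable_flip) hbF']
  have hm : Measurable fun q : Q.carrier × H.Arr =>
      ∫⁻ x, extend (fun z => ENNReal.ofReal (b z) * F (z, q.2)) x q.1
        ∂P.str.meas (Q.str.lmom q.1) := by
    refine P.str.meas_family.measurable_lintegral P.str.continuous_rmom
      (Q.str.continuous_lmom.comp (continuous_fst (X := Q.carrier) (Y := H.Arr)))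
      (f := fun q => extend (fun z => ENNReal.ofReal (b z) * F (z, q.1.2)) q.2 q.1.1) ?_
    exact (measurable_extend (f := fun z γ => ENNReal.ofReal (b z) * F (z, γ)) hbF).comp
      (f := fun q : (Q.carrier × H.Arr) × P.carrier => ((q.2, q.1.1), q.1.2)) (by fun_prop)
  -- Moving `y` to `γ⁻¹ y` costs the factor `Q.dens y γ`, and `x` is moved to `x γ` by invariance of
  -- the measures of `P`. The coboundary of `b` cancels the factor.
  refine (Corr.left_qinv a _ hm).trans ?_
  refine lintegral_congr fun y => lintegral_congr_ae ?_
  filter_upwards [H.ae_rng (Q.str.lmom y)] with γ hγ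
  have hγ' : Q.str.lmom y = H.rng γ := hγ.symm
  have hm1 : Measurable fun x => extend (fun z => ENNReal.ofReal (b z) * F (z, H.inv γ)) x
      (Q.left.act y γ) :=
    (measurable_extend (f := fun z γ => ENNReal.ofReal (b z) * F (z, γ)) hbF).comp
      (f := fun x : P.carrier => ((x, Q.left.act y γ), H.inv γ)) (by fun_prop)
  rw [Corr.lmom_left_act hγ', ← Corr.lintegral_right_act γ hm1, ← hγ']
  have hm2 : Measurable fun x => extend (fun z => ENNReal.ofReal (b z) * F (z, H.inv γ))
      (P.right.act x γ) (Q.left.act y γ) := hm1.comp (Corr.measurable_right_act_const γ)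
  rw [← lintegral_mul_const _ hm2]
  refine lintegral_congr_ae ?_
  filter_upwards [P.ae_rmom (Q.str.lmom y)] with x hx
  have e' : extend (fun z => ENNReal.ofReal (b z) * F (z, H.inv γ)) (P.right.act x γ)
      (Q.left.act y γ) = ENNReal.ofReal (b ((diag P Q).act ⟨(x, y), hx⟩ γ)) *
        F ((diag P Q).act ⟨(x, y), hx⟩ γ, H.inv γ) := extend_eq ((diag P Q).act ⟨(x, y), hx⟩ γ).2
  rw [extend_eq hx, e']
  have e := hb.diag_act ⟨(x, y), hx⟩ γ (hx.trans hγ')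
  have hd := Corr.dens_pos (P := Q) y γ
  calc _ = ENNReal.ofReal (b ((diag P Q).act ⟨(x, y), hx⟩ γ) * Q.dens y γ) *
        F ((diag P Q).act ⟨(x, y), hx⟩ γ, H.inv γ) := by
        rw [ENNReal.ofReal_mul (hb.pos _).le, mul_right_comm]
    _ = _ := by
        rw [e, inv_mul_cancel_right₀ hd.ne']

end IsCochain

theorem continuousOn_dens_snd : ContinuousOn (fun q : FibProd P Q × H.Arr => Q.dens q.1.1.2 q.2)
    {q | (diag P Q).mom q.1 = H.rng q.2} :=
  Corr.continuousOn_dens.comp (f := fun q : FibProd P Q × H.Arr => (q.1.1.2, q.2)) (by fun_prop)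
    fun q hq => q.1.2.symm.trans hq

-- A cocycle over a proper action is a coboundary: `b(x, y) = ∫ w(x γ) Q.dens(y, γ) dγ`, where `w`
-- is nonnegative, positive somewhere on each orbit and of proper support. Replacing `(x, y)` by `(x
-- γ, γ⁻¹ y)` shifts the variable of integration, and the cocycle identity extracts the factor
-- `(Q.dens y γ)⁻¹`. Invariance under `K` is inherited from `Q.dens`.
variable (P Q) in
theorem exists_isCochain : ∃ b : FibProd P Q → ℝ, IsCochain b := by
  obtain ⟨w, hw, h0, hpos, hs⟩ := P.right_isProper.exists_properSupport
  let g : FibProd P Q × H.Arr → ℝ := fun q => w (P.right.act q.1.1.1 q.2) * Q.dens q.1.1.2 q.2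
  have hg : ContinuousOn g {q | (diag P Q).mom q.1 = H.rng q.2} := by
    refine ContinuousOn.mul ?_ continuousOn_dens_snd
    exact (P.right.continuousOn_comp_act hw).comp
      (f := fun q : FibProd P Q × H.Arr => (q.1.1.1, q.2)) (by fun_prop) fun q hq => hq
  obtain ⟨hi, hc⟩ := RAct.continuous_integral_haar hg fun A hA => by
    obtain ⟨Γ, hΓ, h⟩ := hs _ (hA.image (f := fun z : FibProd P Q => z.1.1) (by fun_prop))
    exact ⟨Γ, hΓ, fun z hz γ hγ hn => mul_eq_zero_of_left (h _ ⟨z, hz, rfl⟩ _ hγ hn) _⟩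
  refine ⟨fun z => ∫ γ, g (z, γ) ∂H.haar ((diag P Q).mom z), hc, fun z => ?_, fun z k => ?_,
    fun z γ hγ => ?_⟩
  · obtain ⟨γ, hγ, hwγ⟩ := hpos z.1.1
    refine RAct.integral_haar_pos
      (hg.comp (f := fun γ => (z, γ)) (by fun_prop) fun γ hγ => hγ)
      (fun γ _ => mul_nonneg (h0 _) (Corr.dens_pos _ _).le) (hi z)
      ⟨γ, hγ, mul_pos hwγ (Corr.dens_pos _ _)⟩
  · refine integral_congr_ae ?_
    filter_upwards [H.ae_rng ((diag P Q).mom z)] with γ hγ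
    simp only [g]
    rw [show ((right P Q).act z k).1.2 = Q.right.act z.1.2 k from rfl,
      Corr.dens_right_act _ _ _ (z.2.symm.trans hγ.symm)]
    rfl
  · have hl : Q.str.lmom z.1.2 = H.rng γ := z.2.symm.trans hγ
    rw [show (diag P Q).mom ((diag P Q).act z γ) = H.src γ from (diag P Q).mom_act hγ,
      show (diag P Q).mom z = H.rng γ from hγ, ← H.map_tmul_haar γ, integral_map (φ := H.tmul γ)
        (H.measurable_tmul.comp measurable_prodMk_left).aemeasurable, ← integral_mul_const]
    · refine integral_congr_ae ?_
      filter_upwards [H.ae_rng (H.src γ)] with η hη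
      simp only [g]
      rw [P.right.act_tmul hγ hη.symm, Corr.dens_tmul hl hη.symm]
      show w _ * Q.dens (Q.left.act z.1.2 γ) η = _
      have := (Corr.dens_pos (P := Q) z.1.2 γ).ne'
      field_simp
      exact mul_comm _ _
    · have hgm : Measurable g :=
        ((hw.measurable.comp P.right.measurable_act).comp
          (f := fun q : FibProd P Q × H.Arr => (q.1.1.1, q.2)) (by fun_prop)).mul
          (Corr.measurable_dens.comp
            (f := fun q : FibProd P Q × H.Arr => (q.1.1.2, q.2)) (by fun_prop))
      exact (hgm.comp measurable_prodMk_left).aestronglyMeasurable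

end FibProd

/-! ### The space of a composite -/

namespace CompSpace

open scoped ENNReal

variable {G H K : HaarGroupoid.{u}} (P : Corr G H) (Q : Corr H K)

/-- The quotient map. -/
def proj : FibProd P Q → CompSpace P Q := Quotient.mk (orbitSetoid P Q)

theorem isQuot : (FibProd.diag P Q).IsQuot (proj P Q) := by
  refine RAct.IsQuot.of_isQuotientMap isQuotientMap_quotient_mk' fun {z z'} => Quotient.eq.trans ?_
  refine exists_congr fun γ => ⟨?_, ?_⟩
  · rintro ⟨h, e⟩
    exact ⟨h, e.trans (FibProd.diag_act_eq h).symm⟩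
  · rintro ⟨h, e⟩
    exact ⟨h, e.trans (FibProd.diag_act_eq h)⟩

instance : BorelSpace (CompSpace P Q) := ⟨rfl⟩
instance : T2Space (CompSpace P Q) := (isQuot P Q).t2Space (FibProd.diag_isProper P Q)
instance : SecondCountableTopology (CompSpace P Q) := (isQuot P Q).secondCountableTopology
instance : LocallyCompactSpace (CompSpace P Q) := (isQuot P Q).locallyCompactSpace

/-- The action of `G`, as a right action. -/
noncomputable def left : RAct G (CompSpace P Q) := (FibProd.commute_left P Q).quot (isQuot P Q)

/-- The action of `K`. -/
noncomputable def right : RAct K (CompSpace P Q) := (FibProd.commute_right P Q).quot (isQuot P Q)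

variable {P Q}

theorem surjective_proj : Function.Surjective (proj P Q) :=
  (isQuot P Q).isOpenQuotientMap.surjective

@[simp]
theorem left_mom_proj (z : FibProd P Q) : (left P Q).mom (proj P Q z) = P.str.lmom z.1.1 :=
  (FibProd.commute_left P Q).quot_mom (isQuot P Q) z

@[simp]
theorem right_mom_proj (z : FibProd P Q) : (right P Q).mom (proj P Q z) = Q.str.rmom z.1.2 :=
  (FibProd.commute_right P Q).quot_mom (isQuot P Q) z

@[simp]
theorem left_act_proj (z : FibProd P Q) (g : G.Arr) :
    (left P Q).act (proj P Q z) g = proj P Q ((FibProd.left P Q).act z g) :=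
  (FibProd.commute_left P Q).quot_act (isQuot P Q) z g

@[simp]
theorem right_act_proj (z : FibProd P Q) (k : K.Arr) :
    (right P Q).act (proj P Q z) k = proj P Q ((FibProd.right P Q).act z k) :=
  (FibProd.commute_right P Q).quot_act (isQuot P Q) z k

variable (P Q)

/-- Compact sets downstairs are covered by images of compact sets upstairs. If `(x, y k) = (x' γ,
γ⁻¹ y')` with both `(x, y)` and `(x', y')` in compact sets, properness for `P` confines `γ`. Then `y
k = γ⁻¹ y'` lies in a compact set, and properness for `Q` confines `k`. -/
theorem right_isProper : (right P Q).IsProper := by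
  intro A B hA hB
  have hπ := isQuot P Q
  obtain ⟨A', hA', hAA⟩ := hπ.exists_isCompact_image hA
  obtain ⟨B', hB', hBB⟩ := hπ.exists_isCompact_image hB
  obtain ⟨Θ, hΘ, hΘ'⟩ := P.right_isProper _ _
    (hB'.image (f := fun z : FibProd P Q => z.1.1) (by fun_prop))
    (hA'.image (f := fun z : FibProd P Q => z.1.1) (by fun_prop))
  obtain ⟨Γ, hΓ, h⟩ := Q.right_isProper _ _
    (hA'.image (f := fun z : FibProd P Q => z.1.2) (by fun_prop))
    ((FibProd.diag P Q).isCompact_image_act (hB'.prod hΘ) |>.image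
      (f := fun z : FibProd P Q => z.1.2) (by fun_prop))
  refine ⟨Γ, hΓ, fun ω hω k hk hkB => ?_⟩
  obtain ⟨z, hz, rfl⟩ := hAA hω
  rw [right_act_proj] at hkB
  obtain ⟨z', hz', e⟩ := hBB hkB
  obtain ⟨γ, hγ, e'⟩ := hπ.eq_iff.1 e
  rw [right_mom_proj] at hk
  have e₁ : z.1.1 = P.right.act z'.1.1 γ := congrArg (fun q : FibProd P Q => q.1.1) e'
  refine h z.1.2 ⟨z, hz, rfl⟩ k hk ⟨(FibProd.right P Q).act z k, ?_, rfl⟩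
  refine ⟨(z', γ), ⟨⟨hz', hΘ' _ ⟨z', hz', rfl⟩ γ hγ ?_⟩, hγ⟩, e'.symm⟩
  exact ⟨z, hz, e₁⟩

end CompSpace

/-! ### The adjoining function of a composite -/

namespace FibProd.IsCochain

open scoped ENNReal

variable {G H K : HaarGroupoid.{u}} {P : Corr G H} {Q : Corr H K} {b : FibProd P Q → ℝ}

/-- The density `b(z)⁻¹ b(g⁻¹ z) Δ(g, g⁻¹ x)` for the left action. -/
noncomputable def leftDens (b : FibProd P Q → ℝ) (z : FibProd P Q) (g : G.Arr) : ℝ :=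
  (b z)⁻¹ * (b ((left P Q).act z g) * P.dens z.1.1 g)

variable (hb : IsCochain b)
include hb

theorem leftDens_pos (z : FibProd P Q) (g : G.Arr) : 0 < leftDens b z g :=
  mul_pos (inv_pos.2 (hb.pos _)) (mul_pos (hb.pos _) (Corr.dens_pos _ _))

theorem leftDens_junk (z : FibProd P Q) (g : G.Arr) (h : P.str.lmom z.1.1 ≠ G.rng g) :
    leftDens b z g = 1 := by
  rw [leftDens, (left P Q).act_junk z g h, Corr.dens, dif_neg h, mul_one,
    inv_mul_cancel₀ (hb.pos z).ne']

/-- Both values of `b` acquire the same factor, since the left action leaves `y` unchanged, and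
these factors cancel. The density of `P` is invariant under the right action. Thus the expression
descends to the composite. -/
theorem leftDens_diag_act (z : FibProd P Q) (γ : H.Arr) (hγ : P.str.rmom z.1.1 = H.rng γ)
    (g : G.Arr) : leftDens b ((diag P Q).act z γ) g = leftDens b z g := by
  by_cases hg : P.str.lmom z.1.1 = G.rng g
  · unfold leftDens
    rw [(commute_left P Q).act_act, hb.diag_act z γ hγ,
      hb.diag_act ((left P Q).act z g) γ ((Corr.rmom_left_act _ _).trans hγ)]
    show (_)⁻¹ * (b ((left P Q).act z g) * (Q.dens z.1.2 γ)⁻¹ *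
      P.dens (P.right.act z.1.1 γ) g) = _
    rw [Corr.dens_right_act _ _ _ hg]
    have h₁ := (hb.pos z).ne'
    have h₂ := (Corr.dens_pos (P := Q) z.1.2 γ).ne'
    field_simp
  · rw [hb.leftDens_junk _ _ hg, hb.leftDens_junk]
    exact fun h => hg ((Corr.lmom_right_act _ _).symm.trans h)

theorem continuousOn_leftDens : ContinuousOn (fun q : FibProd P Q × G.Arr => leftDens b q.1 q.2)
    {q | (left P Q).mom q.1 = G.rng q.2} := by
  refine ContinuousOn.mul ?_ (ContinuousOn.mul ((left P Q).continuousOn_comp_act hb.continuous) ?_)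
  · exact ((hb.continuous.comp continuous_fst).inv₀ fun q => (hb.pos q.1).ne').continuousOn
  · exact Corr.continuousOn_dens.comp (f := fun q : FibProd P Q × G.Arr => (q.1.1.1, q.2))
      (by fun_prop) fun q hq => hq

/-- The left action moves only `x`, so the quasi-invariance of the measures of `P` can be used for
fixed `y`; the ratio of values of `b` accounts for the weight. -/
theorem qinv_left (a : K.Obj) : (left P Q).QInv
    ((meas P Q a).withDensity fun z => ENNReal.ofReal (b z)) (leftDens b) := by
  intro F hF
  have hbm := hb.measurable.ennreal_ofReal
  have hbF : Measurable fun q : FibProd P Q × G.Arr => ENNReal.ofReal (b q.1) * F q :=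
    (hbm.comp measurable_fst).mul hF
  have hd : Measurable fun q : FibProd P Q × G.Arr => ENNReal.ofReal (leftDens b q.1 q.2) := by
    refine Measurable.ennreal_ofReal ?_
    refine (hb.measurable.comp measurable_fst).inv.mul
      ((hb.measurable.comp (left P Q).measurable_act).mul (Corr.measurable_dens.comp
        (f := fun q : FibProd P Q × G.Arr => (q.1.1.1, q.2)) (by fun_prop)))
  have split : ∀ E : FibProd P Q × G.Arr → ℝ≥0∞, Measurable E →
      (Measurable fun q : FibProd P Q × G.Arr => ENNReal.ofReal (b q.1) * E q) →
      ∫⁻ z, ∫⁻ g, E (z, g) ∂G.haar ((left P Q).mom z)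
          ∂((meas P Q a).withDensity fun z => ENNReal.ofReal (b z)) =
        ∫⁻ y, ∫⁻ x, ∫⁻ g, extend (fun z => ENNReal.ofReal (b z) * E (z, g)) x y
          ∂G.haar (P.str.lmom x) ∂P.str.meas (Q.str.lmom y) ∂Q.str.meas a := by
    intro E hE hbE
    have hE' := (left P Q).measurable_lintegral_haar hE
    rw [lintegral_withDensity_mul hbm hE', lintegral_meas (f := fun z => ENNReal.ofReal (b z) *
      ∫⁻ g, E (z, g) ∂G.haar ((left P Q).mom z)) (hbm.mul hE')]
    refine lintegral_congr fun y => lintegral_congr_ae ?_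
    filter_upwards [P.ae_rmom (Q.str.lmom y)] with x hx
    rw [extend_eq hx]
    simp_rw [extend_eq hx]
    rw [lintegral_const_mul _ (f := fun g => E (_, g)) (hE.comp measurable_prodMk_left)]
    rfl
  have hF' : Measurable fun q : FibProd P Q × G.Arr => F ((left P Q).act q.1 q.2, G.inv q.2) *
      ENNReal.ofReal (leftDens b q.1 q.2) := (hF.comp RAct.measurable_flip).mul hd
  rw [split F hF hbF, split (fun q => F ((left P Q).act q.1 q.2, G.inv q.2) *
    ENNReal.ofReal (leftDens b q.1 q.2)) hF' ((hbm.comp measurable_fst).mul hF')]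
  refine lintegral_congr fun y => ?_
  have hm : Measurable fun q : P.carrier × G.Arr =>
      extend (fun z => ENNReal.ofReal (b z) * F (z, q.2)) q.1 y :=
    (measurable_extend (f := fun z g => ENNReal.ofReal (b z) * F (z, g)) hbF).comp
      (f := fun q : P.carrier × G.Arr => ((q.1, y), q.2)) (by fun_prop)
  refine (Corr.left_qinv (Q.str.lmom y) _ hm).trans (lintegral_congr_ae ?_)
  filter_upwards [P.ae_rmom (Q.str.lmom y)] with x hx
  refine lintegral_congr fun g => ?_
  have e : extend (fun z => ENNReal.ofReal (b z) * F (z, G.inv g)) (P.left.act x g) y =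
      ENNReal.ofReal (b ((left P Q).act ⟨(x, y), hx⟩ g)) *
        F ((left P Q).act ⟨(x, y), hx⟩ g, G.inv g) := extend_eq ((left P Q).act ⟨(x, y), hx⟩ g).2
  rw [extend_eq hx, e, leftDens, ENNReal.ofReal_mul (inv_nonneg.2 (hb.pos _).le),
    ENNReal.ofReal_mul (hb.pos _).le, ENNReal.ofReal_inv_of_pos (hb.pos _)]
  rw [mul_left_comm (ENNReal.ofReal (b ⟨(x, y), hx⟩)), ← mul_assoc (ENNReal.ofReal (b ⟨(x, y), hx⟩)),
    ENNReal.mul_inv_cancel (ENNReal.ofReal_pos.2 (hb.pos _)).ne' ENNReal.ofReal_ne_top, one_mul]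
  ring

end FibProd.IsCochain

/-- The chosen representative of the class and `z` differ by an arrow `γ`, and left invariance of
the Haar system absorbs it. -/
theorem orbitIntegral_proj {G H K : HaarGroupoid.{u}} {P : Corr G H} {Q : Corr H K}
    {f : FibProd P Q → ℝ} (hf : Continuous f) (z : FibProd P Q) :
    orbitIntegral P Q f (CompSpace.proj P Q z) =
      ∫ γ, f ((FibProd.diag P Q).act z γ) ∂H.haar ((FibProd.diag P Q).mom z) := by
  obtain ⟨γ, hγ, e⟩ := (CompSpace.isQuot P Q).eq_iff.1
    (Quotient.out_eq (CompSpace.proj P Q z)).symm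
  have e₁ : orbitIntegral P Q f (CompSpace.proj P Q z) =
      ∫ η, f ((FibProd.diag P Q).act (Quotient.out (CompSpace.proj P Q z)) η)
        ∂H.haar ((FibProd.diag P Q).mom (Quotient.out (CompSpace.proj P Q z))) := by
    unfold orbitIntegral
    rw [← (Quotient.out (CompSpace.proj P Q z)).2]
    refine integral_congr_ae ?_
    filter_upwards [H.ae_rng _] with η hη
    rw [dif_pos hη.symm, FibProd.diag_act_eq]
  rw [e₁, e, (FibProd.diag P Q).mom_act hγ, hγ, ← H.map_tmul_haar γ, integral_map
    (φ := H.tmul γ) (H.measurable_tmul.comp measurable_prodMk_left).aemeasurable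
    (f := fun η => f ((FibProd.diag P Q).act z η))
    (hf.measurable.comp ((FibProd.diag P Q).measurable_act_left z)).aestronglyMeasurable]
  refine integral_congr_ae ?_
  filter_upwards [H.ae_rng (H.src γ)] with η hη
  rw [(FibProd.diag P Q).act_tmul hγ hη.symm]

theorem prodIntegral_eq {G H K : HaarGroupoid.{u}} {P : Corr G H} {Q : Corr H K}
    {b : FibProd P Q → ℝ} (hb : FibProd.IsCochain b) (a : K.Obj) (f : C_c(FibProd P Q, ℝ)) :
    prodIntegral P Q a (fun z => b z * f z) =
      ∫ z, f z ∂((FibProd.meas P Q a).withDensity fun z => ENNReal.ofReal (b z)) := by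
  rw [IsMeasureFamily.integral_withDensity_ofReal hb.continuous fun z => (hb.pos z).le]
  have hc : Continuous fun z => b z * f z := hb.continuous.mul (map_continuous f)
  exact (IsMeasureFamily.integral_pullbackMeasure _ _ _ _ hc.measurable
    (Continuous.integrable_of_hasCompactSupport (μ := FibProd.meas P Q a) hc
      f.hasCompactSupport.mul_left)).symm

/-- The weighted measures `M` on the fibre product are inversion-invariant, so they lift the
measures `μ` obtained from them with a cutoff. Properties of `μ` are then read off from `M`: the
family structure through the cutoff, invariance under `K` through uniqueness of lifts, and
quasi-invariance under `G` through commutation of the actions. -/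
theorem nonempty_composite {G H K : HaarGroupoid.{u}} (P : Corr G H) (Q : Corr H K) :
    Nonempty (Composite P Q) := by
  obtain ⟨b, hb⟩ := FibProd.exists_isCochain P Q
  obtain ⟨e', hec', he0, hes, he⟩ := FibProd.exists_cutoff P Q
  have hec : Continuous fun z : FibProd P Q => e' z.1.1 :=
    hec'.comp (continuous_fst.comp continuous_subtype_val)
  have hπ := CompSpace.isQuot P Q
  obtain ⟨D, hD⟩ := hπ.exists_descend (FibProd.IsCochain.leftDens b) fun z γ hγ =>
    funext fun g => hb.leftDens_diag_act z γ hγ g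
  have hD' : ∀ z g, D (CompSpace.proj P Q z) g = FibProd.IsCochain.leftDens b z g :=
    fun z => congrFun (hD z)
  have hDpos : ∀ ω g, 0 < D ω g := fun ω g => by
    obtain ⟨z, rfl⟩ := CompSpace.surjective_proj ω
    rw [hD']
    exact hb.leftDens_pos z g
  have hDjunk : ∀ ω g, (CompSpace.left P Q).mom ω ≠ G.rng g → D ω g = 1 := fun ω g h => by
    obtain ⟨z, rfl⟩ := CompSpace.surjective_proj ω
    rw [hD']
    exact hb.leftDens_junk z g (by rwa [CompSpace.left_mom_proj] at h)
  have hDc : ContinuousOn (fun q : CompSpace P Q × G.Arr => D q.1 q.2)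
      {q | (CompSpace.left P Q).mom q.1 = G.rng q.2} := by
    refine (hπ.isOpenQuotientMap.prodMap IsOpenQuotientMap.id).continuousOn_of_comp ?_
    refine (hb.continuousOn_leftDens.mono fun q hq => ?_).congr fun q _ => hD' q.1 q.2
    exact (CompSpace.left_mom_proj q.1).symm.trans hq
  have hDm : Measurable fun q : CompSpace P Q × G.Arr => D q.1 q.2 :=
    HaarGroupoid.measurable_of_continuousOn (CompSpace.left P Q).isClosed_domain hDc
      measurable_const fun q hq => hDjunk q.1 q.2 hq
  let M : K.Obj → Measure (FibProd P Q) := fun a =>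
    (FibProd.meas P Q a).withDensity fun z => ENNReal.ofReal (b z)
  let μ : K.Obj → Measure (CompSpace P Q) := fun a =>
    ((M a).withDensity fun z => ENNReal.ofReal (e' z.1.1)).map (CompSpace.proj P Q)
  have hM : IsMeasureFamily (fun z => (CompSpace.right P Q).mom (CompSpace.proj P Q z)) M := by
    simp_rw [CompSpace.right_mom_proj]
    exact hb.isMeasureFamily
  have hlift : ∀ a, (FibProd.diag P Q).IsLift (CompSpace.proj P Q) (μ a) (M a) := fun a =>
    (hb.qinv a).isLift hπ he
  let C : CorrOn G K (CompSpace P Q) := CorrOn.ofRAct (CompSpace.left P Q) (CompSpace.right P Q)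
    (fun ω g => by
      obtain ⟨z, rfl⟩ := CompSpace.surjective_proj ω
      simp only [CompSpace.left_act_proj, CompSpace.right_mom_proj]
      rfl)
    (fun ω g => by
      obtain ⟨z, rfl⟩ := CompSpace.surjective_proj ω
      simp only [CompSpace.right_act_proj, CompSpace.left_mom_proj]
      rfl)
    (fun ω g k => by
      obtain ⟨z, rfl⟩ := CompSpace.surjective_proj ω
      simp only [CompSpace.left_act_proj, CompSpace.right_act_proj, FibProd.left_right_act])
    (CompSpace.right_isProper P Q) μ
    (he.isMeasureFamily_map hec (fun z => he0 _) hes hπ (CompSpace.right P Q).continuous_mom hM)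
    (fun k => by
      -- Both measures have the lift `M (src k)`, because translation by `k` carries `M (rng k)` to
      -- it.
      refine RAct.IsLift.unique hπ he ((hlift _).map_quot (FibProd.commute_right P Q) hπ k
        ((CompSpace.right P Q).measurable_act.comp measurable_prodMk_right)) ?_
      have := hb.map_right_act k
      change _ = M _ at this
      rw [this]
      exact hlift _)
    -- `D` is a density in the form `D(ω, g) = Δ(g, g⁻¹ ω)`; hence `Δ(g, ω) = D(g ω, g)`.
    (fun p => D ((CompSpace.left P Q).act p.1.2 (G.inv p.1.1)) p.1.1)
    (by
      refine hDc.comp_continuous (f := fun p : G.src.Pullback (CompSpace.left P Q).mom =>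
        ((CompSpace.left P Q).act p.1.2 (G.inv p.1.1), p.1.1)) (Continuous.prodMk
        ((CompSpace.left P Q).continuousOn_act.comp_continuous
          (f := fun p : G.src.Pullback (CompSpace.left P Q).mom => (p.1.2, G.inv p.1.1))
          ((continuous_snd.comp continuous_subtype_val).prodMk
          (G.continuous_inv.comp (continuous_fst.comp continuous_subtype_val))) fun p => ?_)
        (continuous_fst.comp continuous_subtype_val)) fun p => ?_
      · exact p.2.symm.trans (G.rng_inv _).symm
      · refine ((CompSpace.left P Q).mom_act (p.2.symm.trans (G.rng_inv _).symm)).trans (G.src_inv _))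
    (fun p => hDpos _ _) D (fun ω g h => by
      show _ = D _ g
      rw [RAct.act_act_inv h])
    hDjunk (fun a => (hlift a).qinv_quot (FibProd.commute_left P Q) hπ he hD' hDm (hb.qinv_left a))
  refine ⟨⟨C, ?_, ?_, ?_, ?_, ⟨b, hb.continuous, hb.pos, ?_, ?_, ?_⟩⟩⟩
  · exact fun x y h => CompSpace.left_mom_proj ⟨(x, y), h⟩
  · exact fun x y h => CompSpace.right_mom_proj ⟨(x, y), h⟩
  · intro g x y h h₁ h₂ h₃
    refine (CompSpace.left_act_proj ⟨(x, y), h⟩ (G.inv g)).trans (congrArg (CompSpace.proj P Q) ?_)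
    exact Subtype.ext (Prod.ext (Corr.lact_eq_left_act h₂).symm rfl)
  · intro x y k h h₁ h₂ h₃
    refine (CompSpace.right_act_proj ⟨(x, y), h⟩ k).trans (congrArg (CompSpace.proj P Q) ?_)
    exact Subtype.ext (Prod.ext rfl (Corr.right_act_eq h₂))
  · intro x y k h h₁ h₂
    rw [← hb.right_act ⟨(x, y), h⟩ k]
    exact congrArg b (Subtype.ext (Prod.ext rfl (Corr.right_act_eq h₁).symm))
  · intro z γ h
    have hl : Q.str.lmom z.1.2 = H.rng γ := z.2.symm.trans h
    rw [← FibProd.diag_act_eq h, hb.diag_act z γ h, Corr.adj_eq_dens, H.inv_inv,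
      Corr.dens_left_act_inv hl, mul_div_cancel_left₀ _ (hb.pos z).ne']
  · intro a f
    have := hM.finiteOnCompacts a
    rw [prodIntegral_eq hb]
    exact (hlift a).integral_eq (FibProd.diag_isProper P Q) hπ f fun z =>
      orbitIntegral_proj (map_continuous f) z

namespace Composite

variable {G H K : HaarGroupoid.{u}} {P : Corr G H} {Q : Corr H K} (R : Composite P Q)

theorem lmom_proj (z : FibProd P Q) : R.lmom (CompSpace.proj P Q z) = P.str.lmom z.1.1 :=
  R.lmom_mk _ _ z.2

theorem rmom_proj (z : FibProd P Q) : R.rmom (CompSpace.proj P Q z) = Q.str.rmom z.1.2 :=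
  R.rmom_mk _ _ z.2

theorem left_act_proj (z : FibProd P Q) (g : G.Arr) :
    R.toCorr.left.act (CompSpace.proj P Q z) g = CompSpace.proj P Q ((FibProd.left P Q).act z g) := by
  by_cases h : P.str.lmom z.1.1 = G.rng g
  · have h' : G.src (G.inv g) = P.str.lmom z.1.1 := by rw [G.src_inv, h]
    rw [Corr.left_act_eq ((R.lmom_proj z).trans h)]
    refine (R.lact_mk (G.inv g) z.1.1 z.1.2 z.2 _ h' (by rw [P.str.rmom_lact, z.2])).trans ?_
    exact congrArg (CompSpace.proj P Q) (Subtype.ext (Prod.ext (Corr.left_act_eq h).symm rfl))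
  · rw [(FibProd.left P Q).act_junk _ _ h, R.toCorr.left.act_junk]
    exact fun h' => h ((R.lmom_proj z).symm.trans h')

theorem right_act_proj (z : FibProd P Q) (k : K.Arr) :
    R.toCorr.right.act (CompSpace.proj P Q z) k =
      CompSpace.proj P Q ((FibProd.right P Q).act z k) := by
  by_cases h : Q.str.rmom z.1.2 = K.rng k
  · rw [Corr.right_act_eq ((R.rmom_proj z).trans h)]
    refine (R.ract_mk z.1.1 z.1.2 k z.2 _ h (by rw [Q.str.lmom_ract, z.2])).trans ?_
    exact congrArg (CompSpace.proj P Q) (Subtype.ext (Prod.ext rfl (Corr.right_act_eq h).symm))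
  · rw [(FibProd.right P Q).act_junk _ _ h, R.toCorr.right.act_junk]
    exact fun h' => h ((R.rmom_proj z).symm.trans h')

/-- The measures of a composite lift to the fibre product. -/
theorem exists_isLift : ∃ b : FibProd P Q → ℝ, FibProd.IsCochain b ∧
    ∀ a, (FibProd.diag P Q).IsLift (CompSpace.proj P Q) (R.meas a)
      ((FibProd.meas P Q a).withDensity fun z => ENNReal.ofReal (b z)) := by
  obtain ⟨b, hbc, hpos, hinv, hco, h⟩ := R.exists_cochain
  have hb : FibProd.IsCochain b := by
    refine ⟨hbc, hpos, fun z k => ?_, fun z γ hγ => ?_⟩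
    · by_cases hk : Q.str.rmom z.1.2 = K.rng k
      · rw [← hinv z.1.1 z.1.2 k z.2 hk (by rw [Q.str.lmom_ract, z.2])]
        exact congrArg b (Subtype.ext (Prod.ext rfl (Corr.right_act_eq hk)))
      · rw [(FibProd.right P Q).act_junk _ _ hk]
    · have hl : Q.str.lmom z.1.2 = H.rng γ := z.2.symm.trans hγ
      have := hco z γ hγ
      rw [← FibProd.diag_act_eq hγ, Corr.adj_eq_dens, H.inv_inv, Corr.dens_left_act_inv hl,
        div_eq_iff (hpos z).ne'] at this
      rw [this, mul_comm]
  -- The definition of a composite gives the lifting equation only for compactly supported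
  -- continuous functions. A cutoff together with the inversion invariance of the weighted measure
  -- extends it to all nonnegative Borel functions.
  obtain ⟨e, hec, he0, hes, he⟩ := FibProd.exists_cutoff P Q
  refine ⟨b, hb, fun a => ?_⟩
  have := hb.isMeasureFamily.finiteOnCompacts a
  have : IsFiniteMeasureOnCompacts (R.meas a) := R.meas_family.finiteOnCompacts a
  refine he.isLift_of_integral_eq (hec.comp (continuous_fst.comp continuous_subtype_val))
    (fun z => he0 _) hes (CompSpace.isQuot P Q) (hb.qinv a) fun f F hF => ?_
  rw [← prodIntegral_eq hb, ← h a f]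
  congr 1
  funext ω
  obtain ⟨z, rfl⟩ := CompSpace.surjective_proj ω
  rw [hF, orbitIntegral_proj (map_continuous f)]

end Composite

/-! ### Identity correspondences -/

theorem IsMeasureFamily.map_homeomorph {X Y B : Type*} [TopologicalSpace X] [T2Space X]
    [LocallyCompactSpace X] [SecondCountableTopology X] [MeasurableSpace X] [BorelSpace X]
    [TopologicalSpace Y] [T2Space Y]
    [LocallyCompactSpace Y] [SecondCountableTopology Y] [MeasurableSpace Y] [BorelSpace Y]
    [TopologicalSpace B] [T2Space B] {p : X → B} {m : B → Measure X} (hm : IsMeasureFamily p m)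
    (hp : Continuous p) (φ : X ≃ₜ Y) :
    IsMeasureFamily (fun y => p (φ.symm y)) fun b => (m b).map φ := by
  have hφ : Measurable φ := φ.continuous.measurable
  refine .of_mem_support (hp.comp φ.symm.continuous) (fun b => ⟨fun K hK => ?_⟩) (fun b => ?_)
    (fun y => ?_) fun f => ?_
  · have := hm.finiteOnCompacts b
    rw [Measure.map_apply hφ hK.measurableSet]
    exact (φ.isCompact_preimage.2 hK).measure_lt_top
  · refine (ae_map_iff hφ.aemeasurable (isClosed_singleton.preimage
      (hp.comp φ.symm.continuous)).measurableSet).2 ?_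
    filter_upwards [hm.ae_eq b] with x hx
    simpa using hx
  · rw [Measure.mem_support_iff_forall]
    intro U hU
    obtain ⟨V, hVU, hV, hyV⟩ := mem_nhds_iff.1 hU
    refine lt_of_lt_of_le ?_ (measure_mono hVU)
    rw [Measure.map_apply hφ hV.measurableSet]
    refine hm.measure_pos (x := φ.symm y) ((hV.preimage φ.continuous).mem_nhds ?_)
    simpa using hyV
  · have e : ∀ b, ∫ y, f y ∂((m b).map φ) = ∫ x, f (φ x) ∂m b := fun b =>
      integral_map hφ.aemeasurable (map_continuous f).aestronglyMeasurable
    simp_rw [e]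
    exact hm.continuous_integral ⟨⟨fun x => f (φ x), (map_continuous f).comp φ.continuous⟩,
      f.hasCompactSupport.comp_homeomorph φ⟩

namespace HaarGroupoid

open scoped ENNReal

variable (G : HaarGroupoid.{u})

/-- Right multiplication. -/
noncomputable def rightMul : RAct G G.Arr where
  mom := G.src
  act := G.tmul
  continuous_mom := G.continuous_src
  continuousOn_act := G.continuousOn_tmul
  act_junk _ _ h := dif_neg h
  mom_act h := G.src_tmul h
  act_one _ := G.tmul_one
  act_tmul h h' := (G.tmul_assoc h h').symm

/-- Left multiplication by inverses, as a right action. -/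
noncomputable def leftMul : RAct G G.Arr where
  mom := G.rng
  act x g := if G.rng x = G.rng g then G.tmul (G.inv g) x else x
  continuous_mom := G.continuous_rng
  continuousOn_act := by
    refine ContinuousOn.congr (f := fun q : G.Arr × G.Arr => G.tmul (G.inv q.2) q.1) ?_
      fun q hq => if_pos hq
    exact G.continuousOn_tmul.comp (f := fun q : G.Arr × G.Arr => (G.inv q.2, q.1))
      ((G.continuous_inv.comp continuous_snd).prodMk continuous_fst).continuousOn fun q hq =>
        (G.src_inv _).trans (Eq.symm hq)
  act_junk _ _ h := if_neg h
  mom_act h := by rw [if_pos h, G.rng_tmul, G.rng_inv]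
  act_one z := by rw [if_pos (G.rng_one _).symm, G.inv_one, G.one_tmul]
  act_tmul {z γ η} h h' := by
    have h₁ : G.rng (G.tmul (G.inv γ) z) = G.rng η := by rw [G.rng_tmul, G.rng_inv, h']
    have h₂ : G.rng z = G.rng (G.tmul γ η) := by rw [G.rng_tmul, h]
    rw [if_pos h, if_pos h₁, if_pos h₂, G.inv_tmul_rev h', G.tmul_assoc (by simp [h'])
      (by simp [h])]

variable {G}

theorem leftMul_act {x g : G.Arr} (h : G.rng x = G.rng g) :
    G.leftMul.act x g = G.tmul (G.inv g) x := if_pos h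

theorem src_leftMul_act (x g : G.Arr) : G.src (G.leftMul.act x g) = G.src x := by
  by_cases h : G.rng x = G.rng g
  · rw [leftMul_act h, G.src_tmul (by simp [h])]
  · rw [G.leftMul.act_junk _ _ h]

theorem leftMul_tmul (x g k : G.Arr) :
    G.leftMul.act (G.tmul x k) g = G.tmul (G.leftMul.act x g) k := by
  by_cases h : G.rng x = G.rng g
  · by_cases h' : G.src x = G.rng k
    · rw [leftMul_act h, leftMul_act (by simpa using h), G.tmul_assoc (by simp [h]) h']
    · rw [show G.tmul x k = x from G.rightMul.act_junk x k h']
      exact (G.rightMul.act_junk (G.leftMul.act x g) k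
        fun hn => h' ((src_leftMul_act x g).symm.trans hn)).symm
  · rw [G.leftMul.act_junk x g h, G.leftMul.act_junk _ _ (fun hn => h (G.rng_tmul.symm.trans hn))]

variable (G)

/-- The arrow `g = x⁻¹ (x g)` depends continuously on `x` and `x g`. -/
theorem rightMul_isProper : G.rightMul.IsProper := fun A B hA hB => by
  refine ⟨_, ((hA.image G.continuous_inv).prod hB |>.inter_right
    (isClosed_eq (G.continuous_src.comp continuous_fst)
      (G.continuous_rng.comp continuous_snd))).image_of_continuousOn
    (G.continuousOn_tmul.mono Set.inter_subset_right), fun x hx g hg hgB => ?_⟩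
  refine ⟨(G.inv x, G.tmul x g), ⟨⟨⟨x, hx, rfl⟩, hgB⟩, ?_⟩, G.inv_tmul_cancel_left hg⟩
  simp [Set.mem_ofPred_eq]

theorem measurable_inv : Measurable G.inv := G.continuous_inv.measurable

theorem lintegral_map_inv (a : G.Obj) {f : G.Arr → ℝ≥0∞} (hf : Measurable f) :
    ∫⁻ x, f x ∂(G.haar a).map G.inv = ∫⁻ x, f (G.inv x) ∂G.haar a :=
  lintegral_map hf G.measurable_inv

theorem map_rightMul (k : G.Arr) : ((G.haar (G.rng k)).map G.inv).map (fun x => G.tmul x k) =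
    (G.haar (G.src k)).map G.inv := by
  have hk : Measurable fun x => G.tmul x k := G.measurable_tmul.comp measurable_prodMk_right
  ext s hs
  have hs1 : Measurable (s.indicator (1 : G.Arr → ℝ≥0∞)) := measurable_one.indicator hs
  rw [← lintegral_indicator_one hs, ← lintegral_indicator_one hs, lintegral_map hs1 hk,
    G.lintegral_map_inv _ (f := fun x => s.indicator 1 (G.tmul x k)) (hs1.comp hk),
    G.lintegral_map_inv _ hs1, ← G.lintegral_inv_tmul k (f := fun x => s.indicator 1 (G.inv x))
      (hs1.comp G.measurable_inv)]
  refine lintegral_congr_ae ?_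
  filter_upwards [G.ae_rng (G.rng k)] with x hx
  rw [G.inv_tmul_rev (by simp [hx]), G.inv_inv]

/-- With `x = y⁻¹` and, by left invariance, `g = y⁻¹ k`, the integral runs over pairs `(y, k)` of
arrows with range `a`. Inversion sends `(x, g)` to `(k⁻¹, k⁻¹ y)`, that is, it interchanges `y` and
`k`, so Fubini gives density `1`. -/
theorem leftMul_qinv (a : G.Obj) : G.leftMul.QInv ((G.haar a).map G.inv) fun _ _ => 1 := by
  intro F hF
  simp only [ENNReal.ofReal_one, mul_one]
  have hF' : Measurable fun q : G.Arr × G.Arr => F (G.leftMul.act q.1 q.2, G.inv q.2) :=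
    hF.comp (G.leftMul.measurable_act.prodMk (G.measurable_inv.comp measurable_snd))
  rw [G.lintegral_map_inv a (f := fun x => ∫⁻ g, F (x, g) ∂G.haar (G.leftMul.mom x))
    (G.leftMul.measurable_lintegral_haar hF), G.lintegral_map_inv a
    (f := fun x => ∫⁻ g, F (G.leftMul.act x g, G.inv g) ∂G.haar (G.leftMul.mom x))
    (G.leftMul.measurable_lintegral_haar hF')]
  have hm : Measurable fun q : G.Arr × G.Arr => F (G.inv q.1, G.tmul (G.inv q.1) q.2) :=
    hF.comp ((G.measurable_inv.comp measurable_fst).prodMk (G.measurable_tmul.comp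
      ((G.measurable_inv.comp measurable_fst).prodMk measurable_snd)))
  have := G.haar_family.finiteOnCompacts a
  calc ∫⁻ y, ∫⁻ g, F (G.inv y, g) ∂G.haar (G.rng (G.inv y)) ∂G.haar a
      = ∫⁻ y, ∫⁻ k, F (G.inv y, G.tmul (G.inv y) k) ∂G.haar a ∂G.haar a := by
        refine lintegral_congr_ae ?_
        filter_upwards [G.ae_rng a] with y hy
        rw [G.rng_inv, ← hy, G.lintegral_inv_tmul y (f := fun g => F (G.inv y, g))
          (hF.comp measurable_prodMk_left)]
    _ = ∫⁻ y, ∫⁻ k, F (G.inv k, G.tmul (G.inv k) y) ∂G.haar a ∂G.haar a :=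
        lintegral_lintegral_swap (f := fun y k => F (G.inv y, G.tmul (G.inv y) k)) hm.aemeasurable
    _ = _ := by
        refine lintegral_congr_ae ?_
        filter_upwards [G.ae_rng a] with y hy
        show _ = ∫⁻ g, F (G.leftMul.act (G.inv y) g, G.inv g) ∂G.haar (G.rng (G.inv y))
        rw [G.rng_inv, ← hy, ← G.lintegral_tmul y (f := fun k => F (G.inv k, G.tmul (G.inv k) y))
          (hF.comp (G.measurable_inv.prodMk (G.measurable_tmul.comp
            (G.measurable_inv.prodMk measurable_const))))]
        refine lintegral_congr_ae ?_
        filter_upwards [G.ae_rng (G.src y)] with g hg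
        rw [leftMul_act (by simp [hg]), G.inv_tmul_rev hg.symm,
          G.inv_tmul_cancel_right (by simp [hg])]

end HaarGroupoid

theorem nonempty_idCorr (G : HaarGroupoid.{u}) : Nonempty (IdCorr G) := by
  let C : CorrOn G G G.Arr := CorrOn.ofRAct G.leftMul G.rightMul
    HaarGroupoid.src_leftMul_act (fun _ _ => G.rng_tmul) HaarGroupoid.leftMul_tmul
    G.rightMul_isProper (fun a => (G.haar a).map G.inv)
    (by
      have := G.haar_family.map_homeomorph G.continuous_rng G.invHomeo
      simp only [LCGroupoid.invHomeo_symm_apply, G.rng_inv] at this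
      exact this)
    G.map_rightMul (fun _ => 1) continuous_const (fun _ => one_pos) (fun _ _ => 1)
    (fun _ _ _ => rfl) (fun _ _ _ => rfl) G.leftMul_qinv
  refine ⟨⟨C, fun _ => rfl, fun _ => rfl, fun g x h h' => ?_, fun x g h h' => G.tmul_eq h',
    fun _ => rfl, fun _ => rfl⟩⟩
  refine (HaarGroupoid.leftMul_act (by rw [G.rng_inv]; exact h'.symm)).trans ?_
  rw [G.inv_inv, G.tmul_eq h']

namespace IdCorr

variable {G : HaarGroupoid.{u}} (I : IdCorr G)

theorem left_act_eq {x g : G.Arr} (h : G.rng x = G.rng g) :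
    I.toCorr.left.act x g = G.tmul (G.inv g) x := by
  have h' : G.src (G.inv g) = G.rng x := by rw [G.src_inv, h]
  rw [Corr.left_act_eq ((I.lmom_eq x).trans h), G.tmul_eq h']
  exact I.lact_eq _ _ _ _

theorem right_act_eq (x g : G.Arr) : I.toCorr.right.act x g = G.tmul x g := by
  by_cases h : G.src x = G.rng g
  · rw [Corr.right_act_eq ((I.rmom_eq x).trans h), G.tmul_eq h]
    exact I.ract_eq _ _ _ _
  · rw [I.toCorr.right.act_junk _ _ fun hn => h ((I.rmom_eq x).symm.trans hn)]
    exact (G.rightMul.act_junk x g h).symm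

end IdCorr

/-! ### Tools for constructing isomorphisms of correspondences -/

section

variable {Z Ω Ω' : Type*} [TopologicalSpace Z] [TopologicalSpace Ω] [TopologicalSpace Ω']
  {f : Z → Ω} {f' : Z → Ω'}

/-- Two quotient maps with the same fibres have homeomorphic targets. -/
noncomputable def homeomorphOfIsQuotientMap (hf : IsQuotientMap f) (hf' : IsQuotientMap f')
    (h : ∀ z z', f z = f z' ↔ f' z = f' z') : Ω ≃ₜ Ω' :=
  have e : ∀ z, f' (Function.surjInv hf.surjective (f z)) = f' z := fun _ =>
    (h _ _).1 (Function.surjInv_eq hf.surjective _)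
  have e' : ∀ z, f (Function.surjInv hf'.surjective (f' z)) = f z := fun _ =>
    (h _ _).2 (Function.surjInv_eq hf'.surjective _)
  { toFun ω := f' (Function.surjInv hf.surjective ω)
    invFun ω := f (Function.surjInv hf'.surjective ω)
    left_inv ω := (e' _).trans (Function.surjInv_eq hf.surjective ω)
    right_inv ω := (e _).trans (Function.surjInv_eq hf'.surjective ω)
    continuous_toFun := hf.continuous_iff.2 (hf'.continuous.congr fun z => (e z).symm)
    continuous_invFun := hf'.continuous_iff.2 (hf.continuous.congr fun z => (e' z).symm) }

theorem homeomorphOfIsQuotientMap_apply (hf : IsQuotientMap f) (hf' : IsQuotientMap f')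
    (h : ∀ z z', f z = f z' ↔ f' z = f' z') (z : Z) :
    homeomorphOfIsQuotientMap hf hf' h (f z) = f' z :=
  (h _ _).1 (Function.surjInv_eq hf.surjective _)

end

namespace RAct

open scoped ENNReal

variable {H : HaarGroupoid.{u}} {Z Ω Ω' : Type*} [TopologicalSpace Z] [TopologicalSpace Ω]
  [TopologicalSpace Ω'] {S : RAct H Z} {π : Z → Ω} {π' : Z → Ω'} [T2Space Z] [LocallyCompactSpace Z]
  [SecondCountableTopology Z] [MeasurableSpace Z] [BorelSpace Z] [MeasurableSpace Ω] [BorelSpace Ω]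
  [MeasurableSpace Ω'] [BorelSpace Ω'] [T2Space Ω] [SecondCountableTopology Ω] [T2Space Ω']
  [SecondCountableTopology Ω']

theorem IsQuot.measurable_of_avg (hπ : S.IsQuot π) {f : Z → ℝ≥0∞} (hf : Measurable f)
    {F : Ω → ℝ≥0∞} (hF : ∀ z, F (π z) = S.avg f z) : Measurable F := by
  refine measurable_of_comp_surjective hπ.isOpenQuotientMap.continuous.measurable
    hπ.isOpenQuotientMap.surjective ?_
  simp_rw [hF]
  exact S.measurable_avg hf

theorem IsLift.withDensity {μ : Measure Ω} {M : Measure Z} (h : S.IsLift π μ M) (hπ : S.IsQuot π)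
    {D : Ω → ℝ≥0∞} (hD : Measurable D) :
    S.IsLift π (μ.withDensity D) (M.withDensity fun z => D (π z)) := by
  intro f hf F hF
  have hDπ : Measurable fun z => D (π z) := hD.comp hπ.isOpenQuotientMap.continuous.measurable
  rw [lintegral_withDensity_mul hD (hπ.measurable_of_avg hf hF), lintegral_withDensity_mul hDπ hf]
  simp_rw [mul_comm (D _)]
  refine h _ (hf.mul hDπ) _ fun z => ?_
  rw [hF]
  exact (S.avg_mul_of_invariant hf (φ := fun z => D (π z))
    (fun z γ hγ => by rw [hπ.map_act hγ]) z).symm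

theorem IsLift.map {μ : Measure Ω} {M : Measure Z} (h : S.IsLift π μ M) (hπ' : S.IsQuot π')
    {φ : Ω → Ω'} (hφ : Measurable φ) (e : ∀ z, φ (π z) = π' z) : S.IsLift π' (μ.map φ) M := by
  intro f hf F hF
  rw [lintegral_map (hπ'.measurable_of_avg hf hF) hφ]
  exact h f hf _ fun z => by rw [e, hF]

/-- Quotients of two continuously equivalent families of measures are continuously equivalent. -/
theorem contEquivalent_of_isLift {ι : Type*} {μ : ι → Measure Ω} {μ' : ι → Measure Ω'}
    {N : ι → Measure Z} (hπ' : S.IsQuot π') {e : Z → ℝ≥0∞} (he : S.IsCutoff e)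
    {φ : Ω → Ω'} (hφ : Measurable φ) (hφπ : ∀ z, φ (π z) = π' z)
    (hN : ∀ a, IsFiniteMeasureOnCompacts (N a)) (hsupp : ∀ z, ∃ a, z ∈ (N a).support)
    {b b' : Z → ℝ} (hb : Continuous b) (hb' : Continuous b') (hp : ∀ z, 0 < b z)
    (hp' : ∀ z, 0 < b' z)
    (h : ∀ a, S.IsLift π (μ a) ((N a).withDensity fun z => ENNReal.ofReal (b z)))
    (h' : ∀ a, S.IsLift π' (μ' a) ((N a).withDensity fun z => ENNReal.ofReal (b' z))) :
    ContEquivalent (fun a => (μ a).map φ) μ' := by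
  -- Relative to `π'`, the measure `φ_* μ` has the same lift `b N` as `μ` has relative to `π`, while
  -- `μ'` has the lift `b' N`. The ratio `b / b'` is therefore the density that descends.
  have hD : Continuous fun z => b z / b' z := hb.div hb' fun z => (hp' z).ne'
  obtain ⟨D', hD', hpos, -, hd⟩ := IsLift.exists_density (μ' := fun a => (μ a).map φ) hπ' he
    (fun a => isFiniteMeasureOnCompacts_withDensity (N := N a) isClosed_univ
      (.of_forall fun _ => trivial) hb'.continuousOn)
    (fun z => (hsupp z).imp fun a ha => IsMeasureFamily.mem_support_withDensity hb' ha (hp' z)) hD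
    (fun z => div_pos (hp z) (hp' z)) h' (fun a => by
      rw [← withDensity_mul _ hb'.measurable.ennreal_ofReal hD.measurable.ennreal_ofReal]
      convert (h a).map hπ' hφ hφπ using 2
      funext z
      rw [Pi.mul_apply, ← ENNReal.ofReal_mul (hp' z).le, mul_div_cancel₀ _ (hp' z).ne'])
  exact ⟨D', hD', hpos, hd⟩

end RAct

namespace CorrIso

variable {G H : HaarGroupoid.{u}} {P Q : Corr G H}

theorem map_left_act (η : CorrIso P Q) (x : P.carrier) (g : G.Arr) :
    η.φ (P.left.act x g) = Q.left.act (η.φ x) g := by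
  by_cases h : P.str.lmom x = G.rng g
  · rw [Corr.left_act_eq h, Corr.left_act_eq ((η.lmom_map x).trans h)]
    exact η.lact_map _ _ _ _
  · rw [P.left.act_junk _ _ h, Q.left.act_junk _ _ fun hn => h ((η.lmom_map x).symm.trans hn)]

theorem map_right_act (η : CorrIso P Q) (x : P.carrier) (k : H.Arr) :
    η.φ (P.right.act x k) = Q.right.act (η.φ x) k := by
  by_cases h : P.str.rmom x = H.rng k
  · rw [Corr.right_act_eq h, Corr.right_act_eq ((η.rmom_map x).trans h)]
    exact η.ract_map _ _ _ _
  · rw [P.right.act_junk _ _ h, Q.right.act_junk _ _ fun hn => h ((η.rmom_map x).symm.trans hn)]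

/-- An isomorphism from a homeomorphism that commutes with the (total) actions. -/
def ofAct (φ : P.carrier ≃ₜ Q.carrier) (hl : ∀ x, Q.str.lmom (φ x) = P.str.lmom x)
    (hr : ∀ x, Q.str.rmom (φ x) = P.str.rmom x)
    (hla : ∀ x g, φ (P.left.act x g) = Q.left.act (φ x) g)
    (hra : ∀ x k, φ (P.right.act x k) = Q.right.act (φ x) k)
    (h : ContEquivalent (fun a => (P.str.meas a).map φ) Q.str.meas) : CorrIso P Q where
  φ := φ
  lmom_map := hl
  rmom_map := hr
  lact_map g x h h' := by rw [Corr.lact_eq_left_act h, Corr.lact_eq_left_act h', hla]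
  ract_map x k h h' := by rw [← Corr.right_act_eq h, ← Corr.right_act_eq h', hra]
  equivalent := h

/-- The inverse isomorphism. -/
def symm (η : CorrIso P Q) : CorrIso Q P :=
  ofAct η.φ.symm (fun x => by rw [← η.lmom_map, Homeomorph.apply_symm_apply])
    (fun x => by rw [← η.rmom_map, Homeomorph.apply_symm_apply])
    (fun x g => by rw [Homeomorph.symm_apply_eq, map_left_act, Homeomorph.apply_symm_apply])
    (fun x g => by rw [Homeomorph.symm_apply_eq, map_right_act, Homeomorph.apply_symm_apply]) (by
    obtain ⟨h, hc, hp, he⟩ := η.equivalent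
    have hφ := η.φ.continuous.measurable
    have hψ := η.φ.symm.continuous.measurable
    have hm : Measurable fun x => ENNReal.ofReal (h x) := hc.measurable.ennreal_ofReal
    have hm' : Measurable fun x => ENNReal.ofReal (h (η.φ x))⁻¹ :=
      (hc.comp η.φ.continuous).measurable.inv.ennreal_ofReal
    refine ⟨fun x => (h (η.φ x))⁻¹, (hc.comp η.φ.continuous).inv₀ fun x => (hp _).ne',
      fun x => inv_pos.2 (hp _), fun b => ?_⟩
    ext s hs
    have hs1 : Measurable (s.indicator (1 : P.carrier → ENNReal)) := measurable_one.indicator hs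
    have e : ∫⁻ x, s.indicator 1 (η.φ.symm x) * ENNReal.ofReal (h x)⁻¹
        ∂((P.str.meas b).map η.φ) = ∫⁻ x, s.indicator 1 (η.φ.symm x) ∂Q.str.meas b := by
      rw [show (P.str.meas b).map η.φ = _ from he b, lintegral_withDensity_mul hm
        (f := fun x => s.indicator 1 (η.φ.symm x) * ENNReal.ofReal (h x)⁻¹)
        ((hs1.comp hψ).mul hc.measurable.inv.ennreal_ofReal)]
      refine lintegral_congr fun x => ?_
      rw [mul_left_comm, ← ENNReal.ofReal_mul (hp x).le, mul_inv_cancel₀ (hp x).ne',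
        ENNReal.ofReal_one, mul_one]
    rw [← lintegral_indicator_one hs, ← lintegral_indicator_one hs, lintegral_map hs1 hψ, ← e,
      lintegral_map (f := fun x => s.indicator 1 (η.φ.symm x) * ENNReal.ofReal (h x)⁻¹)
        ((hs1.comp hψ).mul hc.measurable.inv.ennreal_ofReal) hφ, lintegral_withDensity_mul hm' hs1]
    refine lintegral_congr fun x => ?_
    rw [Homeomorph.symm_apply_apply, mul_comm])

/-- An isomorphism of correspondences as an isomorphism in the category of correspondences. -/
def toIso (η : CorrIso P Q) : P ≅ Q where
  hom := η
  inv := η.symm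
  hom_inv_id := CorrIso.ext fun x => η.φ.symm_apply_apply x
  inv_hom_id := CorrIso.ext fun x => η.φ.apply_symm_apply x

theorem exists_lintegral (η : CorrIso P Q) : ∃ h : P.carrier → ℝ, Continuous h ∧ (∀ x, 0 < h x) ∧
    ∀ (a : H.Obj) (f : Q.carrier → ENNReal), Measurable f →
      ∫⁻ x, f x ∂Q.str.meas a = ∫⁻ x, f (η.φ x) * ENNReal.ofReal (h x) ∂P.str.meas a := by
  obtain ⟨h, hc, hp, he⟩ := η.symm.equivalent
  refine ⟨h, hc, hp, fun a f hf => ?_⟩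
  have hψ : Measurable η.φ.symm := η.φ.symm.continuous.measurable
  have hfφ : Measurable fun x => f (η.φ x) := hf.comp η.φ.continuous.measurable
  simp_rw [mul_comm (f _)]
  rw [← lintegral_withDensity_mul hc.measurable.ennreal_ofReal hfφ,
    ← show (Q.str.meas a).map η.φ.symm = _ from he a, lintegral_map hfφ hψ]
  simp_rw [Homeomorph.apply_symm_apply]

end CorrIso

/-! ### Horizontal composition -/

theorem FibProd.exists_mem_support_meas {G H K : HaarGroupoid.{u}} {P : Corr G H} {Q : Corr H K}
    (z : FibProd P Q) : ∃ a, z ∈ (FibProd.meas P Q a).support :=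
  ⟨_, (FibProd.isMeasureFamily_meas P Q).mem_support z⟩

/-- The measure condition for all structural 2-arrows is reduced to this: the measures of `R`
already lift to the fibre product with some positive continuous weight, so only the target family
still has to be lifted along the composite quotient map. -/
theorem Composite.contEquivalent {G H K : HaarGroupoid.{u}} {P : Corr G H} {Q : Corr H K}
    (R : Composite P Q) {Ω : Type*} [TopologicalSpace Ω] [T2Space Ω] [SecondCountableTopology Ω]
    [MeasurableSpace Ω] [BorelSpace Ω] {π : FibProd P Q → Ω} (hπ : (FibProd.diag P Q).IsQuot π)
    {φ : CompSpace P Q → Ω} (hφ : Measurable φ) (hφπ : ∀ z, φ (CompSpace.proj P Q z) = π z)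
    {μ : K.Obj → Measure Ω} {b : FibProd P Q → ℝ} (hb : Continuous b) (hp : ∀ z, 0 < b z)
    (h : ∀ a, (FibProd.diag P Q).IsLift π (μ a)
      ((FibProd.meas P Q a).withDensity fun z => ENNReal.ofReal (b z))) :
    ContEquivalent (fun a => (R.meas a).map φ) μ := by
  obtain ⟨b', hb', h'⟩ := R.exists_isLift
  obtain ⟨e, -, -, -, he⟩ := FibProd.exists_cutoff P Q
  exact RAct.contEquivalent_of_isLift hπ he hφ hφπ (fun a => inferInstance)
    FibProd.exists_mem_support_meas hb'.continuous hb hb'.pos hp h' h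

section Horizontal

open scoped ENNReal

variable {G H K : HaarGroupoid.{u}} {P P' : Corr G H} {Q Q' : Corr H K}

/-- The map of fibre products induced by a pair of isomorphisms. -/
def FibProd.map (η : CorrIso P P') (θ : CorrIso Q Q') : FibProd P Q ≃ₜ FibProd P' Q' where
  toFun z := ⟨(η.φ z.1.1, θ.φ z.1.2), by rw [η.rmom_map, θ.lmom_map, z.2]⟩
  invFun z := ⟨(η.φ.symm z.1.1, θ.φ.symm z.1.2), by
    rw [← η.rmom_map, ← θ.lmom_map, Homeomorph.apply_symm_apply, Homeomorph.apply_symm_apply, z.2]⟩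
  left_inv z := Subtype.ext (Prod.ext (η.φ.symm_apply_apply _) (θ.φ.symm_apply_apply _))
  right_inv z := Subtype.ext (Prod.ext (η.φ.apply_symm_apply _) (θ.φ.apply_symm_apply _))
  continuous_toFun := by
    refine Continuous.subtype_mk (Continuous.prodMk ?_ ?_) _
    · exact η.φ.continuous.comp (continuous_fst.comp continuous_subtype_val)
    · exact θ.φ.continuous.comp (continuous_snd.comp continuous_subtype_val)
  continuous_invFun := by
    refine Continuous.subtype_mk (Continuous.prodMk ?_ ?_) _
    · exact η.φ.symm.continuous.comp (continuous_fst.comp continuous_subtype_val)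
    · exact θ.φ.symm.continuous.comp (continuous_snd.comp continuous_subtype_val)

theorem FibProd.map_diag_act (η : CorrIso P P') (θ : CorrIso Q Q') (z : FibProd P Q) (γ : H.Arr) :
    map η θ ((diag P Q).act z γ) = (diag P' Q').act (map η θ z) γ :=
  Subtype.ext (Prod.ext (η.map_right_act _ _) (θ.map_left_act _ _))

theorem FibProd.isQuot_proj_map (η : CorrIso P P') (θ : CorrIso Q Q') :
    (diag P Q).IsQuot fun z => CompSpace.proj P' Q' (map η θ z) where
  isOpenQuotientMap := (CompSpace.isQuot P' Q').isOpenQuotientMap.comp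
    (map η θ).isOpenQuotientMap
  eq_iff {z z'} := by
    rw [(CompSpace.isQuot P' Q').eq_iff]
    refine exists_congr fun γ => and_congr ?_ ?_
    · exact Eq.congr_left (η.rmom_map _)
    · rw [← map_diag_act, (map η θ).injective.eq_iff]

/-- The map of composite spaces induced by a pair of isomorphisms. -/
noncomputable def CompSpace.map (η : CorrIso P P') (θ : CorrIso Q Q') :
    CompSpace P Q ≃ₜ CompSpace P' Q' :=
  homeomorphOfIsQuotientMap (CompSpace.isQuot P Q).isOpenQuotientMap.isQuotientMap
    (FibProd.isQuot_proj_map η θ).isOpenQuotientMap.isQuotientMap fun _ _ =>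
      (CompSpace.isQuot P Q).eq_iff.trans (FibProd.isQuot_proj_map η θ).eq_iff.symm

theorem CompSpace.map_proj (η : CorrIso P P') (θ : CorrIso Q Q') (z : FibProd P Q) :
    CompSpace.map η θ (CompSpace.proj P Q z) = CompSpace.proj P' Q' (FibProd.map η θ z) :=
  homeomorphOfIsQuotientMap_apply _ _ _ _

theorem FibProd.exists_lintegral_map (η : CorrIso P P') (θ : CorrIso Q Q') :
    ∃ D : FibProd P Q → ℝ, Continuous D ∧ (∀ z, 0 < D z) ∧
    ∀ (a : K.Obj) (f : FibProd P' Q' → ℝ≥0∞), Measurable f →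
      ∫⁻ z, f z ∂meas P' Q' a = ∫⁻ z, f (map η θ z) * ENNReal.ofReal (D z) ∂meas P Q a := by
  obtain ⟨h, hc, hp, hh⟩ := η.exists_lintegral
  obtain ⟨k, kc, kp, hk⟩ := θ.exists_lintegral
  have hD : Continuous fun z : FibProd P Q => h z.1.1 * k z.1.2 :=
    (hc.comp (continuous_fst.comp continuous_subtype_val)).mul
      (kc.comp (continuous_snd.comp continuous_subtype_val))
  refine ⟨fun z => h z.1.1 * k z.1.2, hD, fun z => mul_pos (hp _) (kp _), fun a f hf => ?_⟩
  have hf2 : Measurable fun z : FibProd P Q => f (map η θ z) * ENNReal.ofReal (h z.1.1 * k z.1.2) :=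
    (hf.comp (map η θ).continuous.measurable).mul hD.measurable.ennreal_ofReal
  have hfe := measurable_extend' hf
  have hm : Measurable fun y => ∫⁻ x, extend f x y ∂P'.str.meas (Q'.str.lmom y) :=
    P'.str.meas_family.measurable_lintegral P'.str.continuous_rmom Q'.str.continuous_lmom
      (hfe.comp measurable_swap)
  rw [lintegral_meas hf, lintegral_meas hf2, hk a _ hm]
  refine lintegral_congr fun y => ?_
  rw [hh _ (fun x => extend f x (θ.φ y)) (hfe.comp measurable_prodMk_right), θ.lmom_map,
    ← lintegral_mul_const _ (f := fun x => extend f (η.φ x) (θ.φ y) * ENNReal.ofReal (h x))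
    (((hfe.comp measurable_prodMk_right).comp η.φ.continuous.measurable).mul
      hc.measurable.ennreal_ofReal)]
  refine lintegral_congr_ae ?_
  filter_upwards [P.ae_rmom (Q.str.lmom y)] with x hx
  rw [extend_eq hx, extend_eq (show P'.str.rmom (η.φ x) = Q'.str.lmom (θ.φ y) by
    rw [η.rmom_map, θ.lmom_map, hx]), ENNReal.ofReal_mul (hp _).le, mul_assoc]
  rfl

/-- The horizontal composition `[x, y] ↦ [η x, θ y]`. -/
noncomputable def CorrIso.hcomp (R : Composite P Q) (R' : Composite P' Q') (η : CorrIso P P')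
    (θ : CorrIso Q Q') : CorrIso R.toCorr R'.toCorr :=
  CorrIso.ofAct (P := R.toCorr) (Q := R'.toCorr) (CompSpace.map η θ)
    (fun ω => by
      obtain ⟨z, rfl⟩ := CompSpace.surjective_proj ω
      rw [CompSpace.map_proj]
      exact (R'.lmom_proj _).trans ((η.lmom_map _).trans (R.lmom_proj z).symm))
    (fun ω => by
      obtain ⟨z, rfl⟩ := CompSpace.surjective_proj ω
      rw [CompSpace.map_proj]
      exact (R'.rmom_proj _).trans ((θ.rmom_map _).trans (R.rmom_proj z).symm))
    (fun ω g => by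
      obtain ⟨z, rfl⟩ := CompSpace.surjective_proj ω
      rw [R.left_act_proj, CompSpace.map_proj, CompSpace.map_proj, R'.left_act_proj]
      exact congrArg (CompSpace.proj P' Q') (Subtype.ext (Prod.ext (η.map_left_act _ _) rfl)))
    (fun ω g => by
      obtain ⟨z, rfl⟩ := CompSpace.surjective_proj ω
      rw [R.right_act_proj, CompSpace.map_proj, CompSpace.map_proj, R'.right_act_proj]
      exact congrArg (CompSpace.proj P' Q') (Subtype.ext (Prod.ext rfl (θ.map_right_act _ _))))
    (by
      obtain ⟨b', hb', h'⟩ := R'.exists_isLift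
      obtain ⟨D, hD, hpos, hDl⟩ := FibProd.exists_lintegral_map η θ
      have hΦ := (FibProd.map η θ).continuous
      have hbD : Continuous fun z => b' (FibProd.map η θ z) * D z := (hb'.continuous.comp hΦ).mul hD
      -- The target family lifts to the fibre product of `P'` and `Q'` with weight `b'`. Transport
      -- along the homeomorphism gives a lift on the fibre product of `P` and `Q`; the Radon–Nikodym
      -- derivative of the product measures contributes `D`.
      refine R.contEquivalent (FibProd.isQuot_proj_map η θ)
        (CompSpace.map η θ).continuous.measurable (CompSpace.map_proj η θ) hbD
        (fun z => mul_pos (hb'.pos _) (hpos z)) fun a f hf F hF => ?_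
      have hΨ := (FibProd.map η θ).symm.continuous.measurable
      have hfΨ : Measurable fun z => f ((FibProd.map η θ).symm z) := hf.comp hΨ
      rw [h' a _ hfΨ F fun z => ?_]
      · rw [lintegral_withDensity_mul hb'.measurable.ennreal_ofReal hfΨ,
          lintegral_withDensity_mul hbD.measurable.ennreal_ofReal hf, hDl a (fun z =>
          ENNReal.ofReal (b' z) * f ((FibProd.map η θ).symm z))
          (hb'.measurable.ennreal_ofReal.mul hfΨ)]
        refine lintegral_congr fun z => ?_
        rw [Homeomorph.symm_apply_apply, ENNReal.ofReal_mul (hb'.pos _).le, mul_right_comm]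
      · obtain ⟨z, rfl⟩ := (FibProd.map η θ).surjective z
        rw [hF]
        unfold RAct.avg
        rw [show (FibProd.diag P' Q').mom (FibProd.map η θ z) = (FibProd.diag P Q).mom z from
          η.rmom_map _]
        refine lintegral_congr fun γ => ?_
        show _ = f ((FibProd.map η θ).symm _)
        rw [← FibProd.map_diag_act, Homeomorph.symm_apply_apply])

end Horizontal

/-! ### Identity isomorphisms -/

section Unitors

open scoped ENNReal

variable {G H : HaarGroupoid.{u}} (P : Corr G H)

section Left

variable {P} (I : IdCorr G)

theorem FibProd.src_eq_lmom (z : FibProd I.toCorr P) : G.src z.1.1 = P.str.lmom z.1.2 :=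
  (I.rmom_eq _).symm.trans z.2

variable (P) in
/-- The map `(γ, x) ↦ γ x`. -/
noncomputable def FibProd.lmul (z : FibProd I.toCorr P) : P.carrier :=
  P.left.act z.1.2 (G.inv z.1.1)

theorem FibProd.lmul_mem (z : FibProd I.toCorr P) : P.str.lmom z.1.2 = G.rng (G.inv z.1.1) := by
  rw [G.rng_inv, src_eq_lmom I z]

theorem FibProd.lmom_lmul (z : FibProd I.toCorr P) : P.str.lmom (lmul P I z) = G.rng z.1.1 := by
  rw [lmul, Corr.lmom_left_act (lmul_mem I z), G.src_inv]

theorem FibProd.continuous_lmul : Continuous (lmul P I) :=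
  P.left.continuousOn_act.comp_continuous
    (f := fun z : FibProd I.toCorr P => (z.1.2, G.inv z.1.1))
    ((continuous_snd.comp continuous_subtype_val).prodMk
      (G.continuous_inv.comp (continuous_fst.comp continuous_subtype_val))) (lmul_mem I)

theorem FibProd.left_act_lmul (z : FibProd I.toCorr P) : P.left.act (lmul P I z) z.1.1 = z.1.2 := by
  have := RAct.act_act_inv (S := P.left) (lmul_mem I z)
  rwa [G.inv_inv] at this

theorem FibProd.lmul_diag_act (z : FibProd I.toCorr P) (γ : G.Arr) (h : G.src z.1.1 = G.rng γ) :
    lmul P I ((diag I.toCorr P).act z γ) = lmul P I z := by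
  have hl : P.str.lmom z.1.2 = G.rng γ := (src_eq_lmom I z).symm.trans h
  show P.left.act (P.left.act z.1.2 γ) (G.inv (I.toCorr.right.act z.1.1 γ)) = _
  rw [I.right_act_eq, G.inv_tmul_rev h, ← P.left.act_tmul hl (by simp),
    G.tmul_inv_cancel_left (by simp [h])]
  rfl

-- The continuous section `x ↦ (1, x)` makes this a quotient map, and two pairs `(γ, x)`, `(γ', x')`
-- with the same product lie in one orbit via the arrow `γ⁻¹ γ'`.
variable (P) in
theorem FibProd.isQuot_lmul : (diag I.toCorr P).IsQuot (lmul P I) := by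
  refine .of_isQuotientMap ?_ fun {z z'} => ⟨fun e => ?_, ?_⟩
  · refine IsQuotientMap.of_inverse (f := fun x : P.carrier =>
      (⟨(G.one (P.str.lmom x), x),
      (I.rmom_eq _).trans (G.src_one _)⟩ : FibProd I.toCorr P)) ?_ (continuous_lmul I) fun x => ?_
    · exact Continuous.subtype_mk ((G.continuous_one.comp P.str.continuous_lmom).prodMk
        continuous_id) _
    · show P.left.act x (G.inv (G.one (P.str.lmom x))) = x
      rw [G.inv_one]
      exact P.left.act_one x
  · have hr : G.rng z.1.1 = G.rng z'.1.1 := by rw [← lmom_lmul I z, ← lmom_lmul I z', e]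
    have hs : G.src (G.inv z.1.1) = G.rng z'.1.1 := by rw [G.src_inv, hr]
    refine ⟨G.tmul (G.inv z.1.1) z'.1.1, ?_, Subtype.ext (Prod.ext ?_ ?_)⟩
    · show I.rmom z.1.1 = _
      rw [I.rmom_eq, G.rng_tmul, G.rng_inv]
    · show _ = I.toCorr.right.act _ _
      rw [I.right_act_eq, G.tmul_inv_cancel_left hr]
    · show _ = P.left.act _ _
      rw [P.left.act_tmul (lmul_mem I z) hs]
      change _ = P.left.act (lmul P I z) z'.1.1
      rw [e, left_act_lmul]
  · rintro ⟨γ, hγ, rfl⟩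
    exact (lmul_diag_act I z γ ((I.rmom_eq _).symm.trans hγ)).symm

/-- The left identity isomorphism as a map. -/
noncomputable def CompSpace.lmul : CompSpace I.toCorr P ≃ₜ P.carrier :=
  homeomorphOfIsQuotientMap (CompSpace.isQuot I.toCorr P).isOpenQuotientMap.isQuotientMap
    (FibProd.isQuot_lmul P I).isOpenQuotientMap.isQuotientMap fun _ _ =>
      (CompSpace.isQuot I.toCorr P).eq_iff.trans (FibProd.isQuot_lmul P I).eq_iff.symm

theorem CompSpace.lmul_proj (z : FibProd I.toCorr P) :
    CompSpace.lmul I (CompSpace.proj I.toCorr P z) = FibProd.lmul P I z :=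
  homeomorphOfIsQuotientMap_apply _ _ _ _

/-- The orbit over `x` is parametrised from the representative `(1, x)` by `(γ, γ⁻¹ x)`.
Quasi-invariance of the measure of `P` brings the product integral into this form with an extra
factor `P.dens x γ`, which the weight cancels. -/
theorem FibProd.isLift_lmul (a : H.Obj) : (diag I.toCorr P).IsLift (lmul P I) (P.str.meas a)
    ((meas I.toCorr P a).withDensity fun z =>
      ENNReal.ofReal (P.dens (lmul P I z) z.1.1)⁻¹) := by
  intro f hf F hF
  have hd : Measurable fun z : FibProd I.toCorr P =>
      ENNReal.ofReal (P.dens (lmul P I z) z.1.1)⁻¹ :=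
    (Corr.measurable_dens.comp ((continuous_lmul I).measurable.prodMk
      (measurable_fst.comp measurable_subtype_coe))).inv.ennreal_ofReal
  have hdf := hd.mul hf
  have hm : Measurable fun q : P.carrier × G.Arr => extend (P := I.toCorr) (Q := P)
      (fun z => ENNReal.ofReal (P.dens (lmul P I z) z.1.1)⁻¹ * f z) (G.inv q.2) q.1 :=
    (measurable_extend' hdf).comp
      ((G.continuous_inv.measurable.comp measurable_snd).prodMk measurable_fst)
  rw [lintegral_withDensity_mul hd hf, lintegral_meas
    (f := fun z => ENNReal.ofReal (P.dens (lmul P I z) z.1.1)⁻¹ * f z) hdf]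
  simp_rw [I.meas_eq]
  have e : ∀ y, ∫⁻ x, extend (P := I.toCorr) (Q := P) (fun z =>
      ENNReal.ofReal (P.dens (lmul P I z) z.1.1)⁻¹ * f z) x y
        ∂(G.haar (P.str.lmom y)).map G.inv = ∫⁻ g, extend (P := I.toCorr) (Q := P) (fun z =>
      ENNReal.ofReal (P.dens (lmul P I z) z.1.1)⁻¹ * f z) (G.inv g) y
        ∂G.haar (P.left.mom y) := fun y =>
    G.lintegral_map_inv _ ((measurable_extend' hdf).comp measurable_prodMk_right)
  simp_rw [e]
  rw [Corr.left_qinv a _ hm]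
  refine lintegral_congr fun x => ?_
  have hx : I.rmom (G.one (P.str.lmom x)) = P.str.lmom x := (I.rmom_eq _).trans (G.src_one _)
  have e₁ : lmul P I ⟨(G.one (P.str.lmom x), x), hx⟩ = x := by
    show P.left.act x (G.inv (G.one (P.str.lmom x))) = x
    rw [G.inv_one]
    exact P.left.act_one x
  rw [← e₁, hF, e₁]
  unfold RAct.avg
  rw [show (diag I.toCorr P).mom ⟨(G.one (P.str.lmom x), x), hx⟩ = P.str.lmom x from hx]
  refine lintegral_congr_ae ?_
  filter_upwards [G.ae_rng (P.str.lmom x)] with γ hγ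
  have e₂ : ((diag I.toCorr P).act ⟨(G.one (P.str.lmom x), x), hx⟩ γ).1 =
      (G.inv (G.inv γ), P.left.act x γ) := by
    refine Prod.ext ?_ rfl
    show I.toCorr.right.act _ _ = _
    rw [I.right_act_eq, G.one_tmul' hγ, G.inv_inv]
  have e₃ : lmul P I ((diag I.toCorr P).act ⟨(G.one (P.str.lmom x), x), hx⟩ γ) = x :=
    (lmul_diag_act I _ γ ((G.src_one _).trans hγ.symm)).trans e₁
  have h₃ : I.toCorr.str.rmom (G.inv (G.inv γ)) = P.str.lmom (P.left.act x γ) := by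
    have := ((diag I.toCorr P).act ⟨(G.one (P.str.lmom x), x), hx⟩ γ).2
    rwa [e₂] at this
  have e₄ : (⟨(G.inv (G.inv γ), P.left.act x γ), h₃⟩ : FibProd I.toCorr P) =
      (diag I.toCorr P).act ⟨(G.one (P.str.lmom x), x), hx⟩ γ := Subtype.ext e₂.symm
  rw [extend_eq h₃, e₄, e₃, e₂, G.inv_inv, mul_right_comm, ← ENNReal.ofReal_mul
    (inv_nonneg.2 (Corr.dens_pos _ _).le), inv_mul_cancel₀ (Corr.dens_pos _ _).ne',
    ENNReal.ofReal_one, one_mul]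

theorem FibProd.continuous_dens_lmul :
    Continuous fun z : FibProd I.toCorr P => P.dens (lmul P I z) z.1.1 :=
  Corr.continuousOn_dens.comp_continuous
    (f := fun z : FibProd I.toCorr P => (lmul P I z, z.1.1))
    ((continuous_lmul I).prodMk (continuous_fst.comp continuous_subtype_val)) (lmom_lmul I)

/-- The left identity isomorphism `[γ, x] ↦ γ x`. -/
noncomputable def CorrIso.lunit (R : Composite I.toCorr P) : CorrIso R.toCorr P :=
  CorrIso.ofAct (P := R.toCorr) (Q := P) (CompSpace.lmul I)
    (fun ω => by
      obtain ⟨z, rfl⟩ := CompSpace.surjective_proj ω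
      rw [CompSpace.lmul_proj, FibProd.lmom_lmul]
      exact ((R.lmom_proj z).trans (I.lmom_eq _)).symm)
    (fun ω => by
      obtain ⟨z, rfl⟩ := CompSpace.surjective_proj ω
      rw [CompSpace.lmul_proj]
      exact (Corr.rmom_left_act _ _).trans (R.rmom_proj z).symm)
    (fun ω g => by
      obtain ⟨z, rfl⟩ := CompSpace.surjective_proj ω
      rw [R.left_act_proj, CompSpace.lmul_proj, CompSpace.lmul_proj]
      by_cases h : G.rng z.1.1 = G.rng g
      · show P.left.act z.1.2 (G.inv (I.toCorr.left.act z.1.1 g)) =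
          P.left.act (P.left.act z.1.2 (G.inv z.1.1)) g
        rw [I.left_act_eq h, G.inv_tmul_rev (by simp [h]), G.inv_inv,
          P.left.act_tmul (FibProd.lmul_mem I z) (by simp [h])]
      · rw [P.left.act_junk (FibProd.lmul P I z) g fun hn =>
          h ((FibProd.lmom_lmul I z).symm.trans hn), (FibProd.left I.toCorr P).act_junk _ _
            fun hn => h ((I.lmom_eq _).symm.trans hn)])
    (fun ω k => by
      obtain ⟨z, rfl⟩ := CompSpace.surjective_proj ω
      rw [R.right_act_proj, CompSpace.lmul_proj, CompSpace.lmul_proj]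
      exact Corr.left_right_act _ _ _)
    (by
      exact R.contEquivalent (FibProd.isQuot_lmul P I)
        (CompSpace.lmul I).continuous.measurable (CompSpace.lmul_proj I)
        ((FibProd.continuous_dens_lmul I).inv₀ fun z => (Corr.dens_pos _ _).ne')
        (fun z => inv_pos.2 (Corr.dens_pos _ _)) (FibProd.isLift_lmul I))

end Left

section Right

variable {P} (I : IdCorr H)

theorem FibProd.rmom_eq_rng (z : FibProd P I.toCorr) : P.str.rmom z.1.1 = H.rng z.1.2 :=
  z.2.trans (I.lmom_eq _)

variable (P) in
/-- The map `(x, γ) ↦ x γ`. -/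
noncomputable def FibProd.rmul (z : FibProd P I.toCorr) : P.carrier := P.right.act z.1.1 z.1.2

theorem FibProd.rmom_rmul (z : FibProd P I.toCorr) : P.str.rmom (rmul P I z) = H.src z.1.2 :=
  Corr.rmom_right_act (rmom_eq_rng I z)

theorem FibProd.continuous_rmul : Continuous (rmul P I) :=
  P.right.continuousOn_act.comp_continuous
    (f := fun z : FibProd P I.toCorr => (z.1.1, z.1.2)) (by fun_prop) (rmom_eq_rng I)

theorem FibProd.rmul_diag_act (z : FibProd P I.toCorr) (γ : H.Arr)
    (h : P.str.rmom z.1.1 = H.rng γ) :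
    rmul P I ((diag P I.toCorr).act z γ) = rmul P I z := by
  have hr : H.rng z.1.2 = H.rng γ := (rmom_eq_rng I z).symm.trans h
  show P.right.act (P.right.act z.1.1 γ) (I.toCorr.left.act z.1.2 γ) = _
  rw [I.left_act_eq hr, ← P.right.act_tmul h (by simp), H.tmul_inv_cancel_left hr.symm]
  rfl

variable (P) in
theorem FibProd.isQuot_rmul : (diag P I.toCorr).IsQuot (rmul P I) := by
  refine .of_isQuotientMap ?_ fun {z z'} => ⟨fun e => ?_, ?_⟩
  · refine IsQuotientMap.of_inverse (f := fun x : P.carrier => (⟨(x, H.one (P.str.rmom x)),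
      ((I.lmom_eq _).trans (H.rng_one _)).symm⟩ : FibProd P I.toCorr)) ?_ (continuous_rmul I) fun x => ?_
    · exact Continuous.subtype_mk (continuous_id.prodMk
        (H.continuous_one.comp P.str.continuous_rmom)) _
    · exact P.right.act_one x
  · have hs : H.src z.1.2 = H.src z'.1.2 := by rw [← rmom_rmul I z, ← rmom_rmul I z', e]
    have hs' : H.src z.1.2 = H.rng (H.inv z'.1.2) := by rw [H.rng_inv, hs]
    have hr : P.str.rmom z.1.1 = H.rng (H.tmul z.1.2 (H.inv z'.1.2)) := by
      rw [H.rng_tmul, rmom_eq_rng I z]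
    refine ⟨H.tmul z.1.2 (H.inv z'.1.2), hr, Subtype.ext (Prod.ext ?_ ?_)⟩
    · show _ = P.right.act _ _
      rw [P.right.act_tmul (rmom_eq_rng I z) hs']
      change _ = P.right.act (rmul P I z) _
      rw [e]
      exact (RAct.act_act_inv (S := P.right) (rmom_eq_rng I z')).symm
    · show _ = I.toCorr.left.act _ _
      rw [I.left_act_eq (by simp), H.inv_tmul_rev hs', H.inv_inv,
        H.inv_tmul_cancel_right (by simp [hs])]
  · rintro ⟨γ, hγ, rfl⟩
    exact (rmul_diag_act I z γ hγ).symm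

/-- The right identity isomorphism as a map. -/
noncomputable def CompSpace.rmul : CompSpace P I.toCorr ≃ₜ P.carrier :=
  homeomorphOfIsQuotientMap (CompSpace.isQuot P I.toCorr).isOpenQuotientMap.isQuotientMap
    (FibProd.isQuot_rmul P I).isOpenQuotientMap.isQuotientMap fun _ _ =>
      (CompSpace.isQuot P I.toCorr).eq_iff.trans (FibProd.isQuot_rmul P I).eq_iff.symm

theorem CompSpace.rmul_proj (z : FibProd P I.toCorr) :
    CompSpace.rmul I (CompSpace.proj P I.toCorr z) = FibProd.rmul P I z :=
  homeomorphOfIsQuotientMap_apply _ _ _ _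

/-- The orbit over `x` is parametrised from `(x, 1)` by `(x γ, γ⁻¹)`. Fubini and the invariance of
the measures of `P` under `γ` give the product integral, with no weight because the identity
correspondence has adjoining function `1`. -/
theorem FibProd.isLift_rmul (a : H.Obj) : (diag P I.toCorr).IsLift (rmul P I) (P.str.meas a)
    (meas P I.toCorr a) := by
  intro f hf F hF
  have hm : Measurable fun q : H.Arr × P.carrier => extend (P := P) (Q := I.toCorr) f
      (P.right.act q.2 q.1) (H.inv q.1) :=
    (measurable_extend' hf).comp ((P.right.measurable_act.comp
      (measurable_snd.prodMk measurable_fst)).prodMk (H.measurable_inv.comp measurable_fst))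
  have hmi : Measurable fun y => ∫⁻ x, extend (P := P) (Q := I.toCorr) f x y
      ∂P.str.meas (I.lmom y) :=
    P.str.meas_family.measurable_lintegral P.str.continuous_rmom I.continuous_lmom
      ((measurable_extend' hf).comp measurable_swap)
  have := H.haar_family.finiteOnCompacts a
  rw [lintegral_meas hf]
  show _ = ∫⁻ y, ∫⁻ x, extend (P := P) (Q := I.toCorr) f x y ∂P.str.meas (I.lmom y) ∂I.meas a
  rw [I.meas_eq, H.lintegral_map_inv _ hmi]
  calc ∫⁻ x, F x ∂P.str.meas a
      = ∫⁻ x, ∫⁻ γ, extend (P := P) (Q := I.toCorr) f (P.right.act x γ) (H.inv γ)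
          ∂H.haar a ∂P.str.meas a := by
        refine lintegral_congr_ae ?_
        filter_upwards [P.ae_rmom a] with x hx
        have hx' : P.str.rmom x = I.lmom (H.one a) := by rw [I.lmom_eq, H.rng_one, hx]
        have e₁ : rmul P I ⟨(x, H.one a), hx'⟩ = x := by
          subst hx
          exact P.right.act_one x
        refine (congrArg F e₁.symm).trans ((hF _).trans ?_)
        unfold RAct.avg
        rw [show (diag P I.toCorr).mom ⟨(x, H.one a), hx'⟩ = a from hx]
        refine lintegral_congr_ae ?_
        filter_upwards [H.ae_rng a] with γ hγ
        have e₂ : ((diag P I.toCorr).act ⟨(x, H.one a), hx'⟩ γ).1 =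
            (P.right.act x γ, H.inv γ) := by
          refine Prod.ext rfl ?_
          show I.toCorr.left.act _ _ = _
          rw [I.left_act_eq (by rw [H.rng_one, hγ]), H.tmul_one' (by simp [hγ])]
        have h₃ : P.str.rmom (P.right.act x γ) = I.toCorr.str.lmom (H.inv γ) := by
          have := ((diag P I.toCorr).act ⟨(x, H.one a), hx'⟩ γ).2
          rwa [e₂] at this
        rw [extend_eq h₃]
        exact congrArg f (Subtype.ext e₂)
    _ = ∫⁻ γ, ∫⁻ x, extend (P := P) (Q := I.toCorr) f (P.right.act x γ) (H.inv γ)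
          ∂P.str.meas a ∂H.haar a :=
        (lintegral_lintegral_swap (f := fun γ x => extend (P := P) (Q := I.toCorr) f
          (P.right.act x γ) (H.inv γ)) hm.aemeasurable).symm
    _ = _ := by
        refine lintegral_congr_ae ?_
        filter_upwards [H.ae_rng a] with γ hγ
        rw [I.lmom_eq, H.rng_inv, ← hγ]
        exact Corr.lintegral_right_act γ ((measurable_extend' hf).comp measurable_prodMk_right)

/-- The right identity isomorphism `[x, γ] ↦ x γ`. -/
noncomputable def CorrIso.runit (R : Composite P I.toCorr) : CorrIso R.toCorr P :=
  CorrIso.ofAct (P := R.toCorr) (Q := P) (CompSpace.rmul I)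
    (fun ω => by
      obtain ⟨z, rfl⟩ := CompSpace.surjective_proj ω
      rw [CompSpace.rmul_proj]
      exact (Corr.lmom_right_act _ _).trans (R.lmom_proj z).symm)
    (fun ω => by
      obtain ⟨z, rfl⟩ := CompSpace.surjective_proj ω
      rw [CompSpace.rmul_proj, FibProd.rmom_rmul]
      exact ((R.rmom_proj z).trans (I.rmom_eq _)).symm)
    (fun ω g => by
      obtain ⟨z, rfl⟩ := CompSpace.surjective_proj ω
      rw [R.left_act_proj, CompSpace.rmul_proj, CompSpace.rmul_proj]
      exact (Corr.left_right_act _ _ _).symm)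
    (fun ω k => by
      obtain ⟨z, rfl⟩ := CompSpace.surjective_proj ω
      rw [R.right_act_proj, CompSpace.rmul_proj, CompSpace.rmul_proj]
      show P.right.act z.1.1 (I.toCorr.right.act z.1.2 k) = P.right.act (P.right.act _ _) k
      rw [I.right_act_eq]
      by_cases h : H.src z.1.2 = H.rng k
      · rw [P.right.act_tmul (FibProd.rmom_eq_rng I z) h]
      · rw [P.right.act_junk (P.right.act _ _) k fun hn =>
          h ((FibProd.rmom_rmul I z).symm.trans hn),
          show H.tmul z.1.2 k = z.1.2 from H.rightMul.act_junk _ _ h])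
    (by
      refine R.contEquivalent (FibProd.isQuot_rmul P I)
        (CompSpace.rmul I).continuous.measurable (CompSpace.rmul_proj I) (b := fun _ => 1)
        continuous_const (fun z => one_pos) fun a => ?_
      rw [ENNReal.ofReal_one, show (fun _ : FibProd P I.toCorr => (1 : ℝ≥0∞)) = 1 from rfl,
        withDensity_one]
      exact FibProd.isLift_rmul I a)

end Right

end Unitors

/-! ### Successive quotients -/

/-- Used to pass one factor of the triple product to its quotient: the momentum condition upstairs
is the full preimage of the one downstairs. -/
theorem IsOpenQuotientMap.subtypeMap {X Y : Type*} [TopologicalSpace X] [TopologicalSpace Y]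
    {π : X → Y} (hπ : IsOpenQuotientMap π) {p : X → Prop} {q : Y → Prop} (h : ∀ x, p x ↔ q (π x)) :
    IsOpenQuotientMap fun x : Subtype p => (⟨π x, (h x).1 x.2⟩ : Subtype q) := by
  obtain rfl : p = fun x => q (π x) := funext fun x => propext (h x)
  refine ⟨fun y => ?_, (hπ.continuous.comp continuous_subtype_val).subtype_mk _, ?_⟩
  · obtain ⟨x, hx⟩ := hπ.surjective y
    exact ⟨⟨x, by rw [hx]; exact y.2⟩, Subtype.ext hx⟩
  · exact hπ.isOpenMap.restrictPreimage {y | q y}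

namespace RAct

open scoped ENNReal

variable {H K : HaarGroupoid.{u}} {T W V Ω : Type*} [TopologicalSpace T] [TopologicalSpace W]
  [TopologicalSpace V] [TopologicalSpace Ω] {S : RAct H T} {S' : RAct K T}

theorem Commute.symm (c : S.Commute S') : S'.Commute S where
  mom_act_left := c.mom_act_right
  mom_act_right := c.mom_act_left
  act_act z k γ := (c.act_act z γ k).symm

/-- The map `p` intertwines the actions. -/
structure Equivariant (S : RAct H T) (A : RAct H W) (p : T → W) : Prop where
  mom : ∀ t, A.mom (p t) = S.mom t
  act : ∀ t γ, A.act (p t) γ = p (S.act t γ)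

variable {A : RAct H W} {p : T → W} {π : W → Ω}

theorem Commute.comp_eq_iff (c : S.Commute S') (hp : S'.IsQuot p) (hA : S.Equivariant A p)
    (hπ : A.IsQuot π) {t t' : T} : π (p t) = π (p t') ↔
      ∃ γ k, S.mom t = H.rng γ ∧ S'.mom t = K.rng k ∧ t' = S'.act (S.act t γ) k := by
  rw [hπ.eq_iff]
  constructor
  · rintro ⟨γ, hγ, e⟩
    rw [hA.act, eq_comm, hp.eq_iff] at e
    obtain ⟨k, hk, e⟩ := e
    exact ⟨γ, k, (hA.mom t).symm.trans hγ, (c.mom_act_left t γ).symm.trans hk, e⟩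
  · rintro ⟨γ, k, hγ, hk, rfl⟩
    exact ⟨γ, (hA.mom t).trans hγ, by rw [hA.act, hp.map_act ((c.mom_act_left t γ).trans hk)]⟩

variable [T2Space T] [LocallyCompactSpace T] [SecondCountableTopology T] [MeasurableSpace T]
  [BorelSpace T] [T2Space W] [LocallyCompactSpace W] [SecondCountableTopology W]
  [MeasurableSpace W] [BorelSpace W] [T2Space V] [LocallyCompactSpace V]
  [SecondCountableTopology V] [MeasurableSpace V] [BorelSpace V] [MeasurableSpace Ω] [BorelSpace Ω]

/-- Lifting a measure in two steps, in either order. -/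
theorem IsLift.exchange (c : S.Commute S') (hp : S'.IsQuot p) (hA : S.Equivariant A p)
    {B : RAct K V} {q : T → V} (hq : S.IsQuot q) (hB : S'.Equivariant B q) {ρ : V → Ω}
    (e : ∀ t, ρ (q t) = π (p t)) {κ : T → ℝ≥0∞} (hκ : S'.IsCutoff κ)
    {μ : Measure Ω} {N : Measure T} {MV : Measure V} {MW : Measure W}
    (h₁ : B.IsLift ρ μ MV) (h₂ : S.IsLift q MV N) (h₃ : S'.IsLift p MW N) : A.IsLift π μ MW := by
  intro F hF F' hF'
  have hpm := hp.isOpenQuotientMap.continuous.measurable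
  -- The cutoff `κ` produces a function on `T` whose `K`-average is `F ∘ p`. Averaging it over `K`
  -- and then `H`, or over `H` and then `K`, gives the same result by Fubini, so the lifts through
  -- `W` and through `V` can be compared.
  have hf : Measurable fun t => κ t * F (p t) := hκ.measurable.mul (hF.comp hpm)
  have havg : ∀ t, F (p t) = S'.avg (fun t => κ t * F (p t)) t := fun t => by
    rw [S'.avg_mul_of_invariant hκ.measurable (φ := fun t => F (p t))
      (fun t k hk => by rw [hp.map_act hk]), hκ.avg_eq_one, one_mul]
  obtain ⟨F₁, hF₁⟩ := hq.exists_descend _ fun t γ hγ => S.avg_act hγ hf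
  rw [h₃ _ hf F havg, ← h₂ _ hf F₁ hF₁]
  refine h₁ _ (hq.measurable_of_avg hf hF₁) _ fun v => ?_
  obtain ⟨t, rfl⟩ := hq.isOpenQuotientMap.surjective v
  rw [e, hF']
  have := H.haar_family.finiteOnCompacts (S.mom t)
  have := K.haar_family.finiteOnCompacts (S'.mom t)
  calc A.avg F (p t)
      = ∫⁻ γ, ∫⁻ k, κ (S'.act (S.act t γ) k) * F (p (S'.act (S.act t γ) k))
          ∂K.haar (S'.mom t) ∂H.haar (S.mom t) := by
        unfold avg at havg ⊢
        rw [hA.mom]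
        refine lintegral_congr fun γ => ?_
        rw [hA.act, havg, c.mom_act_left]
    _ = ∫⁻ k, ∫⁻ γ, κ (S'.act (S.act t γ) k) * F (p (S'.act (S.act t γ) k))
          ∂H.haar (S.mom t) ∂K.haar (S'.mom t) := by
        refine lintegral_lintegral_swap (f := fun γ k => κ (S'.act (S.act t γ) k) *
          F (p (S'.act (S.act t γ) k))) (Measurable.aemeasurable ?_)
        exact hf.comp (S'.measurable_act.comp
          (((S.measurable_act_left t).comp measurable_fst).prodMk measurable_snd))
    _ = B.avg F₁ (q t) := by
        unfold avg at hF₁ ⊢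
        rw [hB.mom]
        refine lintegral_congr fun k => ?_
        rw [hB.act, hF₁, c.mom_act_right]
        simp_rw [c.act_act]

end RAct

/-! ### Triple products -/

/-- The fibre product of three correspondences. -/
abbrev TripProd {G H K L : HaarGroupoid.{u}} (P : Corr G H) (Q : Corr H K) (R : Corr K L) :
    Type u :=
  P.str.rmom.Pullback fun q : FibProd Q R => Q.str.lmom q.1.1

section

variable {G H K : HaarGroupoid.{u}} (P : Corr G H) (Q : Corr H K)

theorem FibProd.locallyCompactSpace : LocallyCompactSpace (FibProd P Q) := inferInstance

theorem FibProd.secondCountableTopology : SecondCountableTopology (FibProd P Q) := inferInstance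

end

section

variable {G H K L : HaarGroupoid.{u}} {P : Corr G H} {Q : Corr H K} {R : Corr K L}

instance (A : Composite Q R) : LocallyCompactSpace (FibProd P A.toCorr) :=
  FibProd.locallyCompactSpace P A.toCorr

instance (A : Composite Q R) : SecondCountableTopology (FibProd P A.toCorr) :=
  FibProd.secondCountableTopology P A.toCorr

instance (B : Composite P Q) : LocallyCompactSpace (FibProd B.toCorr R) :=
  FibProd.locallyCompactSpace B.toCorr R

instance (B : Composite P Q) : SecondCountableTopology (FibProd B.toCorr R) :=
  FibProd.secondCountableTopology B.toCorr R

end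

namespace TripProd

open scoped ENNReal

variable {G H K L : HaarGroupoid.{u}} (P : Corr G H) (Q : Corr H K) (R : Corr K L)

theorem continuous_lmom_fst : Continuous fun q : FibProd Q R => Q.str.lmom q.1.1 :=
  Q.str.continuous_lmom.comp (continuous_fst.comp continuous_subtype_val)

theorem continuous_rmom_snd : Continuous fun q : FibProd P Q => Q.str.rmom q.1.2 :=
  Q.str.continuous_rmom.comp (continuous_snd.comp continuous_subtype_val)

instance : LocallyCompactSpace (TripProd P Q R) :=
  IsMeasureFamily.locallyCompactSpace_pullback P.str.continuous_rmom (continuous_lmom_fst Q R)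

instance : SecondCountableTopology (TripProd P Q R) :=
  TopologicalSpace.Subtype.secondCountableTopology
    {q : P.carrier × FibProd Q R | P.str.rmom q.1 = Q.str.lmom q.2.1.1}

/-- The action `(x, y, z) γ = (x γ, γ⁻¹ y, z)` of `H`. -/
noncomputable def actLeft : RAct H (TripProd P Q R) where
  mom t := P.str.rmom t.1.1
  act t γ := ⟨(P.right.act t.1.1 γ, (FibProd.left Q R).act t.1.2 γ),
    ((FibProd.diag P Q).act ⟨(t.1.1, t.1.2.1.1), t.2⟩ γ).2⟩
  continuous_mom := P.str.continuous_rmom.comp (continuous_fst.comp continuous_subtype_val)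
  continuousOn_act := by
    refine Topology.IsInducing.subtypeVal.continuousOn_iff.2 ?_
    refine ContinuousOn.prodMk
      (P.right.continuousOn_act.comp (f := fun q : TripProd P Q R × H.Arr => (q.1.1.1, q.2))
        (by fun_prop) fun q hq => hq)
      ((FibProd.left Q R).continuousOn_act.comp
        (f := fun q : TripProd P Q R × H.Arr => (q.1.1.2, q.2))
        (by fun_prop) fun q hq => q.1.2.symm.trans hq)
  act_junk t γ h := Subtype.ext (Prod.ext (P.right.act_junk _ _ h)
    ((FibProd.left Q R).act_junk _ _ fun h' => h (t.2.trans h')))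
  mom_act h := Corr.rmom_right_act h
  act_one t := Subtype.ext (Prod.ext (P.right.act_one _) (by
    show (FibProd.left Q R).act t.1.2 (H.one (P.str.rmom t.1.1)) = _
    rw [t.2]
    exact (FibProd.left Q R).act_one _))
  act_tmul {t γ η} h h' := Subtype.ext (Prod.ext (P.right.act_tmul h h')
    ((FibProd.left Q R).act_tmul (t.2.symm.trans h) h'))

/-- The action `(x, y, z) k = (x, y k, k⁻¹ z)` of `K`. -/
noncomputable def actRight : RAct K (TripProd P Q R) where
  mom t := (FibProd.diag Q R).mom t.1.2
  act t k := ⟨(t.1.1, (FibProd.diag Q R).act t.1.2 k), t.2.trans (Corr.lmom_right_act _ _).symm⟩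
  continuous_mom := (FibProd.diag Q R).continuous_mom.comp
    (continuous_snd.comp continuous_subtype_val)
  continuousOn_act := by
    refine Topology.IsInducing.subtypeVal.continuousOn_iff.2 (ContinuousOn.prodMk (by fun_prop) ?_)
    exact (FibProd.diag Q R).continuousOn_act.comp
      (f := fun q : TripProd P Q R × K.Arr => (q.1.1.2, q.2)) (by fun_prop) fun q hq => hq
  act_junk t k h := Subtype.ext (Prod.ext rfl ((FibProd.diag Q R).act_junk _ _ h))
  mom_act h := (FibProd.diag Q R).mom_act h
  act_one t := Subtype.ext (Prod.ext rfl ((FibProd.diag Q R).act_one _))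
  act_tmul h h' := Subtype.ext (Prod.ext rfl ((FibProd.diag Q R).act_tmul h h'))

theorem commute : (actLeft P Q R).Commute (actRight P Q R) where
  mom_act_left _ _ := Corr.rmom_left_act _ _
  mom_act_right _ _ := rfl
  act_act t γ k := Subtype.ext (Prod.ext rfl ((FibProd.commute_left Q R).act_act t.1.2 k γ).symm)

/-- The projection to the first two factors. -/
def fst (t : TripProd P Q R) : FibProd P Q := ⟨(t.1.1, t.1.2.1.1), t.2⟩

/-- The triple product, bracketed to the left. -/
def assoc : TripProd P Q R ≃ₜ (fun p : FibProd P Q => Q.str.rmom p.1.2).Pullback R.str.lmom where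
  toFun t := ⟨(fst P Q R t, t.1.2.1.2), t.1.2.2⟩
  invFun s := ⟨(s.1.1.1.1, ⟨(s.1.1.1.2, s.1.2), s.2⟩), s.1.1.2⟩
  left_inv _ := rfl
  right_inv _ := rfl
  continuous_toFun := by
    unfold fst
    fun_prop
  continuous_invFun := by fun_prop

variable {P Q R}

/-- The map `(x, y, z) ↦ (x, [y, z])`. -/
def toRight (A : Composite Q R) (t : TripProd P Q R) : FibProd P A.toCorr :=
  ⟨(t.1.1, CompSpace.proj Q R t.1.2), t.2.trans (A.lmom_proj _).symm⟩

/-- The map `(x, y, z) ↦ ([x, y], z)`. -/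
def toLeft (B : Composite P Q) (t : TripProd P Q R) : FibProd B.toCorr R :=
  ⟨(CompSpace.proj P Q (fst P Q R t), t.1.2.1.2), (B.rmom_proj _).trans t.1.2.2⟩

section

variable (A : Composite Q R)

theorem isQuot_toRight : (actRight P Q R).IsQuot (toRight (P := P) A) := by
  refine .of_isQuotientMap ?_ fun {t t'} => ?_
  · exact ((IsOpenQuotientMap.id.prodMap (CompSpace.isQuot Q R).isOpenQuotientMap).subtypeMap
      (q := fun w : P.carrier × CompSpace Q R => P.str.rmom w.1 = A.lmom w.2)
      fun x => by rw [Prod.map_snd, A.lmom_proj]; rfl).isQuotientMap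
  · refine Subtype.ext_iff.trans (Prod.ext_iff.trans ((and_congr Iff.rfl
      (CompSpace.isQuot Q R).eq_iff).trans ?_))
    constructor
    · rintro ⟨e, k, hk, e'⟩
      exact ⟨k, hk, Subtype.ext (Prod.ext e.symm e')⟩
    · rintro ⟨k, hk, rfl⟩
      exact ⟨rfl, k, hk, rfl⟩

theorem equivariant_toRight :
    (actLeft P Q R).Equivariant (FibProd.diag P A.toCorr) (toRight A) where
  mom _ := rfl
  act _ _ := Subtype.ext (Prod.ext rfl (A.left_act_proj _ _))

end

section

variable (B : Composite P Q)

theorem isQuot_toLeft : (actLeft P Q R).IsQuot (toLeft (R := R) B) := by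
  refine .of_isQuotientMap ?_ fun {t t'} => ?_
  · exact (((CompSpace.isQuot P Q).isOpenQuotientMap.prodMap IsOpenQuotientMap.id).subtypeMap
      (q := fun w : CompSpace P Q × R.carrier => B.rmom w.1 = R.str.lmom w.2)
      fun x => by rw [Prod.map_fst, B.rmom_proj]; rfl).isQuotientMap.comp
        (assoc P Q R).isQuotientMap
  · refine Subtype.ext_iff.trans (Prod.ext_iff.trans ((and_congr
      (CompSpace.isQuot P Q).eq_iff Iff.rfl).trans ?_))
    constructor
    · rintro ⟨⟨γ, hγ, e⟩, e'⟩
      refine ⟨γ, hγ, (assoc P Q R).injective (Subtype.ext (Prod.ext e e'.symm))⟩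
    · rintro ⟨γ, hγ, rfl⟩
      exact ⟨⟨γ, hγ, rfl⟩, rfl⟩

theorem equivariant_toLeft :
    (actRight P Q R).Equivariant (FibProd.diag B.toCorr R) (toLeft B) where
  mom t := B.rmom_proj (fst P Q R t)
  act _ _ := Subtype.ext (Prod.ext (B.right_act_proj _ _) rfl)

end

variable (P Q R) in
/-- The measure `∫∫ α (lmom y) dβ (lmom z) dρ_a(z)` on the triple product. -/
noncomputable def meas (a : L.Obj) : Measure (TripProd P Q R) :=
  P.str.meas_family.pullbackMeasure P.str.continuous_rmom (continuous_lmom_fst Q R)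
    (FibProd.meas Q R a)

/-- Extension of a function on the triple product by zero. -/
noncomputable def extend (f : TripProd P Q R → ℝ≥0∞) (x : P.carrier) (q : FibProd Q R) : ℝ≥0∞ :=
  if h : P.str.rmom x = Q.str.lmom q.1.1 then f ⟨(x, q), h⟩ else 0

theorem extend_eq {f : TripProd P Q R → ℝ≥0∞} {x : P.carrier} {q : FibProd Q R}
    (h : P.str.rmom x = Q.str.lmom q.1.1) : extend f x q = f ⟨(x, q), h⟩ := dif_pos h

theorem measurable_extend {f : TripProd P Q R → ℝ≥0∞} (hf : Measurable f) :
    Measurable fun w : P.carrier × FibProd Q R => extend f w.1 w.2 :=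
  IsMeasureFamily.measurable_extend_pullback P.str.continuous_rmom (continuous_lmom_fst Q R) hf

theorem lintegral_meas {f : TripProd P Q R → ℝ≥0∞} (hf : Measurable f) (a : L.Obj) :
    ∫⁻ t, f t ∂meas P Q R a = ∫⁻ q, ∫⁻ x, extend f x q ∂P.str.meas (Q.str.lmom q.1.1)
      ∂FibProd.meas Q R a :=
  IsMeasureFamily.lintegral_pullbackMeasure_dite _ _ _ _ hf

theorem measurable_lintegral_extend {f : TripProd P Q R → ℝ≥0∞} (hf : Measurable f) :
    Measurable fun q => ∫⁻ x, extend f x q ∂P.str.meas (Q.str.lmom q.1.1) :=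
  P.str.meas_family.measurable_lintegral P.str.continuous_rmom (continuous_lmom_fst Q R)
    ((measurable_extend hf).comp measurable_swap)

/-- The action of `K` does not involve `x`. The lift of the measures of `A` is applied to functions
already integrated over `x`, and Fubini interchanges `x` with the orbit variable. -/
theorem isLift_toRight (A : Composite Q R) {b : FibProd Q R → ℝ} (hb : FibProd.IsCochain b)
    {a : L.Obj} (h : (FibProd.diag Q R).IsLift (CompSpace.proj Q R) (A.meas a)
      ((FibProd.meas Q R a).withDensity fun q => ENNReal.ofReal (b q))) :
    (actRight P Q R).IsLift (toRight A) (FibProd.meas P A.toCorr a)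
      ((meas P Q R a).withDensity fun t => ENNReal.ofReal (b t.1.2)) := by
  intro f hf F hF
  have hFm := (isQuot_toRight A).measurable_of_avg hf hF
  have hbm := hb.measurable.ennreal_ofReal
  have hbm' : Measurable fun t : TripProd P Q R => ENNReal.ofReal (b t.1.2) :=
    hbm.comp (measurable_snd.comp measurable_subtype_coe)
  have hψ := measurable_lintegral_extend hf
  rw [FibProd.lintegral_meas hFm, lintegral_withDensity_mul hbm' hf,
    lintegral_meas (f := fun t => ENNReal.ofReal (b t.1.2) * f t) (hbm'.mul hf)]
  refine (h _ hψ (fun ω => ∫⁻ x, FibProd.extend (P := P) (Q := A.toCorr) F x ω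
    ∂P.str.meas (A.lmom ω)) fun q => ?_).trans ?_
  · rw [A.lmom_proj]
    have := K.haar_family.finiteOnCompacts ((FibProd.diag Q R).mom q)
    calc ∫⁻ x, FibProd.extend (P := P) (Q := A.toCorr) F x (CompSpace.proj Q R q)
          ∂P.str.meas (Q.str.lmom q.1.1)
        = ∫⁻ x, ∫⁻ k, extend f x ((FibProd.diag Q R).act q k)
            ∂K.haar ((FibProd.diag Q R).mom q) ∂P.str.meas (Q.str.lmom q.1.1) := by
          refine lintegral_congr_ae ?_
          filter_upwards [P.ae_rmom (Q.str.lmom q.1.1)] with x hx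
          have e : FibProd.extend (P := P) (Q := A.toCorr) F x (CompSpace.proj Q R q) =
              F (toRight A ⟨(x, q), hx⟩) := FibProd.extend_eq (toRight A ⟨(x, q), hx⟩).2
          rw [e, hF]
          refine lintegral_congr fun k => ?_
          exact (extend_eq ((actRight P Q R).act ⟨(x, q), hx⟩ k).2).symm
      _ = ∫⁻ k, ∫⁻ x, extend f x ((FibProd.diag Q R).act q k)
            ∂P.str.meas (Q.str.lmom q.1.1) ∂K.haar ((FibProd.diag Q R).mom q) :=
          lintegral_lintegral_swap (f := fun x k => extend f x ((FibProd.diag Q R).act q k))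
            ((measurable_extend hf).comp (measurable_fst.prodMk
              (((FibProd.diag Q R).measurable_act_left q).comp measurable_snd))).aemeasurable
      _ = _ := by
          refine lintegral_congr fun k => ?_
          show _ = ∫⁻ x, extend f x ((FibProd.diag Q R).act q k)
            ∂P.str.meas (Q.str.lmom ((FibProd.diag Q R).act q k).1.1)
          rw [show Q.str.lmom ((FibProd.diag Q R).act q k).1.1 = Q.str.lmom q.1.1 from
            Corr.lmom_right_act _ _]
  · rw [lintegral_withDensity_mul hbm hψ]
    refine lintegral_congr fun q => ?_
    rw [← lintegral_const_mul _ (f := fun x => extend f x q)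
      ((measurable_extend hf).comp measurable_prodMk_right)]
    refine lintegral_congr_ae ?_
    filter_upwards [P.ae_rmom (Q.str.lmom q.1.1)] with x hx
    rw [extend_eq hx, extend_eq hx]

/-- The lift of `B.meas` is applied for each fixed `z`, at the unit `lmom z`; this is why the
hypothesis is needed at every unit `c`. -/
theorem isLift_toLeft (B : Composite P Q) {b : FibProd P Q → ℝ} (hb : FibProd.IsCochain b)
    (h : ∀ c, (FibProd.diag P Q).IsLift (CompSpace.proj P Q) (B.meas c)
      ((FibProd.meas P Q c).withDensity fun q => ENNReal.ofReal (b q))) (a : L.Obj) :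
    (actLeft P Q R).IsLift (toLeft B) (FibProd.meas B.toCorr R a)
      ((meas P Q R a).withDensity fun t => ENNReal.ofReal (b (fst P Q R t))) := by
  intro f hf F hF
  have hFm := (isQuot_toLeft B).measurable_of_avg hf hF
  have hbm := hb.measurable.ennreal_ofReal
  have hbm' : Measurable fun t : TripProd P Q R => ENNReal.ofReal (b (fst P Q R t)) :=
    hbm.comp (measurable_fst.comp (measurable_subtype_coe.comp
      (assoc P Q R).continuous.measurable))
  have hbf : Measurable fun t => ENNReal.ofReal (b (fst P Q R t)) * f t := hbm'.mul hf
  have hψ := measurable_lintegral_extend hbf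
  rw [FibProd.lintegral_meas hFm, lintegral_withDensity_mul hbm' hf,
    lintegral_meas (f := fun t => ENNReal.ofReal (b (fst P Q R t)) * f t) hbf,
    FibProd.lintegral_meas hψ]
  refine lintegral_congr fun z => ?_
  -- The condition that `(p, z)` is composable does not change along the orbit of `p`, so extension
  -- by zero commutes with orbit averages.
  let ψ : FibProd P Q → ℝ≥0∞ := fun p => if h : Q.str.rmom p.1.2 = R.str.lmom z then
    f ((assoc P Q R).symm ⟨(p, z), h⟩) else 0
  have hψm : Measurable ψ :=
    (IsMeasureFamily.measurable_extend_pullback (continuous_rmom_snd P Q) R.str.continuous_lmom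
      (f := fun s => f ((assoc P Q R).symm s))
      (hf.comp (assoc P Q R).symm.continuous.measurable)).comp measurable_prodMk_right
  have hψF : ∀ p, FibProd.extend (P := B.toCorr) (Q := R) F (CompSpace.proj P Q p) z =
      (FibProd.diag P Q).avg ψ p := by
    intro p
    by_cases hp : Q.str.rmom p.1.2 = R.str.lmom z
    · have e : FibProd.extend (P := B.toCorr) (Q := R) F (CompSpace.proj P Q p) z =
          F (toLeft B ((assoc P Q R).symm ⟨(p, z), hp⟩)) :=
        FibProd.extend_eq (toLeft B ((assoc P Q R).symm ⟨(p, z), hp⟩)).2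
      rw [e, hF]
      refine lintegral_congr fun γ => ?_
      have h' : Q.str.rmom ((FibProd.diag P Q).act p γ).1.2 = R.str.lmom z :=
        (Corr.rmom_left_act _ _).trans hp
      have e' : ψ ((FibProd.diag P Q).act p γ) =
        f ((assoc P Q R).symm ⟨((FibProd.diag P Q).act p γ, z), h'⟩) := dif_pos h'
      exact e'.symm
    · have e : FibProd.extend (P := B.toCorr) (Q := R) F (CompSpace.proj P Q p) z = 0 :=
        dif_neg fun hn => hp ((B.rmom_proj p).symm.trans hn)
      rw [e]
      refine ((lintegral_congr fun γ => ?_).trans lintegral_zero).symm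
      exact dif_neg fun hn => hp ((Corr.rmom_left_act _ _).symm.trans hn)
  refine (h _ ψ hψm _ hψF).trans ?_
  rw [lintegral_withDensity_mul hbm hψm, FibProd.lintegral_meas
    (f := fun p => ENNReal.ofReal (b p) * ψ p) (hbm.mul hψm)]
  refine lintegral_congr_ae ?_
  filter_upwards [Q.ae_rmom (R.str.lmom z)] with y hy
  rw [FibProd.extend_eq hy]
  refine lintegral_congr_ae ?_
  filter_upwards [P.ae_rmom (Q.str.lmom y)] with x hx
  rw [FibProd.extend_eq hx, extend_eq hx, show ψ ⟨(x, y), hx⟩ = _ from dif_pos hy]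
  rfl

end TripProd

/-! ### The associativity isomorphism -/

section Associator

open scoped ENNReal

variable {G H K L : HaarGroupoid.{u}} {P : Corr G H} {Q : Corr H K} {R : Corr K L}
  (A : Composite Q R) (B : Composite P Q)

/-- The map `[x, [y, z]] ↦ [[x, y], z]`. -/
noncomputable def CompSpace.assocInv : CompSpace P A.toCorr ≃ₜ CompSpace B.toCorr R :=
  homeomorphOfIsQuotientMap
    ((CompSpace.isQuot P A.toCorr).isOpenQuotientMap.comp
      (TripProd.isQuot_toRight A).isOpenQuotientMap).isQuotientMap
    ((CompSpace.isQuot B.toCorr R).isOpenQuotientMap.comp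
      (TripProd.isQuot_toLeft B).isOpenQuotientMap).isQuotientMap fun t t' => by
    -- The fibres of both composed quotient maps are the orbits of the joint action of `H` and `K`
    -- on the triple product.
    refine ((TripProd.commute P Q R).comp_eq_iff (TripProd.isQuot_toRight A)
      (TripProd.equivariant_toRight A) (CompSpace.isQuot P A.toCorr)).trans (Iff.trans ?_
      ((TripProd.commute P Q R).symm.comp_eq_iff (TripProd.isQuot_toLeft B)
      (TripProd.equivariant_toLeft B) (CompSpace.isQuot B.toCorr R)).symm)
    rw [exists_comm]
    refine exists_congr fun k => exists_congr fun γ => ?_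
    rw [(TripProd.commute P Q R).act_act]
    exact and_left_comm

theorem CompSpace.assocInv_proj (t : TripProd P Q R) :
    CompSpace.assocInv A B (CompSpace.proj P A.toCorr (TripProd.toRight A t)) =
      CompSpace.proj B.toCorr R (TripProd.toLeft B t) :=
  homeomorphOfIsQuotientMap_apply _ _ _ _

theorem CompSpace.surjective_proj_toRight : Function.Surjective fun t : TripProd P Q R =>
    CompSpace.proj P A.toCorr (TripProd.toRight A t) :=
  CompSpace.surjective_proj.comp (TripProd.isQuot_toRight A).isOpenQuotientMap.surjective

theorem FibProd.isQuot_assocInv : (FibProd.diag P A.toCorr).IsQuot fun w =>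
    CompSpace.assocInv A B (CompSpace.proj P A.toCorr w) where
  isOpenQuotientMap := (CompSpace.assocInv A B).isOpenQuotientMap.comp
    (CompSpace.isQuot P A.toCorr).isOpenQuotientMap
  eq_iff := (CompSpace.assocInv A B).injective.eq_iff.trans (CompSpace.isQuot P A.toCorr).eq_iff

theorem TripProd.continuous_fst : Continuous (fst P Q R) :=
  _root_.continuous_fst.comp (continuous_subtype_val.comp (assoc P Q R).continuous)

/-- The measures of `E` lift in two steps to the triple product, with weight `bB · b₁`, whereas the
product measures for `P` and `A` lift with weight `bA`. Under `K` the cochains `b₁` and `bA` both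
change by the adjoining function of `R` at the same point and `bB` is invariant, so `bB · b₁ / bA`
descends to a weight `D`. Exchanging the order of the quotients then gives the claim. -/
theorem FibProd.exists_isLift_assocInv (E : Composite B.toCorr R) :
    ∃ D : FibProd P A.toCorr → ℝ, Continuous D ∧ (∀ w, 0 < D w) ∧ ∀ a,
      (FibProd.diag P A.toCorr).IsLift
        (fun w => CompSpace.assocInv A B (CompSpace.proj P A.toCorr w)) (E.meas a)
        ((FibProd.meas P A.toCorr a).withDensity fun w => ENNReal.ofReal (D w)) := by
  obtain ⟨b₁, hb₁, h₁⟩ := E.exists_isLift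
  obtain ⟨bA, hbA, hA⟩ := A.exists_isLift
  obtain ⟨bB, hbB, hB⟩ := B.exists_isLift
  obtain ⟨e, -, -, -, he⟩ := FibProd.exists_cutoff Q R
  have hR := TripProd.isQuot_toRight (P := P) A
  have hL := TripProd.isQuot_toLeft (R := R) B
  have hRc : Continuous (TripProd.toRight (P := P) A) := hR.isOpenQuotientMap.continuous
  have hLc : Continuous (TripProd.toLeft (R := R) B) := hL.isOpenQuotientMap.continuous
  have c₁ : Continuous fun t : TripProd P Q R => b₁ (TripProd.toLeft B t) :=
    hb₁.continuous.comp hLc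
  have c₂ : Continuous fun t : TripProd P Q R => bB (TripProd.fst P Q R t) :=
    hbB.continuous.comp TripProd.continuous_fst
  have c₃ : Continuous fun t : TripProd P Q R => bA t.1.2 :=
    hbA.continuous.comp (continuous_snd.comp continuous_subtype_val)
  obtain ⟨D, hD, hDe⟩ := hR.exists_continuous_descend
    (φ := fun t => bB (TripProd.fst P Q R t) * b₁ (TripProd.toLeft B t) / bA t.1.2)
    ((c₂.mul c₁).div c₃ fun t => (hbA.pos _).ne') fun t k hk => by
      have e₁ : bB (TripProd.fst P Q R ((TripProd.actRight P Q R).act t k)) =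
        bB (TripProd.fst P Q R t) := hbB.right_act (TripProd.fst P Q R t) k
      have e₂ : b₁ (TripProd.toLeft B ((TripProd.actRight P Q R).act t k)) =
          b₁ (TripProd.toLeft B t) * (R.dens t.1.2.1.2 k)⁻¹ := by
        rw [← (TripProd.equivariant_toLeft B).act]
        exact hb₁.diag_act (TripProd.toLeft B t) k
          (((TripProd.equivariant_toLeft B).mom t).trans hk)
      have e₃ : bA ((TripProd.actRight P Q R).act t k).1.2 = bA t.1.2 * (R.dens t.1.2.1.2 k)⁻¹ :=
        hbA.diag_act t.1.2 k hk
      rw [e₁, e₂, e₃, ← mul_assoc, mul_div_mul_right _ _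
        (inv_ne_zero (Corr.dens_pos (P := R) _ _).ne')]
  have hpos : ∀ w, 0 < D w := fun w => by
    obtain ⟨t, rfl⟩ := hR.isOpenQuotientMap.surjective w
    rw [hDe]
    exact div_pos (mul_pos (hbB.pos _) (hb₁.pos _)) (hbA.pos _)
  refine ⟨D, hD, hpos, fun a => ?_⟩
  have hκ : (TripProd.actRight P Q R).IsCutoff fun t => ENNReal.ofReal (e t.1.2.1.1) :=
    ⟨he.measurable.comp (measurable_snd.comp measurable_subtype_coe), fun t => he.avg_eq_one t.1.2⟩
  have c₄ : Continuous fun t : TripProd P Q R => D (TripProd.toRight A t) := hD.comp hRc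
  have l₁ := (TripProd.isLift_toLeft (R := R) B hbB hB a).withDensity hL
    hb₁.measurable.ennreal_ofReal
  have l₂ := (TripProd.isLift_toRight (P := P) A hbA (hA a)).withDensity hR
    hD.measurable.ennreal_ofReal
  refine RAct.IsLift.exchange (TripProd.commute P Q R) hR (TripProd.equivariant_toRight A) hL
    (TripProd.equivariant_toLeft B) (fun t => (CompSpace.assocInv_proj A B t).symm) hκ (h₁ a) l₁ ?_
  convert l₂ using 1
  rw [← withDensity_mul _ c₂.measurable.ennreal_ofReal c₁.measurable.ennreal_ofReal,
    ← withDensity_mul _ c₃.measurable.ennreal_ofReal c₄.measurable.ennreal_ofReal]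
  congr 1
  funext t
  rw [Pi.mul_apply, Pi.mul_apply, ← ENNReal.ofReal_mul (hbB.pos _).le,
    ← ENNReal.ofReal_mul (hbA.pos _).le, hDe,
    mul_div_cancel₀ _ (hbA.pos _).ne']

/-- The inverse associativity isomorphism `[x, [y, z]] ↦ [[x, y], z]`. -/
noncomputable def CorrIso.assocInv (C : Composite P A.toCorr) (E : Composite B.toCorr R) :
    CorrIso C.toCorr E.toCorr :=
  CorrIso.ofAct (P := C.toCorr) (Q := E.toCorr) (CompSpace.assocInv A B)
    (fun ω => by
      obtain ⟨t, rfl⟩ := CompSpace.surjective_proj_toRight A ω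
      beta_reduce
      rw [CompSpace.assocInv_proj]
      exact (E.lmom_proj (TripProd.toLeft B t)).trans ((B.lmom_proj (TripProd.fst P Q R t)).trans
        (C.lmom_proj (TripProd.toRight A t)).symm))
    (fun ω => by
      obtain ⟨t, rfl⟩ := CompSpace.surjective_proj_toRight A ω
      beta_reduce
      rw [CompSpace.assocInv_proj]
      exact (E.rmom_proj (TripProd.toLeft B t)).trans ((A.rmom_proj t.1.2).symm.trans
        (C.rmom_proj (TripProd.toRight A t)).symm))
    (fun ω g => by
      obtain ⟨t, rfl⟩ := CompSpace.surjective_proj_toRight A ω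
      beta_reduce
      rw [C.left_act_proj, CompSpace.assocInv_proj, E.left_act_proj]
      refine (CompSpace.assocInv_proj A B ⟨(P.left.act t.1.1 g, t.1.2),
        (Corr.rmom_left_act _ _).trans t.2⟩).trans (congrArg (CompSpace.proj B.toCorr R) ?_)
      exact Subtype.ext (Prod.ext (B.left_act_proj (TripProd.fst P Q R t) g).symm rfl))
    (fun ω k => by
      obtain ⟨t, rfl⟩ := CompSpace.surjective_proj_toRight A ω
      beta_reduce
      rw [C.right_act_proj, CompSpace.assocInv_proj, E.right_act_proj]
      refine Eq.trans ?_ (CompSpace.assocInv_proj A B ⟨(t.1.1, (FibProd.right Q R).act t.1.2 k),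
        t.2⟩)
      refine congrArg (fun w => CompSpace.assocInv A B (CompSpace.proj P A.toCorr w)) ?_
      exact Subtype.ext (Prod.ext rfl (A.right_act_proj t.1.2 k)))
    (by
      obtain ⟨D, hD, hpos, h⟩ := FibProd.exists_isLift_assocInv A B E
      exact C.contEquivalent (FibProd.isQuot_assocInv A B)
        (CompSpace.assocInv A B).continuous.measurable (fun _ => rfl) hD hpos h)

end Associator

/-! ### Coherence -/

section Coherence

variable {G H K L M : HaarGroupoid.{u}}

theorem CompSpace.mk_congr {P : Corr G H} {Q : Corr H K} {x x' : P.carrier} {y y' : Q.carrier}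
    (hx : x = x') (hy : y = y') (h : P.str.rmom x = Q.str.lmom y)
    (h' : P.str.rmom x' = Q.str.lmom y') : CompSpace.mk P Q x y h = CompSpace.mk P Q x' y' h' := by
  subst hx hy
  rfl

theorem CompSpace.exists_eq_mk {P : Corr G H} {Q : Corr H K} (ω : CompSpace P Q) :
    ∃ x y h, ω = CompSpace.mk P Q x y h := by
  obtain ⟨⟨⟨x, y⟩, h⟩, rfl⟩ := CompSpace.surjective_proj ω
  exact ⟨x, y, h, rfl⟩

/-- The associativity isomorphism `[[x, y], z] ↦ [x, [y, z]]`. -/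
noncomputable def CorrIso.assoc {P : Corr G H} {Q : Corr H K} {R : Corr K L} (A : Composite Q R)
    (B : Composite P Q) (C : Composite P A.toCorr) (E : Composite B.toCorr R) :
    E.toCorr ≅ C.toCorr :=
  (CorrIso.assocInv A B C E).toIso.symm

theorem mapOf_hcomp_mk {P P' : Corr G H} {Q Q' : Corr H K} (R : Composite P Q)
    (R' : Composite P' Q') (η : P ⟶ P') (θ : Q ⟶ Q') (x : P.carrier) (y : Q.carrier)
    (h : P.str.rmom x = Q.str.lmom y) (h' : P'.str.rmom (mapOf η x) = Q'.str.lmom (mapOf θ y)) :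
    mapOf (P := R.toCorr) (Q := R'.toCorr) (CorrIso.hcomp R R' η θ) (CompSpace.mk P Q x y h) =
      CompSpace.mk P' Q' (mapOf η x) (mapOf θ y) h' :=
  CompSpace.map_proj η θ ⟨(x, y), h⟩

theorem mapOf_assoc_mk {P : Corr G H} {Q : Corr H K} {R : Corr K L} (A : Composite Q R)
    (B : Composite P Q) (C : Composite P A.toCorr) (E : Composite B.toCorr R) (x : P.carrier)
    (y : Q.carrier) (z : R.carrier) (h₁ : P.str.rmom x = Q.str.lmom y)
    (h₂ : B.rmom (CompSpace.mk P Q x y h₁) = R.str.lmom z) (h₃ : Q.str.rmom y = R.str.lmom z)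
    (h₄ : P.str.rmom x = A.lmom (CompSpace.mk Q R y z h₃)) :
    mapOf (CorrIso.assoc A B C E).hom
        (CompSpace.mk B.toCorr R (CompSpace.mk P Q x y h₁) z h₂) =
      CompSpace.mk P A.toCorr x (CompSpace.mk Q R y z h₃) h₄ :=
  (CompSpace.assocInv A B).symm_apply_eq.2
    (CompSpace.assocInv_proj A B ⟨(x, ⟨(y, z), h₃⟩), h₁⟩).symm

theorem mapOf_lunit_mk {P : Corr G H} (I : IdCorr G) (R : Composite I.toCorr P) (γ : G.Arr)
    (x : P.carrier) (h : I.rmom γ = P.str.lmom x) (h' : G.src γ = P.str.lmom x) :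
    mapOf (CorrIso.lunit I R).toIso.hom (CompSpace.mk I.toCorr P γ x h) =
      P.str.lact ⟨(γ, x), h'⟩ :=
  (CompSpace.lmul_proj I ⟨(γ, x), h⟩).trans (Corr.lact_eq_left_act h').symm

theorem mapOf_runit_mk {P : Corr G H} (I : IdCorr H) (R : Composite P I.toCorr) (x : P.carrier)
    (γ : H.Arr) (h : P.str.rmom x = I.lmom γ) (h' : P.str.rmom x = H.rng γ) :
    mapOf (CorrIso.runit I R).toIso.hom (CompSpace.mk P I.toCorr x γ h) =
      P.str.ract ⟨(x, γ), h'⟩ :=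
  (CompSpace.rmul_proj I ⟨(x, γ), h⟩).trans (Corr.right_act_eq h')

theorem mapOf_mem {P P' : Corr G H} {Q Q' : Corr H K} (η : P ⟶ P') (θ : Q ⟶ Q')
    {x : P.carrier} {y : Q.carrier} (h : P.str.rmom x = Q.str.lmom y) :
    P'.str.rmom (mapOf η x) = Q'.str.lmom (mapOf θ y) :=
  (CorrIso.rmom_map η x).trans (h.trans (CorrIso.lmom_map θ y).symm)

theorem CorrIso.hcomp_id {P : Corr G H} {Q : Corr H K} (R : Composite P Q) :
    CorrIso.hcomp R R (𝟙 P : P ⟶ P) (𝟙 Q : Q ⟶ Q) = (𝟙 R.toCorr : R.toCorr ⟶ R.toCorr) := by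
  refine CorrIso.ext fun ω => ?_
  obtain ⟨x, y, h, rfl⟩ := CompSpace.exists_eq_mk ω
  exact mapOf_hcomp_mk R R (𝟙 P) (𝟙 Q) x y h h

theorem CorrIso.hcomp_comp {P P' P'' : Corr G H} {Q Q' Q'' : Corr H K} (R : Composite P Q)
    (R' : Composite P' Q') (R'' : Composite P'' Q'') (η : P ⟶ P') (η' : P' ⟶ P'') (θ : Q ⟶ Q')
    (θ' : Q' ⟶ Q'') :
    CorrIso.hcomp R R'' (η ≫ η') (θ ≫ θ') =
      CategoryStruct.comp (X := R.toCorr) (Y := R'.toCorr) (Z := R''.toCorr)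
        (CorrIso.hcomp R R' η θ) (CorrIso.hcomp R' R'' η' θ') := by
  refine CorrIso.ext fun ω => ?_
  obtain ⟨x, y, h, rfl⟩ := CompSpace.exists_eq_mk ω
  have h' := mapOf_mem η θ h
  refine (mapOf_hcomp_mk R R'' (η ≫ η') (θ ≫ θ') x y h (mapOf_mem η' θ' h')).trans ?_
  refine ((congrArg (mapOf (P := R'.toCorr) (Q := R''.toCorr) (CorrIso.hcomp R' R'' η' θ'))
    (mapOf_hcomp_mk R R' η θ x y h h')).trans ?_).symm
  exact mapOf_hcomp_mk R' R'' η' θ' _ _ h' _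

theorem CorrIso.lunit_naturality {P P' : Corr G H} (I : IdCorr G) (R : Composite I.toCorr P)
    (R' : Composite I.toCorr P') (η : P ⟶ P') :
    CategoryStruct.comp (X := R.toCorr) (Y := R'.toCorr) (CorrIso.hcomp R R' (𝟙 I.toCorr) η)
      (CorrIso.lunit I R').toIso.hom = (CorrIso.lunit I R).toIso.hom ≫ η := by
  refine CorrIso.ext fun ω => ?_
  obtain ⟨γ, x, h, rfl⟩ := CompSpace.exists_eq_mk ω
  have h' := mapOf_mem (𝟙 I.toCorr) η h
  have k : G.src γ = P.str.lmom x := (I.rmom_eq γ).symm.trans h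
  have k' : G.src γ = P'.str.lmom (mapOf η x) := (I.rmom_eq γ).symm.trans h'
  refine ((congrArg (mapOf (CorrIso.lunit I R').toIso.hom)
    (mapOf_hcomp_mk R R' (𝟙 I.toCorr) η γ x h h')).trans
      (mapOf_lunit_mk I R' γ (mapOf η x) h' k')).trans ?_
  exact ((congrArg (mapOf η) (mapOf_lunit_mk I R γ x h k)).trans
    (CorrIso.lact_map η γ x k k')).symm

theorem CorrIso.runit_naturality {P P' : Corr G H} (I : IdCorr H) (R : Composite P I.toCorr)
    (R' : Composite P' I.toCorr) (η : P ⟶ P') :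
    CategoryStruct.comp (X := R.toCorr) (Y := R'.toCorr) (CorrIso.hcomp R R' η (𝟙 I.toCorr))
      (CorrIso.runit I R').toIso.hom = (CorrIso.runit I R).toIso.hom ≫ η := by
  refine CorrIso.ext fun ω => ?_
  obtain ⟨x, γ, h, rfl⟩ := CompSpace.exists_eq_mk ω
  have h' := mapOf_mem η (𝟙 I.toCorr) h
  have k : P.str.rmom x = H.rng γ := h.trans (I.lmom_eq γ)
  have k' : P'.str.rmom (mapOf η x) = H.rng γ := h'.trans (I.lmom_eq γ)
  refine ((congrArg (mapOf (CorrIso.runit I R').toIso.hom)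
    (mapOf_hcomp_mk R R' η (𝟙 I.toCorr) x γ h h')).trans
      (mapOf_runit_mk I R' (mapOf η x) γ h' k')).trans ?_
  exact ((congrArg (mapOf η) (mapOf_runit_mk I R x γ h k)).trans
    (CorrIso.ract_map η x γ k k')).symm

theorem CompSpace.rmom_eq_lmom_of_mk {P : Corr G H} {Q : Corr H K} {R : Corr K L}
    (B : Composite P Q) {x : P.carrier} {y : Q.carrier} {z : R.carrier}
    {h₁ : P.str.rmom x = Q.str.lmom y} (h₂ : B.rmom (CompSpace.mk P Q x y h₁) = R.str.lmom z) :
    Q.str.rmom y = R.str.lmom z := (B.rmom_mk x y h₁).symm.trans h₂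

theorem CompSpace.rmom_eq_lmom_mk {P : Corr G H} {Q : Corr H K} {R : Corr K L}
    (A : Composite Q R) {x : P.carrier} {y : Q.carrier} {z : R.carrier}
    (h₁ : P.str.rmom x = Q.str.lmom y) (h₃ : Q.str.rmom y = R.str.lmom z) :
    P.str.rmom x = A.lmom (CompSpace.mk Q R y z h₃) := h₁.trans (A.lmom_mk y z h₃).symm

theorem CompSpace.rmom_mk_eq_lmom {P : Corr G H} {Q : Corr H K} {R : Corr K L}
    (B : Composite P Q) {x : P.carrier} {y : Q.carrier} {z : R.carrier}
    (h₁ : P.str.rmom x = Q.str.lmom y) (h₃ : Q.str.rmom y = R.str.lmom z) :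
    B.rmom (CompSpace.mk P Q x y h₁) = R.str.lmom z := (B.rmom_mk x y h₁).trans h₃

theorem CorrIso.assoc_naturality {P P' : Corr G H} {Q Q' : Corr H K} {R R' : Corr K L}
    (A : Composite Q R) (B : Composite P Q) (C : Composite P A.toCorr) (E : Composite B.toCorr R)
    (A' : Composite Q' R') (B' : Composite P' Q') (C' : Composite P' A'.toCorr)
    (E' : Composite B'.toCorr R') (η : P ⟶ P') (θ : Q ⟶ Q') (κ : R ⟶ R') :
    CategoryStruct.comp (X := E.toCorr) (Y := E'.toCorr)
        (CorrIso.hcomp E E' (CorrIso.hcomp B B' η θ) κ) (CorrIso.assoc A' B' C' E').hom =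
      CategoryStruct.comp (Z := C'.toCorr) (CorrIso.assoc A B C E).hom
        (CorrIso.hcomp C C' η (CorrIso.hcomp A A' θ κ)) := by
  let ηθ : B.toCorr ⟶ B'.toCorr := CorrIso.hcomp B B' η θ
  let θκ : A.toCorr ⟶ A'.toCorr := CorrIso.hcomp A A' θ κ
  refine CorrIso.ext fun ω => ?_
  obtain ⟨w, z, h₂, rfl⟩ := CompSpace.exists_eq_mk ω
  obtain ⟨x, y, h₁, rfl⟩ := CompSpace.exists_eq_mk w
  have h₃ := CompSpace.rmom_eq_lmom_of_mk B h₂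
  have h₄ := CompSpace.rmom_eq_lmom_mk A h₁ h₃
  have k₁ := mapOf_mem η θ h₁
  have k₃ := mapOf_mem θ κ h₃
  have k₂ := CompSpace.rmom_mk_eq_lmom B' k₁ k₃
  have k₄ := CompSpace.rmom_eq_lmom_mk A' k₁ k₃
  refine (congrArg (mapOf (CorrIso.assoc A' B' C' E').hom) ((mapOf_hcomp_mk E E' ηθ κ _ z h₂
    (mapOf_mem ηθ κ h₂)).trans (CompSpace.mk_congr (mapOf_hcomp_mk B B' η θ x y h₁ k₁)
      rfl _ k₂))).trans ((mapOf_assoc_mk A' B' C' E' _ _ _ k₁ k₂ k₃ k₄).trans ?_)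
  refine ((congrArg (mapOf (P := C.toCorr) (Q := C'.toCorr) (CorrIso.hcomp C C' η θκ))
    (mapOf_assoc_mk A B C E x y z h₁ h₂ h₃ h₄)).trans ?_).symm
  exact (mapOf_hcomp_mk C C' η θκ x _ h₄ (mapOf_mem η θκ h₄)).trans
    (CompSpace.mk_congr rfl (mapOf_hcomp_mk A A' θ κ y z h₃ k₃) _ k₄)

/-- On `[[x, γ], y]` the two sides give `[x, γ y]` and `[x γ, y]`, which are one point of the orbit
space because `γ` moves the first representative to the second. -/
theorem CorrIso.triangle {P : Corr G H} {Q : Corr H K} (I : IdCorr H) (A : Composite I.toCorr Q)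
    (B : Composite P I.toCorr) (C : Composite P A.toCorr) (E : Composite B.toCorr Q)
    (F : Composite P Q) :
    CategoryStruct.comp (Z := F.toCorr) (CorrIso.assoc A B C E).hom
        (CorrIso.hcomp C F (𝟙 P) (CorrIso.lunit I A).toIso.hom) =
      CorrIso.hcomp E F (CorrIso.runit I B).toIso.hom (𝟙 Q) := by
  refine CorrIso.ext fun ω => ?_
  obtain ⟨w, y, h₂, rfl⟩ := CompSpace.exists_eq_mk ω
  obtain ⟨x, γ, h₁, rfl⟩ := CompSpace.exists_eq_mk w
  have h₃ := CompSpace.rmom_eq_lmom_of_mk B h₂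
  have h₄ := CompSpace.rmom_eq_lmom_mk A h₁ h₃
  have kx : P.str.rmom x = H.rng γ := h₁.trans (I.lmom_eq γ)
  have ky : H.src γ = Q.str.lmom y := (I.rmom_eq γ).symm.trans h₃
  have h₅ : P.str.rmom x = Q.str.lmom (Q.str.lact ⟨(γ, y), ky⟩) := by rw [Q.str.lmom_lact, kx]
  have h₆ : P.str.rmom (P.str.ract ⟨(x, γ), kx⟩) = Q.str.lmom y := by rw [P.str.rmom_ract, ky]
  refine ((congrArg (mapOf (P := C.toCorr) (Q := F.toCorr) (CorrIso.hcomp C F (𝟙 P) _))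
    (mapOf_assoc_mk A B C E x γ y h₁ h₂ h₃ h₄)).trans
      ((mapOf_hcomp_mk C F (𝟙 P) (CorrIso.lunit I A).toIso.hom x _ h₄
        (mapOf_mem (𝟙 P) (CorrIso.lunit I A).toIso.hom h₄)).trans
        (CompSpace.mk_congr rfl (mapOf_lunit_mk I A γ y h₃ ky) _ h₅))).trans ?_
  refine Eq.trans (Quotient.sound ⟨γ, kx, ?_⟩) ((mapOf_hcomp_mk E F (CorrIso.runit I B).toIso.hom
    (𝟙 Q) _ y h₂ (mapOf_mem (CorrIso.runit I B).toIso.hom (𝟙 Q) h₂)).trans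
      (CompSpace.mk_congr (mapOf_runit_mk I B x γ h₁ kx) rfl _ h₆)).symm
  exact (eq_diagAct_iff _ _ γ kx ky).2 ⟨rfl, rfl⟩

/-- Both sides send `[[[x, y], z], s]` to `[x, [y, [z, s]]]` on the same representatives; no choice
of arrow intervenes. -/
theorem CorrIso.pentagon {P : Corr G H} {Q : Corr H K} {R : Corr K L} {S : Corr L M}
    (PQ : Composite P Q) (QR : Composite Q R) (RS : Composite R S)
    (PQ_R : Composite PQ.toCorr R) (P_QR : Composite P QR.toCorr) (QR_S : Composite QR.toCorr S)
    (Q_RS : Composite Q RS.toCorr) (PQ_RS : Composite PQ.toCorr RS.toCorr)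
    (P_Q_RS : Composite P Q_RS.toCorr) (P_QR_S : Composite P QR_S.toCorr)
    (PQR_S : Composite PQ_R.toCorr S) (PQR_S' : Composite P_QR.toCorr S) :
    CategoryStruct.comp (X := PQR_S.toCorr) (Y := PQR_S'.toCorr) (Z := P_Q_RS.toCorr)
        (CorrIso.hcomp PQR_S PQR_S' (CorrIso.assoc QR PQ P_QR PQ_R).hom (𝟙 S))
        (CategoryStruct.comp (CorrIso.assoc QR_S P_QR P_QR_S PQR_S').hom
          (CorrIso.hcomp P_QR_S P_Q_RS (𝟙 P) (CorrIso.assoc RS QR Q_RS QR_S).hom)) =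
      (CorrIso.assoc RS PQ_R PQ_RS PQR_S).hom ≫ (CorrIso.assoc Q_RS PQ P_Q_RS PQ_RS).hom := by
  refine CorrIso.ext fun ω => ?_
  obtain ⟨v, s, h₃, rfl⟩ := CompSpace.exists_eq_mk ω
  obtain ⟨w, z, h₂, rfl⟩ := CompSpace.exists_eq_mk v
  obtain ⟨x, y, h₁, rfl⟩ := CompSpace.exists_eq_mk w
  let α₁ := (CorrIso.assoc QR PQ P_QR PQ_R).hom
  let α₂ := (CorrIso.assoc RS QR Q_RS QR_S).hom
  have yz := CompSpace.rmom_eq_lmom_of_mk PQ h₂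
  have zs := CompSpace.rmom_eq_lmom_of_mk PQ_R h₃
  have x_yz := CompSpace.rmom_eq_lmom_mk QR h₁ yz
  have yz_s := CompSpace.rmom_mk_eq_lmom QR yz zs
  have x_yz_s := CompSpace.rmom_mk_eq_lmom P_QR x_yz yz_s
  have x_yz_s' := CompSpace.rmom_eq_lmom_mk QR_S x_yz yz_s
  have y_zs := CompSpace.rmom_eq_lmom_mk RS yz zs
  have x_y_zs := CompSpace.rmom_eq_lmom_mk Q_RS h₁ y_zs
  have xy_zs := CompSpace.rmom_eq_lmom_mk RS h₂ zs
  have e₁ := (mapOf_hcomp_mk PQR_S PQR_S' α₁ (𝟙 S) _ s h₃ (mapOf_mem α₁ (𝟙 S) h₃)).trans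
    (CompSpace.mk_congr (mapOf_assoc_mk QR PQ P_QR PQ_R x y z h₁ h₂ yz x_yz) rfl _ x_yz_s)
  have e₂ := mapOf_assoc_mk QR_S P_QR P_QR_S PQR_S' x _ s x_yz x_yz_s yz_s x_yz_s'
  have e₃ := (mapOf_hcomp_mk P_QR_S P_Q_RS (𝟙 P) α₂ x _ x_yz_s' (mapOf_mem (𝟙 P) α₂ x_yz_s')).trans
    (CompSpace.mk_congr rfl (mapOf_assoc_mk RS QR Q_RS QR_S y z s yz yz_s zs y_zs) _ x_y_zs)
  have e₄ := mapOf_assoc_mk RS PQ_R PQ_RS PQR_S _ z s h₂ h₃ zs xy_zs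
  have e₅ := mapOf_assoc_mk Q_RS PQ P_Q_RS PQ_RS x y _ h₁ xy_zs y_zs x_y_zs
  refine ((congrArg _ ((congrArg _ e₁).trans e₂)).trans e₃).trans ?_
  exact ((congrArg (mapOf (CorrIso.assoc Q_RS PQ P_Q_RS PQ_RS).hom) e₄).trans e₅).symm

end Coherence

/-- Identity correspondences and composites exist, and for every choice of composites the second
countable locally compact Hausdorff groupoids with Haar systems, correspondences and isomorphisms
of correspondences form a bicategory, with horizontal composition `[x, y] ↦ [η x, θ y]`,
associator `[[x, y], z] ↦ [x, [y, z]]` and unitors `[γ, x] ↦ γ x` and `[x, γ] ↦ x γ`. -/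
theorem mainTheorem1 :
    (∀ G : HaarGroupoid.{u}, Nonempty (IdCorr G)) ∧
    (∀ {G H K : HaarGroupoid.{u}} (P : Corr G H) (Q : Corr H K), Nonempty (Composite P Q)) ∧
    ∀ (I : ∀ G : HaarGroupoid.{u}, IdCorr G)
      (c : ∀ {G H K : HaarGroupoid.{u}} (P : Corr G H) (Q : Corr H K), Composite P Q),
    ∃ (hc : ∀ {G H K : HaarGroupoid.{u}} {P P' : Corr G H} {Q Q' : Corr H K},
        (P ⟶ P') → (Q ⟶ Q') → ((c P Q).toCorr ⟶ (c P' Q').toCorr))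
      (as : ∀ {G H K L : HaarGroupoid.{u}} (P : Corr G H) (Q : Corr H K) (R : Corr K L),
        (c (c P Q).toCorr R).toCorr ≅ (c P (c Q R).toCorr).toCorr)
      (lu : ∀ {G H : HaarGroupoid.{u}} (P : Corr G H), (c (I G).toCorr P).toCorr ≅ P)
      (ru : ∀ {G H : HaarGroupoid.{u}} (P : Corr G H), (c P (I H).toCorr).toCorr ≅ P),
      -- the underlying maps
      (∀ {G H K : HaarGroupoid.{u}} {P P' : Corr G H} {Q Q' : Corr H K}
        (η : P ⟶ P') (θ : Q ⟶ Q') x y h h',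
        mapOf (hc η θ) (CompSpace.mk P Q x y h) =
          CompSpace.mk P' Q' (mapOf η x) (mapOf θ y) h') ∧
      (∀ {G H K L : HaarGroupoid.{u}} (P : Corr G H) (Q : Corr H K) (R : Corr K L)
        x y z h₁ h₂ h₃ h₄,
        mapOf (as P Q R).hom (CompSpace.mk (c P Q).toCorr R (CompSpace.mk P Q x y h₁) z h₂) =
          CompSpace.mk P (c Q R).toCorr x (CompSpace.mk Q R y z h₃) h₄) ∧
      (∀ {G H : HaarGroupoid.{u}} (P : Corr G H) γ x h h',
        mapOf (lu P).hom (CompSpace.mk (I G).toCorr P γ x h) = P.str.lact ⟨(γ, x), h'⟩) ∧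
      (∀ {G H : HaarGroupoid.{u}} (P : Corr G H) x γ h h',
        mapOf (ru P).hom (CompSpace.mk P (I H).toCorr x γ h) = P.str.ract ⟨(x, γ), h'⟩) ∧
      -- horizontal composition is functorial
      (∀ {G H K : HaarGroupoid.{u}} (P : Corr G H) (Q : Corr H K),
        hc (𝟙 P) (𝟙 Q) = 𝟙 (c P Q).toCorr) ∧
      (∀ {G H K : HaarGroupoid.{u}} {P P' P'' : Corr G H} {Q Q' Q'' : Corr H K}
        (η : P ⟶ P') (η' : P' ⟶ P'') (θ : Q ⟶ Q') (θ' : Q' ⟶ Q''),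
        hc (η ≫ η') (θ ≫ θ') = hc η θ ≫ hc η' θ') ∧
      -- the data form a bicategory
      BicategoryData.IsBicategory.{u, u + 1, u + 1} (B := HaarGroupoid.{u})
        { Hom := fun G H => Corr G H
          id := fun G => (I G).toCorr
          comp := fun P Q => (c P Q).toCorr
          homCategory := fun G H => corrCategory G H
          whiskerLeft := fun P _ _ θ => hc (𝟙 P) θ
          whiskerRight := fun η Q => hc η (𝟙 Q)
          associator := fun P Q R => as P Q R
          leftUnitor := fun P => lu P
          rightUnitor := fun P => ru P } := by
  refine ⟨nonempty_idCorr, nonempty_composite, fun I c => ?_⟩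
  let hc : ∀ {G H K : HaarGroupoid.{u}} {P P' : Corr G H} {Q Q' : Corr H K},
      (P ⟶ P') → (Q ⟶ Q') → ((c P Q).toCorr ⟶ (c P' Q').toCorr) :=
    fun η θ => CorrIso.hcomp (c _ _) (c _ _) η θ
  let as : ∀ {G H K L : HaarGroupoid.{u}} (P : Corr G H) (Q : Corr H K) (R : Corr K L),
      (c (c P Q).toCorr R).toCorr ≅ (c P (c Q R).toCorr).toCorr :=
    fun P Q R => CorrIso.assoc (c Q R) (c P Q) (c P _) (c _ R)
  let lu : ∀ {G H : HaarGroupoid.{u}} (P : Corr G H), (c (I G).toCorr P).toCorr ≅ P :=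
    fun P => (CorrIso.lunit (I _) (c _ P)).toIso
  let ru : ∀ {G H : HaarGroupoid.{u}} (P : Corr G H), (c P (I H).toCorr).toCorr ≅ P :=
    fun P => (CorrIso.runit (I _) (c P _)).toIso
  have hc_id : ∀ {G H K : HaarGroupoid.{u}} (P : Corr G H) (Q : Corr H K),
      hc (𝟙 P) (𝟙 Q) = 𝟙 (c P Q).toCorr := fun P Q => CorrIso.hcomp_id (c P Q)
  have hc_comp : ∀ {G H K : HaarGroupoid.{u}} {P P' P'' : Corr G H} {Q Q' Q'' : Corr H K}
      (η : P ⟶ P') (η' : P' ⟶ P'') (θ : Q ⟶ Q') (θ' : Q' ⟶ Q''),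
      hc (η ≫ η') (θ ≫ θ') = hc η θ ≫ hc η' θ' := fun η η' θ θ' =>
    CorrIso.hcomp_comp (c _ _) (c _ _) (c _ _) η η' θ θ'
  have as_nat : ∀ {G H K L : HaarGroupoid.{u}} {P P' : Corr G H} {Q Q' : Corr H K}
      {R R' : Corr K L} (η : P ⟶ P') (θ : Q ⟶ Q') (κ : R ⟶ R'),
      hc (hc η θ) κ ≫ (as P' Q' R').hom = (as P Q R).hom ≫ hc η (hc θ κ) := fun η θ κ =>
    CorrIso.assoc_naturality (c _ _) (c _ _) (c _ _) (c _ _) (c _ _) (c _ _) (c _ _) (c _ _) η θ κ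
  refine ⟨hc, as, lu, ru, fun η θ x y h h' => mapOf_hcomp_mk (c _ _) (c _ _) η θ x y h h',
    fun P Q R x y z h₁ h₂ h₃ h₄ => mapOf_assoc_mk (c Q R) (c P Q) (c P _) (c _ R) x y z h₁ h₂ h₃ h₄,
    fun P γ x h h' => mapOf_lunit_mk (I _) (c _ P) γ x h h',
    fun P x γ h h' => mapOf_runit_mk (I _) (c P _) x γ h h', hc_id, hc_comp, ?_⟩
  -- Whiskering is horizontal composition with an identity. Functoriality therefore gives the
  -- composition and exchange laws, and naturality of the associator and the unitors, specialised to
  -- identities, gives the remaining laws apart from pentagon and triangle. The closing `rfl` says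
  -- that the bicategory has exactly the prescribed data.
  refine ⟨{
    Hom := fun G H => Corr G H
    id := fun G => (I G).toCorr
    comp := fun P Q => (c P Q).toCorr
    homCategory := fun G H => corrCategory G H
    whiskerLeft := fun P _ _ θ => hc (𝟙 P) θ
    whiskerRight := fun η Q => hc η (𝟙 Q)
    associator := fun P Q R => as P Q R
    leftUnitor := fun P => lu P
    rightUnitor := fun P => ru P
    whiskerLeft_id := hc_id
    whiskerLeft_comp := fun P _ _ _ η θ => by
      rw [← hc_comp, Category.comp_id]
    id_whiskerLeft := fun η => by
      rw [← Category.assoc, Iso.eq_comp_inv]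
      exact CorrIso.lunit_naturality (I _) (c _ _) (c _ _) η
    comp_whiskerLeft := fun P Q _ _ η => by
      rw [← Category.assoc, Iso.eq_comp_inv, ← as_nat, hc_id]
    id_whiskerRight := hc_id
    comp_whiskerRight := fun η θ Q => by
      rw [← hc_comp, Category.comp_id]
    whiskerRight_id := fun η => by
      rw [← Category.assoc, Iso.eq_comp_inv]
      exact CorrIso.runit_naturality (I _) (c _ _) (c _ _) η
    whiskerRight_comp := fun η Q R => by
      rw [Iso.eq_inv_comp, as_nat, hc_id]
    whisker_assoc := fun P _ _ η R => by
      rw [← Category.assoc, Iso.eq_comp_inv, as_nat]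
    whisker_exchange := fun η θ => by
      rw [← hc_comp, ← hc_comp, Category.id_comp, Category.id_comp, Category.comp_id,
        Category.comp_id]
    pentagon := fun P Q R S => CorrIso.pentagon (c P Q) (c Q R) (c R S) (c _ R) (c P _) (c _ S)
      (c Q _) (c _ _) (c P _) (c P _) (c _ S) (c _ S)
    triangle := fun P Q => CorrIso.triangle (I _) (c _ Q) (c P _) (c P _) (c _ Q) (c P Q) }, rfl⟩
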